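/- Let $\mathfrak g=\mathfrak{ham}_2^0$ be the Lie algebra of formal Hamiltonian vector fields on $\mathbb R^2$ vanishing at the origin, identified with the formal power series in $q,p$ over $\mathbb R$ without terms of degree $0$ and $1$, with the Poisson bracket $\{f,g\}=\frac{\partial f}{\partial q}\frac{\partial g}{\partial p}-\frac{\partial f}{\partial p}\frac{\partial g}{\partial q}$ and the topology of coefficientwise convergence; let $S^\ell\subset\mathfrak g$ be the homogeneous polynomials of degree $\ell\ge 2$, so that $S^2=\mathfrak{sp}(2,\mathbb R)$. For $m\ge 0$ let $C^m(\mathfrak g)$ be the continuous alternating $\mathbb R$-multilinear maps $\mathfrak g^m\to\mathbb R$, with the coboundary $$(d\sigma)(X_0,\dots,X_m)=\sum_{i<j}(-1)^{i+j}\sigma([X_i,X_j],X_0,\dots,\widehat{X_i},\dots,\widehat{X_j},\dots,X_m),$$ and let $C^m(\mathfrak g,\mathfrak{sp}(2,\mathbb R))$ be the relative cochains, i.e. those $\sigma$ with $i_X\sigma=0$ and $i_Xd\sigma=0$ for all $X\in\mathfrak{sp}(2,\mathbb R)$. For $m\ge 1$ a cochain has weight $w$ if it vanishes on $S^{\ell_1}\times\dots\times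 S^{\ell_m}$ whenever $\sum_i(\ell_i-2)\ne w$; let $C^m_w$ be the space of relative $m$-cochains of weight $w$. By convention $C^0_w=\mathbb R$ (the constants) for every $w$. Let $H^m_w$ be the cohomology in degree $m$ of the complex $(C^\bullet_w,d)$, the relative Gel'fand–Kalinin–Fuks cohomology of weight $w$. For weight $w=20$, all $C^m_{20}$ are finite-dimensional, with dimensions $$\begin{array}{c|cccccccccccc} m&0&1&2&3&4&5&6&7&8&9&10&11\\\hline \dim C^m_{20}&1&0&0&17&124&423&791&801&414&96&9&1\end{array}$$ and $C^m_{20}=0$ for $m\ge 12$. Hence the Euler characteristic $\chi=\sum_{m\ge 0}(-1)^m\dim C^m_{20}$ equals $1$. The Betti numbers of weight $20$ are all trivial except in degree $0$: $\dim H^0_{20}=1$, and $H^m_{20}=0$ for all $m\ge 1$. -/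

import Mathlib

open scoped MvPowerSeries.WithPiTopology

noncomputable section

namespace GKF

/-! Continuous Chevalley–Eilenberg cochains (trivial coefficients) of a topological Lie algebra. -/

section Cochains

variable (g : Type*) [LieRing g] [LieAlgebra ℝ g] [TopologicalSpace g]

/-- All functions of `m` arguments in `g`; the cochains are the continuous alternating
multilinear ones among them. -/
abbrev Fun (m : ℕ) : Type _ := (Fin m → g) → ℝ

/-- `C^m(g)`: continuous, alternating, `ℝ`-multilinear maps `g × ⋯ × g → ℝ`. -/
def cochain (m : ℕ) : Submodule ℝ (Fun g m) where
  carrier := {σ | ∃ φ : g [⋀^Fin m]→L[ℝ] ℝ, ⇑φ = σ}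
  zero_mem' := ⟨0, rfl⟩
  add_mem' := by
    rintro _ _ ⟨φ, rfl⟩ ⟨ψ, rfl⟩
    exact ⟨φ + ψ, rfl⟩
  smul_mem' := by
    rintro c _ ⟨φ, rfl⟩
    exact ⟨c • φ, rfl⟩

variable {g}

/-- The coboundary operator
`(dσ)(X₀, …, Xₘ) = ∑_{i < j} (-1)^{i+j} σ([Xᵢ, Xⱼ], X₀, …, X̂ᵢ, …, X̂ⱼ, …, Xₘ)`.
For `i < j` the tuple with both entries removed is `k ↦ X (j.succAbove (i.succAbove k))`;
on `0`-cochains the sum is empty. -/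
def d : ∀ m : ℕ, Fun g m →ₗ[ℝ] Fun g (m + 1)
  | 0 => 0
  | m + 1 =>
    { toFun := fun σ X => ∑ j : Fin (m + 2), ∑ i : Fin (m + 1),
        if i.castSucc < j then
          (-1 : ℝ) ^ ((i : ℕ) + (j : ℕ)) *
            σ (Fin.cons ⁅X i.castSucc, X j⁆ fun k : Fin m => X (j.succAbove (i.succAbove k)))
        else 0
      map_add' := by
        intro σ τ
        funext X
        simp only [Pi.add_apply, ← Finset.sum_add_distrib]
        refine Finset.sum_congr rfl fun j _ => Finset.sum_congr rfl fun i _ => ?_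
        split_ifs <;> ring
      map_smul' := by
        intro c σ
        funext X
        simp only [Pi.smul_apply, smul_eq_mul, RingHom.id_apply, Finset.mul_sum]
        refine Finset.sum_congr rfl fun j _ => Finset.sum_congr rfl fun i _ => ?_
        split_ifs <;> ring }

/-- The interior product `(i_X σ)(Y₁, …, Yₘ₋₁) = σ(X, Y₁, …, Yₘ₋₁)`, zero on `0`-cochains. -/
def interiorProd (X : g) : ∀ m : ℕ, Fun g m →ₗ[ℝ] Fun g (m - 1)
  | 0 => 0
  | m + 1 =>
    { toFun := fun σ Y => σ (Fin.cons X Y : Fin (m + 1) → g)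
      map_add' := fun _ _ => rfl
      map_smul' := fun _ _ => rfl }

/-- `C^m(g, k)`: the cochains `σ` with `i_X σ = 0` and `i_X dσ = 0` for all `X ∈ k`. -/
def relCochain (k : LieSubalgebra ℝ g) (m : ℕ) : Submodule ℝ (Fun g m) :=
  cochain g m ⊓
    ⨅ X ∈ k, LinearMap.ker (interiorProd X m) ⊓ LinearMap.ker (interiorProd X (m + 1) ∘ₗ d m)

end Cochains

/-! The Lie algebra of formal Hamiltonian vector fields of the plane vanishing at the origin. -/

/-- Formal power series in two variables `q = X 0`, `p = X 1`. -/
abbrev Series : Type := MvPowerSeries (Fin 2) ℝ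

/-- The Poisson bracket `{f, g} = ∂f/∂q ∂g/∂p - ∂f/∂p ∂g/∂q`. -/
def poisson (f g : Series) : Series :=
  MvPowerSeries.pderiv ℝ 0 f * MvPowerSeries.pderiv ℝ 1 g -
    MvPowerSeries.pderiv ℝ 1 f * MvPowerSeries.pderiv ℝ 0 g

/-- Hamiltonian potentials with no terms of degree `0` and `1`. -/
def ham0Submodule : Submodule ℝ Series where
  carrier := {f | ∀ n : Fin 2 →₀ ℕ, n.degree < 2 → MvPowerSeries.coeff n f = 0}
  zero_mem' := fun _ _ => by simp
  add_mem' := fun hf hg n hn => by simp [hf n hn, hg n hn]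
  smul_mem' := fun c f hf n hn => by simp [hf n hn]

theorem pderiv_comm (i j : Fin 2) (f : Series) :
    MvPowerSeries.pderiv ℝ i (MvPowerSeries.pderiv ℝ j f) =
      MvPowerSeries.pderiv ℝ j (MvPowerSeries.pderiv ℝ i f) := by
  by_cases h : i = j
  · rw [h]
  · ext n
    simp only [MvPowerSeries.coeff_pderiv, Finsupp.add_apply, Finsupp.single_apply, if_neg h,
      if_neg (Ne.symm h), add_right_comm n, add_zero]
    ring

theorem pderiv_coeff_zero {f : Series} (hf : f ∈ ham0Submodule) (i : Fin 2) :
    MvPowerSeries.coeff 0 (MvPowerSeries.pderiv ℝ i f) = 0 := by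
  rw [MvPowerSeries.coeff_pderiv, hf _ (by simp), zero_mul]

theorem mul_mem_ham0 {a b : Series} (ha : MvPowerSeries.coeff 0 a = 0)
    (hb : MvPowerSeries.coeff 0 b = 0) : a * b ∈ ham0Submodule := by
  intro n hn
  rw [MvPowerSeries.coeff_mul]
  refine Finset.sum_eq_zero fun x hx => ?_
  rw [Finset.HasAntidiagonal.mem_antidiagonal] at hx
  have h : x.1.degree + x.2.degree < 2 := by rw [← map_add, hx]; exact hn
  have h' : x.1.degree = 0 ∨ x.2.degree = 0 := by omega
  rcases h' with h' | h'
  · rw [(Finsupp.degree_eq_zero_iff _).1 h', ha, zero_mul]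
  · rw [(Finsupp.degree_eq_zero_iff _).1 h', hb, mul_zero]

theorem poisson_mem {f g : Series} (hf : f ∈ ham0Submodule) (hg : g ∈ ham0Submodule) :
    poisson f g ∈ ham0Submodule :=
  sub_mem (mul_mem_ham0 (pderiv_coeff_zero hf 0) (pderiv_coeff_zero hg 1))
    (mul_mem_ham0 (pderiv_coeff_zero hf 1) (pderiv_coeff_zero hg 0))

/-- Formal Hamiltonian vector fields of the plane vanishing at the origin, identified with their
potentials; its topology is that of coefficientwise convergence. -/
abbrev Ham0 : Type := ↥ham0Submodule

instance : LieRing Ham0 where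
  bracket f g := ⟨poisson f g, poisson_mem f.2 g.2⟩
  add_lie f g h := Subtype.ext <| by simp only [poisson, Submodule.coe_add, map_add]; ring
  lie_add f g h := Subtype.ext <| by simp only [poisson, Submodule.coe_add, map_add]; ring
  lie_self f := Subtype.ext <| by simp only [poisson, Submodule.coe_zero]; ring
  leibniz_lie f g h := Subtype.ext <| by
    simp only [poisson, Submodule.coe_add, map_sub, Derivation.leibniz, smul_eq_mul]
    rw [pderiv_comm 1 0 f.1, pderiv_comm 1 0 g.1, pderiv_comm 1 0 h.1]
    ring

instance : LieAlgebra ℝ Ham0 where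
  lie_smul c f g := Subtype.ext <| by
    change poisson f (c • g : Series) = c • poisson f g
    simp only [poisson, Derivation.map_smul, smul_sub, mul_smul_comm]

theorem coe_lie (f g : Ham0) : ((⁅f, g⁆ : Ham0) : Series) = poisson f g := rfl

/-- `f ∈ S^ℓ`: only monomials of total degree `ℓ` occur in `f`. -/
def IsHomog (f : Ham0) (l : ℕ) : Prop := MvPowerSeries.IsHomogeneous (f : Series) l

/-- The quadratic Hamiltonians `S²`, i.e. the Lie algebra `sp(2, ℝ)` of linear Hamiltonian
vector fields. -/
def sp2 : LieSubalgebra ℝ Ham0 where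
  carrier := {f | ∀ n : Fin 2 →₀ ℕ, n.degree ≠ 2 → MvPowerSeries.coeff n (f : Series) = 0}
  zero_mem' := fun _ _ => by simp
  add_mem' := fun hf hg n hn => by simp [hf n hn, hg n hn]
  smul_mem' := fun c f hf n hn => by simp [hf n hn]
  lie_mem' := by
    have key : ∀ (f : Ham0), (∀ n : Fin 2 →₀ ℕ, n.degree ≠ 2 →
        MvPowerSeries.coeff n (f : Series) = 0) → ∀ (i : Fin 2) (n : Fin 2 →₀ ℕ), n.degree ≠ 1 →
        MvPowerSeries.coeff n (MvPowerSeries.pderiv ℝ i (f : Series)) = 0 := by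
      intro f hf i n hn
      rw [MvPowerSeries.coeff_pderiv, hf _ (by simpa using hn), zero_mul]
    intro f g hf hg n hn
    have hmul : ∀ i j : Fin 2, MvPowerSeries.coeff n
        (MvPowerSeries.pderiv ℝ i (f : Series) * MvPowerSeries.pderiv ℝ j (g : Series)) = 0 := by
      intro i j
      rw [MvPowerSeries.coeff_mul]
      refine Finset.sum_eq_zero fun x hx => ?_
      rw [Finset.HasAntidiagonal.mem_antidiagonal] at hx
      have h : x.1.degree + x.2.degree ≠ 2 := by rw [← map_add, hx]; exact hn
      by_cases h1 : x.1.degree = 1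
      · rw [key g hg j x.2 (by omega), mul_zero]
      · rw [key f hf i x.1 h1, zero_mul]
    rw [coe_lie, poisson, map_sub, hmul, hmul, sub_zero]

/-! The weight decomposition, and relative cohomology in a fixed weight. -/

/-- Functions of weight `w`: they vanish on `S^{ℓ₁} × ⋯ × S^{ℓₘ}` unless `∑ (ℓᵢ - 2) = w`.
By convention the constants (degree `0`) are kept in the complex of every weight. -/
def weightPart (w : ℤ) (m : ℕ) : Submodule ℝ (Fun Ham0 m) where
  carrier := {σ | m ≠ 0 → ∀ (l : Fin m → ℕ) (X : Fin m → Ham0), (∀ i, IsHomog (X i) (l i)) →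
    ∑ i, ((l i : ℤ) - 2) ≠ w → σ X = 0}
  zero_mem' := fun _ _ _ _ _ => rfl
  add_mem' := fun hσ hτ h0 l X hX hw => by
    simp [hσ h0 l X hX hw, hτ h0 l X hX hw]
  smul_mem' := fun c σ hσ h0 l X hX hw => by
    simp [hσ h0 l X hX hw]

/-- The relative cochains of degree `m` and weight `w`. -/
def C (w : ℤ) (m : ℕ) : Submodule ℝ (Fun Ham0 m) := relCochain sp2 m ⊓ weightPart w m

/-- Relative cocycles. -/
def Z (w : ℤ) (m : ℕ) : Submodule ℝ (Fun Ham0 m) := C w m ⊓ LinearMap.ker (d m)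

/-- Relative coboundaries. -/
def B (w : ℤ) : ∀ m : ℕ, Submodule ℝ (Fun Ham0 m)
  | 0 => ⊥
  | m + 1 => (C w m).map (d m)

/-- The relative Gel'fand–Kalinin–Fuks cohomology in degree `m` and weight `w`: cocycles modulo
coboundaries (the latter regarded as a subspace of the cocycles). -/
abbrev H (w : ℤ) (m : ℕ) : Type := ↥(Z w m) ⧸ (B w m).submoduleOf (Z w m)

/-- The Betti numbers. -/
def betti (w : ℤ) (m : ℕ) : ℕ := Module.finrank ℝ (H w m)

/-- The Euler characteristic: the alternating sum of the cochain dimensions, including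
degree `0`. -/
def eulerChar (w : ℤ) : ℤ := ∑ᶠ m : ℕ, (-1 : ℤ) ^ m * (Module.finrank ℝ (C w m) : ℤ)

end GKF

end

/-! Dimensions. Continuous multilinear cochains are determined by their values on tuples of
monomials q^i p^j. By Cartan's formula, the relative cochains of positive degree are the
sp(2)-invariant cochains that vanish as soon as an argument is quadratic (`C_eq_R`). For weight 20
and m arguments the total degree of a tuple is 20 + 2m, and qp acts through the degree h in p, the
height. By the representation theory of sl(2), the invariants form the kernel of the lowering
operator at the middle height 10 + m, and this operator maps onto height 9 + m (`lower_surjective`).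
Hence dim C^m is the number of strictly increasing monomial tuples of height 10 + m minus the number
of height 9 + m (`finrank_R`). Both counts are coefficients of a generating function, read off as
digits of its value at a large base (`finrank_R_eq`).

Cohomology. Suppose that r_m bounds the rank of d on C^m from below and that r_(m-1) + r_m = dim
C^m. Then the cocycles have dimension at most r_(m-1), which is at most the dimension of the
coboundaries; since d² = 0, the two spaces agree (`betti_eq_zero`). The ranks 17, 107, 316, 475,
326, 88, 8, 1 in degrees 3 to 10 do this. Only lower bounds for ranks are needed, so d may be
restricted to invariants supported on suitable multisets of degrees (types), and the dimension of
its kernel there may be estimated modulo the prime 8191: reduction of an integral linear system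
modulo a prime can only enlarge the solution space (`finrank_Sol_le`).

The kernel modulo 8191. The function `kerDim` computes an upper bound for it
(`finrank_W_le_kerDim`). The invariance relations express the value at any tuple of a type through
the values at free tuples, in which one chosen monomial is a pure power of q and another a pure
power of p (`red_rep`). Behind this is the fact that a tensor product of two irreducible
representations is generated by the product of an extreme vector of one with the opposite extreme
vector of the other. The values at the free tuples are then eliminated with selected equations, one
block of types after another. In each block the types of earlier blocks are already absent, and an
equation that involves a later block is recognised by a huge sentinel value and discarded. Leaving
out equations only weakens the bound, so a certificate (types, chosen positions, selected equations)
has nothing to prove about completeness.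

Encoding. A monomial of degree l with exponent k of p has the code 32 l + k. A tuple is a number in
base 2^10, and a linear combination of free tuples is a number in base 2^40 whose digits count
modulo 8191 = 2^13 - 1. Vector operations thus become single operations on large natural numbers,
which the kernel evaluates quickly. -/

noncomputable section

set_option exponentiation.threshold 10000
set_option linter.unusedSectionVars false
set_option linter.unusedVariables false

namespace GKF


/-! ### Cartan calculus on alternating cochains of a Lie algebra. -/

section Cartan

variable {g : Type*} [LieRing g] [LieAlgebra ℝ g]

/-- Alternating multilinear functions, without continuity. -/
def IsAlt {m : ℕ} (σ : Fun g m) : Prop := ∃ φ : g [⋀^Fin m]→ₗ[ℝ] ℝ, ⇑φ = σ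

/-- The Lie derivative of a function of `m` arguments. -/
def lieDer (X : g) (m : ℕ) : Fun g m →ₗ[ℝ] Fun g m where
  toFun σ Y := -∑ i, σ (Function.update Y i ⁅X, Y i⁆)
  map_add' σ τ := by
    funext Y
    simp only [Pi.add_apply, Finset.sum_add_distrib, neg_add]
  map_smul' c σ := by
    funext Y
    simp only [Pi.smul_apply, smul_eq_mul, RingHom.id_apply, ← Finset.mul_sum, mul_neg]

theorem lieDer_apply (X : g) {m : ℕ} (σ : Fun g m) (Y : Fin m → g) :
    lieDer X m σ Y = -∑ i, σ (Function.update Y i ⁅X, Y i⁆) := rfl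

/-- The interior product on functions of at least one argument. -/
def ip (X : g) {m : ℕ} : Fun g (m + 1) →ₗ[ℝ] Fun g m := interiorProd X (m + 1)

theorem ip_apply (X : g) {m : ℕ} (σ : Fun g (m + 1)) (Y : Fin m → g) :
    ip X σ Y = σ (Fin.cons X Y : Fin (m + 1) → g) := rfl

/-- Contractions determine a function of at least one argument; this is what allows the operator
identities below to be proved by induction on the degree. -/
theorem fun_ext_ip {m : ℕ} {σ τ : Fun g (m + 1)} (h : ∀ X, ip X σ = ip X τ) : σ = τ := by
  funext Y
  have := congrFun (h (Y 0)) (Fin.tail Y)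
  simpa only [ip_apply, Fin.cons_self_tail] using this

theorem IsAlt.ip {m : ℕ} {σ : Fun g (m + 1)} (h : IsAlt σ) (X : g) : IsAlt (ip X σ) := by
  obtain ⟨φ, rfl⟩ := h
  exact ⟨φ.curryLeft X, rfl⟩

theorem IsAlt.add {m : ℕ} {σ τ : Fun g m} (h : IsAlt σ) (h' : IsAlt τ) : IsAlt (σ + τ) := by
  obtain ⟨φ, rfl⟩ := h
  obtain ⟨ψ, rfl⟩ := h'
  exact ⟨φ + ψ, rfl⟩

theorem IsAlt.ip_sub {m : ℕ} {σ : Fun g (m + 1)} (h : IsAlt σ) (X Y : g) :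
    GKF.ip (X - Y) σ = GKF.ip X σ - GKF.ip Y σ := by
  obtain ⟨φ, rfl⟩ := h
  funext v
  exact congrFun (congrArg DFunLike.coe (map_sub φ.curryLeft X Y)) v

/-- In the sum defining the Lie derivative, the term at the first position is the contraction with
the bracket, and the other terms form the Lie derivative of the contraction. No alternation is
involved. -/
theorem ip_lieDer (X Y : g) {m : ℕ} (σ : Fun g (m + 1)) :
    ip Y (lieDer X (m + 1) σ) = lieDer X m (ip Y σ) - ip ⁅X, Y⁆ σ := by
  funext v
  simp only [ip_apply, lieDer_apply, Pi.sub_apply]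
  rw [Fin.sum_univ_succ]
  simp only [Fin.cons_zero, Fin.update_cons_zero, Fin.cons_succ, ← Fin.cons_update]
  ring

theorem IsAlt.map_cons_cons {m : ℕ} {σ : Fun g (m + 2)} (h : IsAlt σ) (X Y : g) (v : Fin m → g) :
    σ (Fin.cons X (Fin.cons Y v : Fin (m + 1) → g)) =
      -σ (Fin.cons Y (Fin.cons X v : Fin (m + 1) → g)) := by
  obtain ⟨φ, rfl⟩ := h
  rw [← φ.map_swap _ (show (0 : Fin (m + 2)) ≠ 1 by simp)]
  congr 1
  funext i
  refine Fin.cases ?_ (fun i => Fin.cases ?_ (fun i => ?_) i) i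
  · simp
  · simp
  · have h0 : (i.succ.succ : Fin (m + 2)) ≠ 0 := Fin.succ_ne_zero _
    have h1 : (i.succ.succ : Fin (m + 2)) ≠ 1 := by
      rw [← Fin.succ_zero_eq_one]
      exact fun h => Fin.succ_ne_zero _ (Fin.succ_injective _ h)
    rw [Function.comp_apply, Equiv.swap_apply_of_ne_of_ne h0 h1]
    simp

theorem IsAlt.map_update {m : ℕ} {σ : Fun g (m + 1)} (h : IsAlt σ) (Z : g) (j : Fin (m + 1))
    (Y : Fin (m + 1) → g) :
    σ (Function.update Y j Z) = (-1) ^ (j : ℕ) * σ (Fin.cons Z fun k => Y (j.succAbove k)) := by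
  obtain ⟨φ, rfl⟩ := h
  have := φ.map_insertNth j Z (j.removeNth Y)
  rw [Fin.insertNth_removeNth] at this
  rw [this, zsmul_eq_mul]
  norm_cast

theorem d_succ_apply {m : ℕ} (σ : Fun g (m + 1)) (X : Fin (m + 2) → g) :
    d (m + 1) σ X = ∑ j : Fin (m + 2), ∑ i : Fin (m + 1),
        if i.castSucc < j then
          (-1 : ℝ) ^ ((i : ℕ) + (j : ℕ)) *
            σ (Fin.cons ⁅X i.castSucc, X j⁆ fun k : Fin m => X (j.succAbove (i.succAbove k)))
        else 0 := rfl

/-- Cartan's formula. The pairs of indices containing 0 give the Lie derivative. In the remaining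
pairs both indices are shifted by one, which keeps the sign, and interchanging X with the bracket in
the first two slots produces the minus sign in front of d. -/
theorem IsAlt.ip_d {m : ℕ} {σ : Fun g (m + 1)} (h : IsAlt σ) (X : g) :
    GKF.ip X (d (m + 1) σ) = lieDer X (m + 1) σ - d m (GKF.ip X σ) := by
  funext Y
  have h0 : ∀ i : Fin (m + 1), ¬ i.castSucc < (0 : Fin (m + 2)) := fun i => Fin.not_lt_zero _
  rw [ip_apply, d_succ_apply, Pi.sub_apply, lieDer_apply, Fin.sum_univ_succ]
  simp only [h0, if_false, Finset.sum_const_zero, zero_add]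
  have key : ∀ j : Fin (m + 1), (-1 : ℝ) ^ (((0 : Fin (m + 1)) : ℕ) + (j.succ : ℕ)) *
      σ (Fin.cons ⁅X, Y j⁆ fun k : Fin m =>
        (Fin.cons X Y : Fin (m + 2) → g) (j.succ.succAbove ((0 : Fin (m + 1)).succAbove k))) =
      -σ (Function.update Y j ⁅X, Y j⁆) := by
    intro j
    rw [h.map_update]
    simp only [Fin.zero_succAbove, Fin.succ_succAbove_succ, Fin.cons_succ, Fin.val_zero,
      Fin.val_succ]
    ring
  rw [Finset.sum_congr rfl fun j _ => Fin.sum_univ_succ _, Finset.sum_add_distrib]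
  simp only [Fin.castSucc_zero, Fin.succ_pos, if_true, Fin.cons_zero, Fin.cons_succ, key,
    Finset.sum_neg_distrib, sub_eq_add_neg]
  congr 1
  cases m with
  | zero => simp [d]
  | succ m =>
    rw [d_succ_apply, ← Finset.sum_neg_distrib]
    refine Finset.sum_congr rfl fun j _ => ?_
    rw [← Finset.sum_neg_distrib]
    refine Finset.sum_congr rfl fun i _ => ?_
    have hlt : i.succ.castSucc < j.succ ↔ i.castSucc < j := by
      rw [← Fin.succ_castSucc, Fin.succ_lt_succ_iff]
    simp only [hlt]
    split_ifs with hij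
    · have : (fun k : Fin (m + 1) => (Fin.cons X Y : Fin (m + 3) → g)
          (j.succ.succAbove (i.succ.succAbove k))) =
          Fin.cons X fun k : Fin m => Y (j.succAbove (i.succAbove k)) := by
        funext k
        refine Fin.cases ?_ (fun k => ?_) k
        · simp
        · simp
      rw [this, ← Fin.succ_castSucc, Fin.cons_succ, h.map_cons_cons, ip_apply]
      simp only [Fin.val_succ]
      ring
    · simp

theorem d_zero_apply (σ : Fun g 0) : d 0 σ = 0 := rfl

theorem lieDer_zero_apply (X : g) (σ : Fun g 0) : lieDer X 0 σ = 0 := by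
  funext Y
  simp [lieDer_apply]

/-- The coboundary is -1/2 times the double alternatization of the contraction of φ by ⁅X, Y⁆: each
pair occurs in both orders, and as the bracket is skew each term is counted twice. -/
theorem IsAlt.d {m : ℕ} {σ : Fun g m} (h : IsAlt σ) : IsAlt (d m σ) := by
  obtain ⟨φ, rfl⟩ := h
  cases m with
  | zero => exact ⟨0, rfl⟩
  | succ m =>
    let f : g →ₗ[ℝ] g →ₗ[ℝ] g [⋀^Fin m]→ₗ[ℝ] ℝ :=
      LinearMap.mk₂ ℝ (fun X Y => φ.curryLeft ⁅X, Y⁆) (by simp) (by simp) (by simp) (by simp)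
    refine ⟨-(1 / 2 : ℝ) • AlternatingMap.alternatizeUncurryFin
      (AlternatingMap.alternatizeUncurryFinLM ∘ₗ f), ?_⟩
    funext X
    have h0 : ∀ i : Fin (m + 1), ¬ i.castSucc < (0 : Fin (m + 2)) := fun i => Fin.not_lt_zero _
    rw [AlternatingMap.smul_apply,
      AlternatingMap.alternatizeUncurryFin_alternatizeUncurryFinLM_comp_apply, d_succ_apply,
      Fin.sum_univ_succ (n := m + 1)]
    simp only [h0, if_false, Finset.sum_const_zero, zero_add]
    rw [Finset.sum_comm, Finset.smul_sum]
    refine Finset.sum_congr rfl fun i _ => ?_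
    rw [Finset.smul_sum, ← Finset.sum_filter]
    have : Finset.univ.filter (fun j : Fin (m + 1) => i.castSucc < j.succ) = Finset.Ici i := by
      ext j
      rw [Finset.mem_filter, Finset.mem_Ici, Fin.lt_def, Fin.le_iff_val_le_val, Fin.val_succ,
        Fin.val_castSucc, Nat.lt_succ_iff]
      exact and_iff_right (Finset.mem_univ _)
    rw [this]
    refine Finset.sum_congr rfl fun j hj => ?_
    rw [Finset.mem_Ici] at hj
    have h1 : (fun k : Fin m => X (j.succ.succAbove (i.succAbove k))) =
        j.removeNth (i.castSucc.removeNth X) := by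
      have h2 : i.castSucc.succAbove j = j.succ := Fin.succAbove_of_le_castSucc _ _ hj
      have h3 : j.predAbove i.castSucc = i := by simp [Fin.predAbove, hj]
      rw [Fin.removeNth_removeNth_eq_swap, h2, h3]
      rfl
    rw [h1]
    have h2 : ⁅X j.succ, X i.castSucc⁆ = -⁅X i.castSucc, X j.succ⁆ := (lie_skew _ _).symm
    simp only [f, LinearMap.mk₂_apply, h2, map_neg, AlternatingMap.neg_apply, zsmul_eq_mul,
      smul_eq_mul, AlternatingMap.curryLeft_apply_apply, Fin.val_succ, Matrix.vecCons]
    push_cast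
    ring

/-- Cartan's formula read backwards: L_X is composed of d and contractions, all of which preserve
alternation. -/
theorem IsAlt.lieDer {m : ℕ} {σ : Fun g m} (h : IsAlt σ) (X : g) : IsAlt (lieDer X m σ) := by
  cases m with
  | zero =>
    rw [lieDer_zero_apply]
    exact ⟨0, rfl⟩
  | succ m =>
    rw [← sub_add_cancel (GKF.lieDer X (m + 1) σ) (GKF.d m (GKF.ip X σ)), ← h.ip_d]
    exact (h.d.ip X).add (h.ip X).d

/-- By induction on the degree: after contraction with Z, the terms left over beside the induction
hypothesis match by the Jacobi identity. -/
theorem IsAlt.lieDer_lie {m : ℕ} {σ : Fun g m} (h : IsAlt σ) (X Y : g) :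
    GKF.lieDer X m (GKF.lieDer Y m σ) - GKF.lieDer Y m (GKF.lieDer X m σ) =
      GKF.lieDer ⁅X, Y⁆ m σ := by
  induction m with
  | zero => simp only [lieDer_zero_apply, sub_zero]
  | succ m ih =>
    refine fun_ext_ip fun Z => ?_
    have h3 : ⁅⁅X, Y⁆, Z⁆ = ⁅X, ⁅Y, Z⁆⁆ - ⁅Y, ⁅X, Z⁆⁆ := lie_lie X Y Z
    simp only [map_sub, ip_lieDer, ← ih (h.ip Z), h3, h.ip_sub]
    abel

/-- Both identities go through one induction, since contraction lowers the degree. For the second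
one, Cartan's formula used twice gives ι_X d d σ = L_X d σ - d L_X σ + d d ι_X σ; here the first
identity cancels two terms and the induction hypothesis kills the third. -/
theorem IsAlt.d_lieDer_and_d_d {m : ℕ} {σ : Fun g m} (h : IsAlt σ) :
    (∀ X, GKF.lieDer X (m + 1) (GKF.d m σ) = GKF.d m (GKF.lieDer X m σ)) ∧
      GKF.d (m + 1) (GKF.d m σ) = 0 := by
  induction m with
  | zero =>
    refine ⟨fun X => ?_, ?_⟩
    · rw [lieDer_zero_apply, d_zero_apply, d_zero_apply, map_zero]
    · rw [d_zero_apply, map_zero]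
  | succ m ih =>
    have h1 : ∀ X, GKF.lieDer X (m + 2) (GKF.d (m + 1) σ) =
        GKF.d (m + 1) (GKF.lieDer X (m + 1) σ) := by
      intro X
      refine fun_ext_ip fun Y => ?_
      rw [ip_lieDer, h.ip_d, h.ip_d, (h.lieDer X).ip_d, ip_lieDer, map_sub, map_sub,
        (ih (h.ip Y)).1, ← h.lieDer_lie]
      abel
    refine ⟨h1, fun_ext_ip fun X => ?_⟩
    rw [h.d.ip_d, h.ip_d, map_sub, (ih (h.ip X)).2, h1, map_zero]
    abel

end Cartan


/-! Monomials. -/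

/-- The exponent of `q ^ a.1 * p ^ a.2`. -/
def xp (a : ℕ × ℕ) : Fin 2 →₀ ℕ := Finsupp.single 0 a.1 + Finsupp.single 1 a.2

@[simp] theorem xp_zero (a : ℕ × ℕ) : xp a 0 = a.1 := by simp [xp]

@[simp] theorem xp_one (a : ℕ × ℕ) : xp a 1 = a.2 := by simp [xp]

theorem xp_apply (n : Fin 2 →₀ ℕ) : xp (n 0, n 1) = n := by
  ext i
  fin_cases i <;> simp

theorem xp_injective : Function.Injective xp := fun a b h =>
  Prod.ext (by simpa using DFunLike.congr_fun h 0) (by simpa using DFunLike.congr_fun h 1)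

theorem degree_xp (a : ℕ × ℕ) : (xp a).degree = a.1 + a.2 := by
  simp [xp]

/-- The monomial `q ^ a.1 * p ^ a.2`, when its degree is at least `2`. -/
def mono (a : ℕ × ℕ) : Ham0 :=
  if h : 2 ≤ a.1 + a.2 then
    ⟨MvPowerSeries.monomial (xp a) 1, fun n hn => by
      rw [MvPowerSeries.coeff_monomial, if_neg]
      rintro rfl
      rw [degree_xp] at hn
      omega⟩
  else 0

theorem coe_mono {a : ℕ × ℕ} (h : 2 ≤ a.1 + a.2) :
    (mono a : Series) = MvPowerSeries.monomial (xp a) 1 := by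
  rw [mono, dif_pos h]

theorem coeff_mono {a : ℕ × ℕ} (h : 2 ≤ a.1 + a.2) (b : ℕ × ℕ) :
    MvPowerSeries.coeff (xp b) (mono a : Series) = if b = a then 1 else 0 := by
  rw [coe_mono h, MvPowerSeries.coeff_monomial]
  simp only [xp_injective.eq_iff]

theorem isHomog_mono {a : ℕ × ℕ} (h : 2 ≤ a.1 + a.2) : IsHomog (mono a) (a.1 + a.2) := by
  rw [IsHomog, coe_mono h, ← degree_xp]
  intro n hn
  by_contra hne
  refine hn ?_
  rw [MvPowerSeries.coeff_monomial, if_neg]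
  rintro rfl
  exact hne (by rw [Finsupp.degree_eq_weight_one]; rfl)

theorem monomial_xp (a : ℕ × ℕ) : (MvPowerSeries.monomial (xp a) 1 : Series) =
    MvPowerSeries.X 0 ^ a.1 * MvPowerSeries.X 1 ^ a.2 := by
  rw [MvPowerSeries.X_pow_eq, MvPowerSeries.X_pow_eq, MvPowerSeries.monomial_mul_monomial, mul_one,
    xp]

/-- The truncated subtraction in the exponents is harmless: if one of the exponent sums is 0, the
coefficient vanishes. -/
theorem poisson_monomial (a b : ℕ × ℕ) :
    poisson (MvPowerSeries.monomial (xp a) 1) (MvPowerSeries.monomial (xp b) 1) =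
      ((a.1 * b.2 - a.2 * b.1 : ℝ)) •
        MvPowerSeries.monomial (xp (a.1 + b.1 - 1, a.2 + b.2 - 1)) 1 := by
  obtain ⟨i, j⟩ := a
  obtain ⟨k, l⟩ := b
  have h0 : ∀ n : ℕ, ((n : ℝ) • (1 : Series)) = (n : Series) := fun n => by
    rw [Nat.cast_smul_eq_nsmul, nsmul_one]
  have hs : ∀ (c : ℝ) (f : Series), c • f = (c • (1 : Series)) * f := fun c f => by
    rw [smul_mul_assoc, one_mul]
  have h00 : MvPowerSeries.pderiv ℝ (0 : Fin 2) (MvPowerSeries.X 0 : Series) = 1 :=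
    MvPowerSeries.pderiv_X_self
  have h01 : MvPowerSeries.pderiv ℝ (0 : Fin 2) (MvPowerSeries.X 1 : Series) = 0 :=
    MvPowerSeries.pderiv_X_of_ne (by simp)
  have h10 : MvPowerSeries.pderiv ℝ (1 : Fin 2) (MvPowerSeries.X 0 : Series) = 0 :=
    MvPowerSeries.pderiv_X_of_ne (by simp)
  have h11 : MvPowerSeries.pderiv ℝ (1 : Fin 2) (MvPowerSeries.X 1 : Series) = 1 :=
    MvPowerSeries.pderiv_X_self
  simp only [monomial_xp, poisson, Derivation.leibniz, Derivation.leibniz_pow, h00, h01, h10, h11,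
    smul_eq_mul, nsmul_eq_mul, mul_zero, mul_one, zero_add, add_zero]
  rw [hs, sub_smul, mul_smul, mul_smul, h0, h0, hs, hs (j : ℝ), h0, h0]
  rcases i with _ | i <;> rcases j with _ | j <;> rcases k with _ | k <;> rcases l with _ | l <;>
    simp only [Nat.zero_add, Nat.add_zero, Nat.cast_zero, zero_mul, mul_zero,
      sub_zero, zero_sub, pow_zero, mul_one, one_mul, sub_self, Nat.zero_sub,
      show ∀ x y : ℕ, x + 1 + (y + 1) - 1 = x + y + 1 by omega,
      show ∀ x y : ℕ, x + (y + 1) - 1 = x + y by omega] <;> ring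

theorem lie_mono {a b : ℕ × ℕ} (ha : 2 ≤ a.1 + a.2) (hb : 2 ≤ b.1 + b.2) :
    ⁅mono a, mono b⁆ = ((a.1 * b.2 - a.2 * b.1 : ℝ)) • mono (a.1 + b.1 - 1, a.2 + b.2 - 1) := by
  apply Subtype.ext
  rw [coe_lie, coe_mono ha, coe_mono hb, poisson_monomial]
  -- If an exponent sum is 0 the coefficient is 0. Otherwise the product has degree at least 2, so
  -- that `mono` does not take its default value 0.
  by_cases h : a.1 + b.1 = 0 ∨ a.2 + b.2 = 0
  · have : (a.1 * b.2 - a.2 * b.1 : ℝ) = 0 := by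
      rcases h with h | h
      · have h1 : a.1 = 0 := by omega
        have h2 : b.1 = 0 := by omega
        simp [h1, h2]
      · have h1 : a.2 = 0 := by omega
        have h2 : b.2 = 0 := by omega
        simp [h1, h2]
    simp [this]
  · rw [Submodule.coe_smul, coe_mono]
    simp only
    omega

/-! Topology. -/

instance : IsTopologicalRing Series := MvPowerSeries.WithPiTopology.instIsTopologicalRing (Fin 2) ℝ

theorem continuous_pderiv (i : Fin 2) :
    Continuous fun f : Series => MvPowerSeries.pderiv ℝ i f := by
  refine continuous_pi fun n => ?_
  have : (fun f : Series => MvPowerSeries.pderiv ℝ i f n) = fun f : Series =>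
      MvPowerSeries.coeff (n + Finsupp.single i 1) f * (n i + 1 : ℝ) := by
    funext f
    exact MvPowerSeries.coeff_pderiv f n
  rw [this]
  exact (MvPowerSeries.WithPiTopology.continuous_coeff ℝ _).mul continuous_const

theorem continuous_lie : Continuous fun x : Ham0 × Ham0 => ⁅x.1, x.2⁆ := by
  refine Continuous.subtype_mk ?_ _
  have h : ∀ i, Continuous fun x : Ham0 × Ham0 => MvPowerSeries.pderiv ℝ i (x.1 : Series) :=
    fun i => (continuous_pderiv i).comp (continuous_subtype_val.comp continuous_fst)
  have h' : ∀ i, Continuous fun x : Ham0 × Ham0 => MvPowerSeries.pderiv ℝ i (x.2 : Series) :=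
    fun i => (continuous_pderiv i).comp (continuous_subtype_val.comp continuous_snd)
  exact ((h 0).mul (h' 1)).sub ((h 1).mul (h' 0))

theorem mem_cochain_iff {m : ℕ} {σ : Fun Ham0 m} :
    σ ∈ cochain Ham0 m ↔ IsAlt σ ∧ Continuous σ := by
  constructor
  · rintro ⟨φ, rfl⟩
    exact ⟨⟨φ.toAlternatingMap, rfl⟩, φ.cont⟩
  · rintro ⟨⟨φ, rfl⟩, h⟩
    exact ⟨⟨⟨φ.toMultilinearMap, h⟩, φ.map_eq_zero_of_eq'⟩, rfl⟩

theorem continuous_d {m : ℕ} {σ : Fun Ham0 m} (h : Continuous σ) : Continuous (d m σ) := by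
  cases m with
  | zero => exact continuous_const
  | succ m =>
    have : d (m + 1) σ = fun X => ∑ j : Fin (m + 2), ∑ i : Fin (m + 1),
        if i.castSucc < j then
          (-1 : ℝ) ^ ((i : ℕ) + (j : ℕ)) *
            σ (Fin.cons ⁅X i.castSucc, X j⁆ fun k : Fin m => X (j.succAbove (i.succAbove k)))
        else 0 := rfl
    rw [this]
    refine continuous_finsetSum _ fun j _ => continuous_finsetSum _ fun i _ => ?_
    split_ifs
    · refine continuous_const.mul (h.comp (continuous_pi fun k => ?_))
      refine Fin.cases ?_ (fun k => ?_) k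
      · exact continuous_lie.comp (f := fun a : Fin (m + 2) → Ham0 => (a i.castSucc, a j))
          ((continuous_apply _).prodMk (continuous_apply _))
      · exact continuous_apply _
    · exact continuous_const

theorem continuous_lieDer (X : Ham0) {m : ℕ} {σ : Fun Ham0 m} (h : Continuous σ) :
    Continuous (lieDer X m σ) := by
  have : lieDer X m σ = fun Y => -∑ i, σ (Function.update Y i ⁅X, Y i⁆) := rfl
  rw [this]
  refine (continuous_finsetSum _ fun i _ => h.comp ?_).neg
  exact continuous_id.update i
    (continuous_lie.comp (continuous_const.prodMk (continuous_apply i)))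

theorem cochain_d {m : ℕ} {σ : Fun Ham0 m} (h : σ ∈ cochain Ham0 m) :
    d m σ ∈ cochain Ham0 (m + 1) := by
  rw [mem_cochain_iff] at h ⊢
  exact ⟨h.1.d, continuous_d h.2⟩

theorem cochain_lieDer (X : Ham0) {m : ℕ} {σ : Fun Ham0 m} (h : σ ∈ cochain Ham0 m) :
    lieDer X m σ ∈ cochain Ham0 m := by
  rw [mem_cochain_iff] at h ⊢
  exact ⟨h.1.lieDer X, continuous_lieDer X h.2⟩

/-- A series is the coefficientwise sum of its monomial terms, and only monomials in s contribute to
the finite partial sums. -/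
theorem mem_closure_span_mono (X : Ham0) (s : Set (ℕ × ℕ))
    (h : ∀ a ∉ s, MvPowerSeries.coeff (xp a) (X : Series) = 0) :
    X ∈ closure (Submodule.span ℝ (mono '' {a | a ∈ s ∧ 2 ≤ a.1 + a.2}) : Set Ham0) := by
  have h1 : HasSum (fun n : Fin 2 →₀ ℕ =>
      MvPowerSeries.coeff n (X : Series) • mono (n 0, n 1)) X := by
    have h2 := MvPowerSeries.WithPiTopology.hasSum_of_monomials_self (R := ℝ) (X : Series)
    rw [← Topology.IsInducing.subtypeVal.hasSum_iff (g := ham0Submodule.subtype)]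
    convert h2 using 1
    swap
    · rfl
    funext n
    rw [Function.comp_apply, map_smul, Submodule.subtype_apply]
    by_cases hn : 2 ≤ n 0 + n 1
    · rw [coe_mono hn, xp_apply, ← map_smul, smul_eq_mul, mul_one]
    · have : MvPowerSeries.coeff n (X : Series) = 0 := X.2 n (by
        rw [← xp_apply n, degree_xp]
        simpa using hn)
      simp [this]
  refine mem_closure_of_tendsto h1 (Filter.Eventually.of_forall fun t => ?_)
  refine Submodule.sum_mem _ fun n _ => ?_
  by_cases hn : (n 0, n 1) ∈ s
  · by_cases hd : 2 ≤ n 0 + n 1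
    · exact Submodule.smul_mem _ _ (Submodule.subset_span ⟨_, ⟨hn, hd⟩, rfl⟩)
    · rw [mono, dif_neg hd, smul_zero]
      exact Submodule.zero_mem _
  · have := h _ hn
    rw [xp_apply] at this
    rw [this, zero_smul]
    exact Submodule.zero_mem _

/-- In each single argument the zero set of a cochain is a closed subspace, so the arguments may be
moved one at a time from `s i` to the closure of its span; the induction is over the set of
arguments already moved. -/
theorem cochain_eq_zero_of_closure {m : ℕ} {σ : Fun Ham0 m} (hσ : σ ∈ cochain Ham0 m)
    (s : Fin m → Set Ham0) (h : ∀ X, (∀ i, X i ∈ s i) → σ X = 0) (X : Fin m → Ham0)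
    (hX : ∀ i, X i ∈ closure (Submodule.span ℝ (s i) : Set Ham0)) : σ X = 0 := by
  obtain ⟨φ, rfl⟩ := hσ
  have key : ∀ t : Finset (Fin m), ∀ X : Fin m → Ham0,
      (∀ i ∈ t, X i ∈ closure (Submodule.span ℝ (s i) : Set Ham0)) → (∀ i ∉ t, X i ∈ s i) →
        φ X = 0 := by
    intro t
    induction t using Finset.induction_on with
    | empty => exact fun X _ hX => h X fun i => hX i (Finset.notMem_empty i)
    | insert i t hi ih =>
      intro X h1 h2
      have h3 : ∀ u ∈ s i, φ (Function.update X i u) = 0 := by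
        intro u hu
        refine ih _ (fun j hj => ?_) fun j hj => ?_
        · rw [Function.update_of_ne (by rintro rfl; exact hi hj)]
          exact h1 j (Finset.mem_insert_of_mem hj)
        · by_cases hji : j = i
          · subst hji
            rwa [Function.update_self]
          · rw [Function.update_of_ne hji]
            exact h2 j (by simp [hji, hj])
      have h4 : ∀ u ∈ (Submodule.span ℝ (s i)), φ (Function.update X i u) = 0 := by
        intro u hu
        have : Submodule.span ℝ (s i) ≤
            LinearMap.ker (φ.toMultilinearMap.toLinearMap X i) := Submodule.span_le.2 h3
        exact this hu
      have h5 : IsClosed {u : Ham0 | φ (Function.update X i u) = 0} :=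
        isClosed_eq (φ.cont.comp (continuous_const.update i continuous_id)) continuous_const
      have h6 := closure_minimal h4 h5 (h1 i (Finset.mem_insert_self i t))
      have h7 : φ (Function.update X i (X i)) = 0 := h6
      rwa [Function.update_eq_self] at h7
  exact key Finset.univ X (fun i _ => hX i) (fun i hi => absurd (Finset.mem_univ i) hi)

theorem cochain_eq_zero_of_mono {m : ℕ} {σ : Fun Ham0 m} (hσ : σ ∈ cochain Ham0 m)
    (h : ∀ n : Fin m → ℕ × ℕ, (∀ i, 2 ≤ (n i).1 + (n i).2) → σ (fun i => mono (n i)) = 0) :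
    σ = 0 := by
  funext X
  refine cochain_eq_zero_of_closure hσ
    (fun _ => mono '' {a | a ∈ (Set.univ : Set (ℕ × ℕ)) ∧ 2 ≤ a.1 + a.2}) (fun Y hY => ?_) X
    fun i => mem_closure_span_mono _ _ fun a ha => absurd (Set.mem_univ a) ha
  choose n hn hn' using hY
  obtain rfl : (fun i => mono (n i)) = Y := funext hn'
  exact h n fun i => (hn i).2


/-! Cochains supported on given monomials. -/

/-- The conditions on the exponents of a tuple of monomials: all degrees are at least `3`, the
weight is `20`, the multiset of degrees satisfies `P`, and the degree in `p` is `h`. -/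
def Wt (P : Multiset ℕ → Prop) (h : ℕ) {m : ℕ} (n : Fin m → ℕ × ℕ) : Prop :=
  (∀ i, 3 ≤ (n i).1 + (n i).2) ∧ ∑ i, ((n i).1 + (n i).2 - 2) = 20 ∧
    P (Finset.univ.val.map fun i => (n i).1 + (n i).2) ∧ ∑ i, (n i).2 = h

/-- The cochains that vanish on all tuples of monomials but those with `Wt P h`. -/
def V (m : ℕ) (P : Multiset ℕ → Prop) (h : ℕ) : Submodule ℝ (Fun Ham0 m) where
  carrier := {σ | σ ∈ cochain Ham0 m ∧ ∀ n : Fin m → ℕ × ℕ,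
    (∀ i, 2 ≤ (n i).1 + (n i).2) → ¬ Wt P h n → σ (fun i => mono (n i)) = 0}
  zero_mem' := ⟨Submodule.zero_mem _, fun _ _ _ => rfl⟩
  add_mem' hσ hτ := ⟨Submodule.add_mem _ hσ.1 hτ.1, fun n h1 h2 => by
    rw [Pi.add_apply, hσ.2 n h1 h2, hτ.2 n h1 h2, add_zero]⟩
  smul_mem' c σ hσ := ⟨Submodule.smul_mem _ c hσ.1, fun n h1 h2 => by
    rw [Pi.smul_apply, hσ.2 n h1 h2, smul_zero]⟩

/-- The exponents of the monomial with code `c`. -/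
def ex (c : ℕ) : ℕ × ℕ := (c / 32 - c % 32, c % 32)

/-- The code of a monomial. -/
def code (a : ℕ × ℕ) : ℕ := 32 * (a.1 + a.2) + a.2

theorem code_ex {c : ℕ} (h : c % 32 ≤ c / 32) : code (ex c) = c := by
  simp only [code, ex]
  omega

theorem ex_code {a : ℕ × ℕ} (h : a.1 + a.2 < 32) : ex (code a) = a := by
  have h1 : code a / 32 = a.1 + a.2 := by simp only [code]; omega
  have h2 : code a % 32 = a.2 := by simp only [code]; omega
  simp only [ex, h1, h2]
  ext <;> simp

/-- Strictly increasing tuples of codes with `Wt P h`. -/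
def N (m : ℕ) (P : Multiset ℕ → Prop) (h : ℕ) : Set (Fin m → ℕ) :=
  {f | StrictMono f ∧ (∀ i, f i % 32 ≤ f i / 32) ∧ Wt P h fun i => ex (f i)}

/-- One argument carries at most the whole weight 20. This bound is the reason why five bits for the
exponent of p and ten bits for a code suffice. -/
theorem Wt.degree_le {P : Multiset ℕ → Prop} {h m : ℕ} {n : Fin m → ℕ × ℕ} (hn : Wt P h n)
    (i : Fin m) : (n i).1 + (n i).2 ≤ 22 := by
  have := Finset.single_le_sum (f := fun i => (n i).1 + (n i).2 - 2) (fun i _ => Nat.zero_le _)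
    (Finset.mem_univ i)
  rw [hn.2.1] at this
  omega

theorem Wt.comp_perm {P : Multiset ℕ → Prop} {h m : ℕ} {n : Fin m → ℕ × ℕ} (hn : Wt P h n)
    (π : Equiv.Perm (Fin m)) : Wt P h fun i => n (π i) := by
  refine ⟨fun i => hn.1 _, ?_, ?_, ?_⟩
  · rw [← hn.2.1]
    exact Equiv.sum_comp π fun i => (n i).1 + (n i).2 - 2
  · convert hn.2.2.1 using 1
    have h1 := congrArg Finset.val (Finset.map_univ_equiv π)
    rw [Finset.map_val] at h1
    conv_rhs => rw [← h1]
    rw [Multiset.map_map]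
    rfl
  · rw [← hn.2.2.2]
    exact Equiv.sum_comp π fun i => (n i).2

theorem ex_lt {P : Multiset ℕ → Prop} {h m : ℕ} {f : Fin m → ℕ} (hf : f ∈ N m P h) (i : Fin m) :
    f i < 736 := by
  have := hf.2.2.degree_le i
  have := hf.2.1 i
  simp only [ex] at *
  omega

theorem finite_N (m : ℕ) (P : Multiset ℕ → Prop) (h : ℕ) : (N m P h).Finite :=
  (Set.Finite.pi' fun _ : Fin m => Set.finite_Iio 736).subset fun _ hf i => ex_lt hf i

theorem exists_sorted {P : Multiset ℕ → Prop} {h m : ℕ} {n : Fin m → ℕ × ℕ} (hn : Wt P h n)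
    (hi : Function.Injective n) :
    ∃ f ∈ N m P h, ∃ π : Equiv.Perm (Fin m), ∀ i, n (π i) = ex (f i) := by
  have hx : ∀ i, ex (code (n i)) = n i := fun i => ex_code (by have := hn.degree_le i; omega)
  have hc : Function.Injective fun i => code (n i) := fun i j hij => hi (by
    rw [← hx i, ← hx j]
    exact congrArg ex hij)
  refine ⟨(fun i => code (n i)) ∘ Tuple.sort fun i => code (n i), ⟨?_, fun i => ?_, ?_⟩,
    Tuple.sort fun i => code (n i), fun i => (hx _).symm⟩
  · exact (Tuple.monotone_sort _).strictMono_of_injective (hc.comp (Equiv.injective _))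
  · rw [Function.comp_apply]
    generalize Tuple.sort (fun i => code (n i)) i = j
    have := hn.degree_le j
    have h1 : code (n j) / 32 = (n j).1 + (n j).2 := by simp only [code]; omega
    have h2 : code (n j) % 32 = (n j).2 := by simp only [code]; omega
    omega
  · simp only [Function.comp_apply, hx]
    exact hn.comp_perm _

/-- Evaluation of a cochain at increasing tuples of codes. -/
def evalN (m : ℕ) (P : Multiset ℕ → Prop) (h : ℕ) : V m P h →ₗ[ℝ] (N m P h → ℝ) where
  toFun σ f := σ.1 fun i => mono (ex (f.1 i))
  map_add' _ _ := rfl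
  map_smul' _ _ := rfl

/-- On monomials outside the support the value is 0 by definition, on tuples with a repetition it is
0 by alternation, and every other tuple is a permutation of an increasing one. -/
theorem evalN_injective (m : ℕ) (P : Multiset ℕ → Prop) (h : ℕ) :
    Function.Injective (evalN m P h) := by
  rw [← LinearMap.ker_eq_bot, LinearMap.ker_eq_bot']
  rintro ⟨σ, hσ⟩ h0
  apply Subtype.ext
  refine cochain_eq_zero_of_mono hσ.1 fun n hn => ?_
  by_cases hw : Wt P h n
  · obtain ⟨φ, rfl⟩ := hσ.1
    by_cases hi : Function.Injective n
    · obtain ⟨f, hf, π, hπ⟩ := exists_sorted hw hi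
      have h1 := congrFun h0 ⟨f, hf⟩
      have h2 := φ.toAlternatingMap.map_perm (fun i => mono (n i)) π
      have h3 : (fun i => mono (n i)) ∘ π = fun i => mono (ex (f i)) := by
        funext i
        rw [Function.comp_apply, hπ]
      rw [h3] at h2
      have h4 : φ.toAlternatingMap (fun i => mono (ex (f i))) = 0 := h1
      rw [h4] at h2
      exact (smul_eq_zero_iff_eq _).1 h2.symm
    · refine φ.map_eq_zero_of_not_injective _ fun hi' => hi ?_
      exact fun i j hij => hi' (congrArg mono hij)
  · exact hσ.2 n hn hw

/-- The determinant of the coefficients at the monomials with codes `f i`. -/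
def detCochain {m : ℕ} (f : Fin m → ℕ) : Fun Ham0 m := fun X =>
  Matrix.det (Matrix.of fun j i => MvPowerSeries.coeff (xp (ex (f i))) (X j : Series))

theorem detCochain_mem {m : ℕ} (f : Fin m → ℕ) : detCochain f ∈ cochain Ham0 m := by
  rw [mem_cochain_iff]
  refine ⟨⟨(Matrix.detRowAlternating (n := Fin m) (R := ℝ)).compLinearMap
    (LinearMap.pi fun i => MvPowerSeries.coeff (xp (ex (f i))) ∘ₗ ham0Submodule.subtype), rfl⟩, ?_⟩
  refine Continuous.matrix_det (continuous_matrix fun j i => ?_)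
  exact (MvPowerSeries.WithPiTopology.continuous_coeff ℝ _).comp
    (continuous_subtype_val.comp (continuous_apply j))

theorem exists_perm_of_detCochain_ne_zero {m : ℕ} (f : Fin m → ℕ) (n : Fin m → ℕ × ℕ)
    (hn : ∀ i, 2 ≤ (n i).1 + (n i).2) (h : detCochain f (fun i => mono (n i)) ≠ 0) :
    ∃ π : Equiv.Perm (Fin m), ∀ i, ex (f i) = n (π i) := by
  rw [detCochain, Matrix.det_apply] at h
  obtain ⟨π, -, hπ⟩ := Finset.exists_ne_zero_of_sum_ne_zero h
  refine ⟨π, fun i => ?_⟩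
  by_contra hne
  refine hπ ?_
  rw [Finset.prod_eq_zero (Finset.mem_univ i), smul_zero]
  rw [Matrix.of_apply, coeff_mono (hn _), if_neg hne]

theorem detCochain_mem_V {m : ℕ} {P : Multiset ℕ → Prop} {h : ℕ} {f : Fin m → ℕ}
    (hf : f ∈ N m P h) : detCochain f ∈ V m P h := by
  refine ⟨detCochain_mem f, fun n hn hw => ?_⟩
  by_contra hne
  obtain ⟨π, hπ⟩ := exists_perm_of_detCochain_ne_zero f n hn hne
  refine hw ?_
  have := hf.2.2.comp_perm π⁻¹
  simpa [hπ] using this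

theorem mem_N_two_le {m : ℕ} {P : Multiset ℕ → Prop} {h : ℕ} {f : Fin m → ℕ} (hf : f ∈ N m P h)
    (i : Fin m) : 2 ≤ (ex (f i)).1 + (ex (f i)).2 := by
  have : 3 ≤ (ex (f i)).1 + (ex (f i)).2 := hf.2.2.1 i
  omega

theorem detCochain_self {m : ℕ} {P : Multiset ℕ → Prop} {h : ℕ} {f : Fin m → ℕ}
    (hf : f ∈ N m P h) : detCochain f (fun i => mono (ex (f i))) = 1 := by
  rw [detCochain, ← Matrix.det_one (n := Fin m)]
  congr 1
  ext j i
  rw [Matrix.of_apply, coeff_mono (mem_N_two_le hf j), Matrix.one_apply]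
  refine if_congr ⟨fun h => ?_, fun h => by rw [h]⟩ rfl rfl
  refine hf.1.injective ?_
  rw [← code_ex (hf.2.1 i), h, code_ex (hf.2.1 j)]

theorem detCochain_ne {m : ℕ} {P : Multiset ℕ → Prop} {h : ℕ} {f f' : Fin m → ℕ}
    (hf : f ∈ N m P h) (hf' : f' ∈ N m P h) (hne : f ≠ f') :
    detCochain f (fun i => mono (ex (f' i))) = 0 := by
  by_contra h0
  obtain ⟨π, hπ⟩ := exists_perm_of_detCochain_ne_zero f _ (mem_N_two_le hf') h0
  have h1 : f = f' ∘ π := by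
    funext i
    rw [← code_ex (hf.2.1 i), hπ, code_ex (hf'.2.1 _)]
    rfl
  refine hne ((StrictMono.range_inj hf.1 hf'.1).1 ?_)
  rw [h1, Set.range_comp, π.surjective.range_eq, Set.image_univ]

/-- The determinants of coefficients at increasing tuples are dual to evaluation at these tuples. -/
theorem evalN_surjective (m : ℕ) (P : Multiset ℕ → Prop) (h : ℕ) :
    Function.Surjective (evalN m P h) := by
  classical
  have := (finite_N m P h).fintype
  intro c
  refine ⟨∑ f : N m P h, c f • ⟨detCochain f.1, detCochain_mem_V f.2⟩, ?_⟩
  rw [map_sum]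
  funext f'
  rw [Finset.sum_apply, Finset.sum_eq_single f']
  · rw [map_smul, Pi.smul_apply, smul_eq_mul]
    exact (congrArg (c f' * ·) (detCochain_self f'.2)).trans (mul_one _)
  · intro f _ hne
    rw [map_smul, Pi.smul_apply, smul_eq_mul]
    exact (congrArg (c f * ·) (detCochain_ne f.2 f'.2 fun h => hne (Subtype.ext h))).trans
      (mul_zero _)
  · exact fun h => absurd (Finset.mem_univ _) h

/-- Cochains with given support correspond to functions on increasing tuples of codes. -/
def equivN (m : ℕ) (P : Multiset ℕ → Prop) (h : ℕ) : V m P h ≃ₗ[ℝ] (N m P h → ℝ) :=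
  LinearEquiv.ofBijective (evalN m P h) ⟨evalN_injective m P h, evalN_surjective m P h⟩

instance finite_V (m : ℕ) (P : Multiset ℕ → Prop) (h : ℕ) : Module.Finite ℝ (V m P h) := by
  have := (finite_N m P h).fintype
  exact Module.Finite.equiv (equivN m P h).symm

theorem finrank_V (m : ℕ) (P : Multiset ℕ → Prop) (h : ℕ) :
    Module.finrank ℝ (V m P h) = (N m P h).ncard := by
  have := (finite_N m P h).fintype
  rw [(equivN m P h).finrank_eq, Module.finrank_fintype_fun_eq_card, Set.ncard_eq_toFinset_card',
    Set.toFinset_card]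


/-! The action of `sp(2, ℝ)` on cochains. -/

theorem IsAlt.lieDer_add {g : Type*} [LieRing g] [LieAlgebra ℝ g] {m : ℕ} {σ : Fun g m}
    (h : IsAlt σ) (X Y : g) :
    GKF.lieDer (X + Y) m σ = GKF.lieDer X m σ + GKF.lieDer Y m σ := by
  obtain ⟨φ, rfl⟩ := h
  funext v
  simp only [lieDer_apply, Pi.add_apply, add_lie, AlternatingMap.map_update_add,
    Finset.sum_add_distrib, neg_add]

theorem IsAlt.lieDer_smul {g : Type*} [LieRing g] [LieAlgebra ℝ g] {m : ℕ} {σ : Fun g m}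
    (h : IsAlt σ) (c : ℝ) (X : g) : GKF.lieDer (c • X) m σ = c • GKF.lieDer X m σ := by
  obtain ⟨φ, rfl⟩ := h
  funext v
  simp only [lieDer_apply, Pi.smul_apply, smul_lie, AlternatingMap.map_update_smul, smul_eq_mul,
    ← Finset.mul_sum, mul_neg]

theorem lieDer_mono_apply {m : ℕ} {σ : Fun Ham0 m} (h : IsAlt σ) {a : ℕ × ℕ}
    (ha : 2 ≤ a.1 + a.2) {n : Fin m → ℕ × ℕ} (hn : ∀ i, 2 ≤ (n i).1 + (n i).2) :
    lieDer (mono a) m σ (fun i => mono (n i)) =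
      -∑ i, (a.1 * (n i).2 - a.2 * (n i).1 : ℝ) * σ (fun j => mono (Function.update n i
        (a.1 + (n i).1 - 1, a.2 + (n i).2 - 1) j)) := by
  obtain ⟨φ, rfl⟩ := h
  rw [lieDer_apply]
  congr 1
  refine Finset.sum_congr rfl fun i _ => ?_
  rw [lie_mono ha (hn i), AlternatingMap.map_update_smul, smul_eq_mul]
  congr 2
  funext j
  by_cases hj : j = i
  · subst hj
    simp
  · simp [hj]

theorem sum_update {m : ℕ} (n : Fin m → ℕ × ℕ) (i : Fin m) (b : ℕ × ℕ) (F : ℕ × ℕ → ℕ) :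
    ∑ j, F (Function.update n i b j) + F (n i) = ∑ j, F (n j) + F b := by
  rw [← Finset.add_sum_erase _ _ (Finset.mem_univ i),
    ← Finset.add_sum_erase _ (fun j => F (n j)) (Finset.mem_univ i), Function.update_self]
  rw [Finset.sum_congr rfl fun j hj => by
    rw [Function.update_of_ne (Finset.ne_of_mem_erase hj)]]
  omega

theorem Wt.of_update {P : Multiset ℕ → Prop} {h h' m : ℕ} {n : Fin m → ℕ × ℕ} {i : Fin m}
    {b : ℕ × ℕ} (hn : Wt P h (Function.update n i b)) (hd : b.1 + b.2 = (n i).1 + (n i).2)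
    (hh : h + (n i).2 = h' + b.2) : Wt P h' n := by
  have hdeg : ∀ j, (Function.update n i b j).1 + (Function.update n i b j).2 =
      (n j).1 + (n j).2 := by
    intro j
    by_cases hj : j = i
    · subst hj
      simpa using hd
    · rw [Function.update_of_ne hj]
  obtain ⟨h1, h2, h3, h4⟩ := hn
  simp only [hdeg] at h1 h2 h3
  refine ⟨h1, h2, h3, ?_⟩
  have := sum_update n i b Prod.snd
  omega

/-- A bracket with a quadratic monomial preserves the degree of each argument, hence the weight and
the type, and changes one exponent of p by `a.2 - 1`. The support of the cochain moves the opposite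
way, so that q² raises the height and p² lowers it. -/
theorem lieDer_mono_mem_V {m : ℕ} {P : Multiset ℕ → Prop} {h h' : ℕ} {σ : Fun Ham0 m}
    (hσ : σ ∈ V m P h) {a : ℕ × ℕ} (ha : a.1 + a.2 = 2) (hh : h' + a.2 = h + 1) :
    lieDer (mono a) m σ ∈ V m P h' := by
  refine ⟨cochain_lieDer _ hσ.1, fun n hn hw => ?_⟩
  rw [lieDer_mono_apply (mem_cochain_iff.1 hσ.1).1 ha.ge hn, neg_eq_zero]
  refine Finset.sum_eq_zero fun i _ => ?_
  by_cases h0 : a.1 + (n i).1 = 0 ∨ a.2 + (n i).2 = 0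
  · have : (a.1 * (n i).2 - a.2 * (n i).1 : ℝ) = 0 := by
      rcases h0 with h0 | h0
      · have h1 : a.1 = 0 := by omega
        have h2 : (n i).1 = 0 := by omega
        simp [h1, h2]
      · have h1 : a.2 = 0 := by omega
        have h2 : (n i).2 = 0 := by omega
        simp [h1, h2]
    rw [this, zero_mul]
  · have hd : a.1 + (n i).1 - 1 + (a.2 + (n i).2 - 1) = (n i).1 + (n i).2 := by omega
    rw [hσ.2, mul_zero]
    · intro j
      by_cases hj : j = i
      · subst hj
        rw [Function.update_self]
        have := hn j
        simp only
        omega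
      · rw [Function.update_of_ne hj]
        exact hn j
    · intro hw'
      refine hw (hw'.of_update hd ?_)
      simp only
      omega

/-- The monomial q^i p^j is an eigenvector of qp with eigenvalue j - i. Over a tuple of total degree
20 + 2m and height h, the sum of i - j is 20 + 2m - 2h. -/
theorem lieDer_mono_one_one {m : ℕ} {P : Multiset ℕ → Prop} {h : ℕ} {σ : Fun Ham0 m}
    (hσ : σ ∈ V m P h) : lieDer (mono (1, 1)) m σ = ((20 + 2 * m : ℝ) - 2 * h) • σ := by
  rw [← sub_eq_zero]
  refine cochain_eq_zero_of_mono (Submodule.sub_mem _ (cochain_lieDer _ hσ.1)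
    (Submodule.smul_mem _ _ hσ.1)) fun n hn => ?_
  rw [Pi.sub_apply, Pi.smul_apply, lieDer_mono_apply (mem_cochain_iff.1 hσ.1).1 (by simp) hn]
  simp only [Nat.add_sub_cancel_left, Prod.mk.eta, Function.update_eq_self, Nat.cast_one, one_mul]
  rw [← Finset.sum_mul, smul_eq_mul, ← neg_mul, ← sub_mul]
  by_cases hw : Wt P h n
  · have h1 : (∑ i, ((n i).1 + (n i).2 : ℕ)) = 20 + 2 * m := by
      have h2 := hw.2.1
      have h3 : ∀ i ∈ Finset.univ, (n i).1 + (n i).2 = ((n i).1 + (n i).2 - 2) + 2 :=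
        fun i _ => by have := hw.1 i; omega
      rw [Finset.sum_congr rfl h3, Finset.sum_add_distrib, h2]
      simp [mul_comm]
    have h4 := hw.2.2.2
    have h5 : (∑ i, ((n i).1 + (n i).2 : ℝ)) = 20 + 2 * m := by exact_mod_cast h1
    have h6 : (∑ i, ((n i).2 : ℝ)) = h := by exact_mod_cast h4
    rw [Finset.sum_add_distrib] at h5
    rw [Finset.sum_sub_distrib]
    have : -(∑ i, ((n i).2 : ℝ) - ∑ i, ((n i).1 : ℝ)) - ((20 + 2 * m : ℝ) - 2 * h) = 0 := by
      linarith
    rw [this, zero_mul]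
  · rw [hσ.2 n hn hw, mul_zero]

theorem lie_mono_two_two : ⁅mono (2, 0), mono (0, 2)⁆ = (4 : ℝ) • mono (1, 1) := by
  rw [lie_mono (by simp) (by simp)]
  norm_num

/-- The sl(2) commutation relation {q², p²} = 4qp, with qp replaced by its eigenvalue at height h.
-/
theorem lieDer_comm {m : ℕ} {P : Multiset ℕ → Prop} {h : ℕ} {σ : Fun Ham0 m}
    (hσ : σ ∈ V m P h) : lieDer (mono (2, 0)) m (lieDer (mono (0, 2)) m σ) =
      lieDer (mono (0, 2)) m (lieDer (mono (2, 0)) m σ) +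
        (8 * ((10 + m : ℝ) - h)) • σ := by
  have hA := (mem_cochain_iff.1 hσ.1).1
  rw [← sub_eq_iff_eq_add', hA.lieDer_lie, lie_mono_two_two, hA.lieDer_smul,
    lieDer_mono_one_one hσ, smul_smul]
  congr 1
  ring

/-- If `b` is nilpotent on `w` and `a` undoes `b` up to positive factors, then `w = 0`. -/
theorem eq_zero_of_chain {M : Type*} [AddCommGroup M] [Module ℝ M] (a b : M →ₗ[ℝ] M) (x : ℕ → M)
    (hx : ∀ j, x (j + 1) = b (x j)) (μ : ℕ → ℝ) (hμ : ∀ j, 0 < μ j)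
    (hab : ∀ j, a (b (x (j + 1))) = b (a (x (j + 1))) + μ j • x (j + 1)) {c : ℝ} (hc : 0 < c)
    (h0 : a (b (x 0)) = c • x 0) (k : ℕ) (hk : x k = 0) : x 0 = 0 := by
  -- The operator a sends each link of the chain to a positive multiple of the preceding one; each
  -- step adds `μ j` to the factor. Once some link is 0, all earlier ones are 0 too.
  have h1 : ∀ j, ∃ c : ℝ, 0 < c ∧ a (x (j + 1)) = c • x j := by
    intro j
    induction j with
    | zero => exact ⟨c, hc, by rw [hx, h0]⟩
    | succ j ih =>
      obtain ⟨c, hc, h⟩ := ih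
      exact ⟨c + μ j, add_pos hc (hμ j), by rw [hx (j + 1), hab, h, map_smul, ← hx, add_smul]⟩
  induction k with
  | zero => exact hk
  | succ k ih =>
    obtain ⟨c, hc, h⟩ := h1 k
    rw [hk, map_zero] at h
    exact ih ((smul_eq_zero_iff_right hc.ne').1 h.symm)

theorem V_eq_zero {m : ℕ} {P : Multiset ℕ → Prop} {h : ℕ} (hh : 20 + 2 * m < h) {σ : Fun Ham0 m}
    (hσ : σ ∈ V m P h) : σ = 0 := by
  refine cochain_eq_zero_of_mono hσ.1 fun n hn => hσ.2 n hn fun hw => ?_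
  have h1 : (∑ i, ((n i).1 + (n i).2 : ℕ)) = 20 + 2 * m := by
    have h2 := hw.2.1
    have h3 : ∀ i ∈ Finset.univ, (n i).1 + (n i).2 = ((n i).1 + (n i).2 - 2) + 2 :=
      fun i _ => by have := hw.1 i; omega
    rw [Finset.sum_congr rfl h3, Finset.sum_add_distrib, h2]
    simp [mul_comm]
  have h4 := hw.2.2.2
  rw [Finset.sum_add_distrib] at h1
  omega

theorem raise_mem {m : ℕ} {P : Multiset ℕ → Prop} {h : ℕ} {σ : Fun Ham0 m} (hσ : σ ∈ V m P h) :
    lieDer (mono (2, 0)) m σ ∈ V m P (h + 1) :=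
  lieDer_mono_mem_V hσ rfl rfl

theorem lower_mem {m : ℕ} {P : Multiset ℕ → Prop} {h : ℕ} {σ : Fun Ham0 m}
    (hσ : σ ∈ V m P (h + 1)) : lieDer (mono (0, 2)) m σ ∈ V m P h :=
  lieDer_mono_mem_V hσ rfl rfl

/-- A nonzero term would need a tuple of height 0 in which an exponent of p has just been increased.
-/
theorem lower_eq_zero {m : ℕ} {P : Multiset ℕ → Prop} {σ : Fun Ham0 m} (hσ : σ ∈ V m P 0) :
    lieDer (mono (0, 2)) m σ = 0 := by
  refine cochain_eq_zero_of_mono (cochain_lieDer _ hσ.1) fun n hn => ?_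
  rw [lieDer_mono_apply (mem_cochain_iff.1 hσ.1).1 (by simp) hn, neg_eq_zero]
  refine Finset.sum_eq_zero fun i _ => ?_
  by_cases h0 : (n i).1 = 0
  · simp [h0]
  · rw [hσ.2, mul_zero]
    · intro j
      by_cases hj : j = i
      · subst hj
        rw [Function.update_self]
        have := hn j
        simp only
        omega
      · rw [Function.update_of_ne hj]
        exact hn j
    · intro hw
      have h1 := hw.2.2.2
      have h2 := Finset.single_le_sum (f := fun j => (Function.update n i
        (0 + (n i).1 - 1, 2 + (n i).2 - 1) j).2) (fun j _ => Nat.zero_le _) (Finset.mem_univ i)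
      simp only [Function.update_self] at h2
      simp only at h1
      omega

/-- Cochains of the middle height killed by the lowering operator are killed by the raising
operator. -/
theorem raise_eq_zero {m : ℕ} {P : Multiset ℕ → Prop} {σ : Fun Ham0 m} (hσ : σ ∈ V m P (10 + m))
    (h0 : lieDer (mono (0, 2)) m σ = 0) : lieDer (mono (2, 0)) m σ = 0 := by
  set e := lieDer (mono (2, 0)) m
  set f := lieDer (mono (0, 2)) m
  have hx : ∀ j, (e ^ (j + 1)) σ ∈ V m P (10 + m + (j + 1)) := by
    intro j
    induction j with
    | zero => simpa using raise_mem hσ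
    | succ j ih =>
      rw [pow_succ', Module.End.mul_apply]
      exact raise_mem ih
  have hc := lieDer_comm hσ
  -- The chain starts at e σ. Here f e (e σ) = 8 e σ because σ has eigenvalue 0 and is killed by f;
  -- at height 10 + m + (j + 2) the commutator contributes 8 (j + 2). The chain ends when the height
  -- exceeds the total degree 20 + 2m.
  refine eq_zero_of_chain f e (fun j => (e ^ (j + 1)) σ) (fun j => ?_) (fun j => 8 * (j + 2))
    (fun j => by positivity) (fun j => ?_) (c := 8) (by norm_num) ?_ (10 + m) ?_
  · rw [pow_succ', Module.End.mul_apply]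
  · have h1 := lieDer_comm (hx (j + 1))
    change f (e ((e ^ (j + 1 + 1)) σ)) = e (f ((e ^ (j + 1 + 1)) σ)) + _
    change e (f ((e ^ (j + 1 + 1)) σ)) = f (e ((e ^ (j + 1 + 1)) σ)) + _ at h1
    generalize (e ^ (j + 1 + 1)) σ = y at h1 ⊢
    rw [h1, add_assoc, ← add_smul]
    have h2 : 8 * ((10 + m : ℝ) - ((10 + m + (j + 1 + 1) : ℕ) : ℝ)) + 8 * ((j : ℝ) + 2) = 0 := by
      push_cast
      ring
    rw [h2, zero_smul, add_zero]
  · simp only [zero_add, pow_one]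
    have h1 : f (e σ) = 0 := by
      have h2 : (8 * ((10 + m : ℝ) - ((10 + m : ℕ) : ℝ))) = 0 := by push_cast; ring
      rw [h2, zero_smul, add_zero, h0, map_zero] at hc
      exact hc.symm
    have h3 : f (e (e σ)) = (8 : ℝ) • e σ := by
      have h4 : f (e (e σ)) + (8 * ((10 + m : ℝ) - ((10 + m + 1 : ℕ) : ℝ))) • e σ = 0 := by
        have := lieDer_comm (hx 0)
        simp only [zero_add, pow_one] at this
        rw [← this]
        change e (f (e σ)) = 0
        rw [h1, map_zero]
      rw [eq_neg_of_add_eq_zero_left h4, ← neg_smul]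
      congr 1
      push_cast
      ring
    exact h3
  · exact V_eq_zero (by omega) (hx (10 + m))

/-- The lowering operator from the middle height is onto. -/
theorem lower_surjective {m : ℕ} {P : Multiset ℕ → Prop} {τ : Fun Ham0 m}
    (hτ : τ ∈ V m P (9 + m)) : ∃ σ ∈ V m P (10 + m), lieDer (mono (0, 2)) m σ = τ := by
  set e := lieDer (mono (2, 0)) m with he
  set f := lieDer (mono (0, 2)) m with hf
  have h1 : ∀ τ ∈ V m P (9 + m), e τ ∈ V m P (10 + m) := fun τ h => by
    have := raise_mem h
    rwa [show 9 + m + 1 = 10 + m by omega] at this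
  have h2 : ∀ σ ∈ V m P (10 + m), f σ ∈ V m P (9 + m) := fun σ h => by
    rw [show 10 + m = 9 + m + 1 by omega] at h
    exact lower_mem h
  -- Preimages are sought among the raised cochains: as the space is finite-dimensional, it suffices
  -- that f e is injective at height 9 + m.
  let T : V m P (9 + m) →ₗ[ℝ] V m P (9 + m) := (f ∘ₗ e).restrict fun τ h => h2 _ (h1 τ h)
  have hT : Function.Injective T := by
    rw [← LinearMap.ker_eq_bot, LinearMap.ker_eq_bot']
    rintro ⟨w, hw⟩ h0
    have h0 : f (e w) = 0 := congrArg Subtype.val h0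
    have hx : ∀ j, (f ^ j) w ∈ V m P (9 + m - j) := by
      intro j
      induction j with
      | zero => simpa using hw
      | succ j ih =>
        rw [pow_succ', Module.End.mul_apply]
        -- Once height 0 is reached, all further powers vanish, so that membership remains true with
        -- truncated subtraction.
        rcases Nat.eq_zero_or_pos (9 + m - j) with h | h
        · rw [h] at ih
          rw [hf, lower_eq_zero ih]
          exact Submodule.zero_mem _
        · obtain ⟨k, hk⟩ := Nat.exists_eq_add_of_lt h
          rw [show 9 + m - j = k + 1 by omega] at ih
          rw [show 9 + m - (j + 1) = k by omega]
          exact lower_mem ih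
    apply Subtype.ext
    -- From f e w = 0 the commutator gives e f w = 8 w. Below the middle height all later commutator
    -- constants are positive as well, and lowering ends at height 0.
    refine eq_zero_of_chain e f (fun j => (f ^ j) w) (fun j => ?_)
      (fun j => 8 * ((10 + m : ℝ) - (9 + m - (j + 1) : ℕ))) (fun j => ?_) (fun j => ?_) (c := 8)
      (by norm_num) ?_ (10 + m) ?_
    · rw [pow_succ', Module.End.mul_apply]
    · have : ((9 + m - (j + 1) : ℕ) : ℝ) ≤ 9 + m := by
        have : 9 + m - (j + 1) ≤ 9 + m := by omega
        exact_mod_cast this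
      linarith
    · exact lieDer_comm (hx (j + 1))
    · have := lieDer_comm hw
      simp only [pow_zero, Module.End.one_apply]
      rw [← he, ← hf] at this
      rw [this, h0, zero_add]
      congr 1
      push_cast
      ring
    · rw [show 10 + m = (9 + m) + 1 by omega, pow_succ', Module.End.mul_apply]
      refine lower_eq_zero (P := P) ?_
      simpa using hx (9 + m)
  obtain ⟨σ, hσ⟩ := (LinearMap.injective_iff_surjective.1 hT) ⟨τ, hτ⟩
  exact ⟨e σ, h1 _ σ.2, congrArg Subtype.val hσ⟩

/-- The `sp(2, ℝ)`-invariant cochains supported on degrees satisfying `P`. -/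
def R (m : ℕ) (P : Multiset ℕ → Prop) : Submodule ℝ (Fun Ham0 m) :=
  V m P (10 + m) ⊓ LinearMap.ker (lieDer (mono (0, 2)) m)

instance finite_R (m : ℕ) (P : Multiset ℕ → Prop) : Module.Finite ℝ (R m P) :=
  Submodule.finiteDimensional_of_le (inf_le_left : R m P ≤ V m P (10 + m))

/-- Rank-nullity for the lowering operator from height 10 + m onto height 9 + m. -/
theorem finrank_R (m : ℕ) (P : Multiset ℕ → Prop) :
    Module.finrank ℝ (R m P) + (N m P (9 + m)).ncard = (N m P (10 + m)).ncard := by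
  rw [← finrank_V, ← finrank_V]
  have h2 : ∀ σ ∈ V m P (10 + m), lieDer (mono (0, 2)) m σ ∈ V m P (9 + m) := fun σ h => by
    rw [show 10 + m = 9 + m + 1 by omega] at h
    exact lower_mem h
  let T : V m P (10 + m) →ₗ[ℝ] V m P (9 + m) := (lieDer (mono (0, 2)) m).restrict h2
  have hT : LinearMap.range T = ⊤ := LinearMap.range_eq_top.2 fun τ => by
    obtain ⟨σ, hσ, h⟩ := lower_surjective τ.2
    exact ⟨⟨σ, hσ⟩, Subtype.ext h⟩
  have h3 := T.finrank_range_add_finrank_ker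
  rw [hT, finrank_top] at h3
  have h4 : Module.finrank ℝ (LinearMap.ker T) = Module.finrank ℝ (R m P) := by
    have : R m P = (LinearMap.ker T).map (V m P (10 + m)).subtype := by
      ext σ
      constructor
      · rintro ⟨h5, h6⟩
        exact ⟨⟨σ, h5⟩, Subtype.ext h6, rfl⟩
      · rintro ⟨⟨σ, h5⟩, h6, rfl⟩
        exact ⟨h5, congrArg Subtype.val h6⟩
    rw [this]
    exact (LinearEquiv.finrank_eq (Submodule.equivMapOfInjective _ (Submodule.subtype_injective _)
      _))
  omega


/-! The relative cochains of weight `20` are the invariant cochains. -/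

theorem mono_mem_sp2 {a : ℕ × ℕ} (ha : a.1 + a.2 = 2) : mono a ∈ sp2 := by
  intro n hn
  rw [coe_mono ha.ge, MvPowerSeries.coeff_monomial, if_neg]
  rintro rfl
  exact hn (by rw [degree_xp, ha])

theorem V_ip {m : ℕ} {P : Multiset ℕ → Prop} {h : ℕ} {σ : Fun Ham0 (m + 1)}
    (hσ : σ ∈ V (m + 1) P h) {X : Ham0} (hX : X ∈ sp2) : ip X σ = 0 := by
  funext Y
  refine cochain_eq_zero_of_closure hσ.1
    (fun i => mono '' {a | a ∈ {a : ℕ × ℕ | i = 0 → a.1 + a.2 = 2} ∧ 2 ≤ a.1 + a.2})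
    (fun Z hZ => ?_) _ fun i => mem_closure_span_mono _ _ fun a ha => ?_
  · choose n hn hn' using hZ
    obtain rfl : (fun i => mono (n i)) = Z := funext hn'
    refine hσ.2 n (fun i => (hn i).2) fun hw => ?_
    have h1 := hw.1 0
    rw [(hn 0).1 rfl] at h1
    omega
  · rw [Set.mem_ofPred_eq, Classical.not_imp] at ha
    rw [ha.1]
    exact hX _ (by rw [degree_xp]; exact ha.2)

theorem V_le_weightPart (m : ℕ) (P : Multiset ℕ → Prop) (h : ℕ) : V m P h ≤ weightPart 20 m := by
  intro σ hσ _ l X hX hl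
  refine cochain_eq_zero_of_closure hσ.1
    (fun i => mono '' {a | a ∈ {a : ℕ × ℕ | a.1 + a.2 = l i} ∧ 2 ≤ a.1 + a.2})
    (fun Z hZ => ?_) _ fun i => mem_closure_span_mono _ _ fun a ha => ?_
  · choose n hn hn' using hZ
    obtain rfl : (fun i => mono (n i)) = Z := funext hn'
    refine hσ.2 n (fun i => (hn i).2) fun hw => hl ?_
    have h1 := hw.2.1
    zify at h1
    rw [← h1]
    refine Finset.sum_congr rfl fun i _ => ?_
    have h2 : (n i).1 + (n i).2 = l i := (hn i).1
    have h3 := (hn i).2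
    rw [Nat.cast_sub h3, ← h2]
    rfl
  · exact MvPowerSeries.IsHomogeneous.coeff_eq_zero (hX i) (by rw [degree_xp]; exact ha)

theorem sp2_eq {X : Ham0} (hX : X ∈ sp2) :
    X = MvPowerSeries.coeff (xp (2, 0)) (X : Series) • mono (2, 0) +
      MvPowerSeries.coeff (xp (1, 1)) (X : Series) • mono (1, 1) +
      MvPowerSeries.coeff (xp (0, 2)) (X : Series) • mono (0, 2) := by
  apply Subtype.ext
  ext n
  rw [← xp_apply n]
  generalize (n 0, n 1) = b
  rw [Submodule.coe_add, Submodule.coe_add, Submodule.coe_smul, Submodule.coe_smul,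
    Submodule.coe_smul, map_add, map_add, map_smul, map_smul, map_smul, coeff_mono (by simp),
    coeff_mono (by simp), coeff_mono (by simp)]
  by_cases hb : b.1 + b.2 = 2
  · obtain ⟨i, j⟩ := b
    have hi : i ≤ 2 := by simp only at hb; omega
    simp only at hb
    interval_cases i
    · obtain rfl : j = 2 := by omega
      simp
    · obtain rfl : j = 1 := by omega
      simp
    · obtain rfl : j = 0 := by omega
      simp
  · rw [hX _ (by rw [degree_xp]; exact hb), if_neg, if_neg, if_neg]
    · simp
    all_goals
      rintro rfl
      exact hb rfl

/-- The three basis elements of sp(2): p² kills σ by definition of `R`, qp because the middle height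
has eigenvalue 0, and q² by `raise_eq_zero`. -/
theorem R_lieDer {m : ℕ} {P : Multiset ℕ → Prop} {σ : Fun Ham0 m} (hσ : σ ∈ R m P) {X : Ham0}
    (hX : X ∈ sp2) : lieDer X m σ = 0 := by
  have hA := (mem_cochain_iff.1 hσ.1.1).1
  have h0 : lieDer (mono (0, 2)) m σ = 0 := hσ.2
  have h1 : ((20 + 2 * m : ℝ) - 2 * (10 + m : ℕ)) = 0 := by
    push_cast
    ring
  rw [sp2_eq hX, hA.lieDer_add, hA.lieDer_add, hA.lieDer_smul, hA.lieDer_smul, hA.lieDer_smul,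
    raise_eq_zero hσ.1 h0, h0, lieDer_mono_one_one hσ.1, h1]
  simp

theorem mem_C_succ {m : ℕ} {σ : Fun Ham0 (m + 1)} : σ ∈ C 20 (m + 1) ↔
    σ ∈ cochain Ham0 (m + 1) ∧ (∀ X ∈ sp2, ip X σ = 0 ∧ ip X (d (m + 1) σ) = 0) ∧
      σ ∈ weightPart 20 (m + 1) := by
  rw [C, relCochain, Submodule.mem_inf, Submodule.mem_inf, and_assoc]
  simp only [Submodule.mem_iInf, Submodule.mem_inf, LinearMap.mem_ker]
  rfl

theorem R_le_C (m : ℕ) (P : Multiset ℕ → Prop) : R (m + 1) P ≤ C 20 (m + 1) := by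
  intro σ hσ
  have hA := (mem_cochain_iff.1 hσ.1.1).1
  refine mem_C_succ.2 ⟨hσ.1.1, fun X hX => ⟨V_ip hσ.1 hX, ?_⟩, V_le_weightPart _ _ _ hσ.1⟩
  rw [hA.ip_d, R_lieDer hσ hX, V_ip hσ.1 hX, map_zero, sub_zero]

/-- For a cochain killed by all contractions with sp(2), Cartan's formula identifies i_X dσ with L_X
σ. The contractions force every degree to be at least 3, and invariance under qp forces equal
degrees in q and p, that is, the middle height. -/
theorem C_eq_R (m : ℕ) : C 20 (m + 1) = R (m + 1) fun _ => True := by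
  refine le_antisymm (fun σ hσ => ?_) (R_le_C m _)
  obtain ⟨h1, h2, h3⟩ := mem_C_succ.1 hσ
  have hA := (mem_cochain_iff.1 h1).1
  have hL : ∀ X ∈ sp2, lieDer X (m + 1) σ = 0 := fun X hX => by
    have := hA.ip_d X
    rw [(h2 X hX).1, (h2 X hX).2, map_zero, sub_zero] at this
    exact this.symm
  refine ⟨⟨h1, fun n hn hw => ?_⟩, hL _ (mono_mem_sp2 rfl)⟩
  by_contra h0
  have h4 : ∀ i, 3 ≤ (n i).1 + (n i).2 := by
    intro i
    by_contra h5
    have h6 : (n i).1 + (n i).2 = 2 := by have := hn i; omega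
    have h7 := hA.map_update (mono (n i)) i fun i => mono (n i)
    rw [Function.update_eq_self] at h7
    refine h0 (h7.trans ?_)
    have h8 := congrFun (h2 _ (mono_mem_sp2 h6)).1 fun k => mono (n (i.succAbove k))
    rw [ip_apply] at h8
    rw [h8, Pi.zero_apply, mul_zero]
  have h5 : (∑ i, (((n i).1 + (n i).2 : ℕ) - 2 : ℤ)) = 20 := by
    by_contra h5
    exact h0 (h3 (Nat.succ_ne_zero m) _ _ (fun i => isHomog_mono (hn i)) h5)
  -- The action of qp multiplies the nonzero value by the difference of the total exponents of q and
  -- p, so the two totals agree.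
  have h6 := congrFun (hL _ (mono_mem_sp2 (a := (1, 1)) rfl)) fun i => mono (n i)
  rw [lieDer_mono_apply hA (by simp) hn] at h6
  simp only [Nat.add_sub_cancel_left, Prod.mk.eta, Function.update_eq_self, Nat.cast_one,
    one_mul] at h6
  rw [← Finset.sum_mul, Pi.zero_apply, neg_eq_zero, mul_eq_zero, or_iff_left h0,
    Finset.sum_sub_distrib, sub_eq_zero] at h6
  have h7 : (∑ i, (n i).2) = ∑ i, (n i).1 := by exact_mod_cast h6
  refine hw ⟨h4, ?_, trivial, ?_⟩
  · zify
    rw [← h5]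
    refine Finset.sum_congr rfl fun i _ => ?_
    rw [Nat.cast_sub (hn i)]
    rfl
  · simp only [Nat.cast_add, Finset.sum_sub_distrib, Finset.sum_add_distrib] at h5
    zify at h7 ⊢
    rw [← h7] at h5
    simp only [Finset.sum_const, Finset.card_univ, Fintype.card_fin, nsmul_eq_mul] at h5
    push_cast at h5
    linarith

/-- The bracket of degrees l and l' has degree l + l' - 2, so l - 2 is additive and the tuples at
which d evaluates σ have the weight of the original tuple. -/
theorem d_weightPart {m : ℕ} {σ : Fun Ham0 (m + 1)} (hσ : σ ∈ cochain Ham0 (m + 1))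
    (hw : σ ∈ weightPart 20 (m + 1)) : d (m + 1) σ ∈ weightPart 20 (m + 2) := by
  intro _ l X hX hl
  refine cochain_eq_zero_of_closure (cochain_d hσ)
    (fun i => mono '' {a | a ∈ {a : ℕ × ℕ | a.1 + a.2 = l i} ∧ 2 ≤ a.1 + a.2})
    (fun Z hZ => ?_) _ fun i => mem_closure_span_mono _ _ fun a ha =>
      MvPowerSeries.IsHomogeneous.coeff_eq_zero (hX i) (by rw [degree_xp]; exact ha)
  choose n hn hn' using hZ
  obtain rfl : (fun i => mono (n i)) = Z := funext hn'
  rw [d_succ_apply]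
  refine Finset.sum_eq_zero fun j _ => Finset.sum_eq_zero fun i _ => ?_
  split_ifs with hij
  swap
  · rfl
  rw [lie_mono (hn _).2 (hn _).2]
  set c : ℝ := (n i.castSucc).1 * (n j).2 - (n i.castSucc).2 * (n j).1 with hc
  set b : ℕ × ℕ := ((n i.castSucc).1 + (n j).1 - 1, (n i.castSucc).2 + (n j).2 - 1) with hb
  have h1 : σ (Fin.cons (c • mono b) fun k : Fin m => mono (n (j.succAbove (i.succAbove k)))) =
      c * σ (Fin.cons (mono b) fun k : Fin m => mono (n (j.succAbove (i.succAbove k)))) := by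
    obtain ⟨φ, rfl⟩ := hσ
    exact φ.cons_smul _ c (mono b)
  rw [h1]
  -- If the coefficient is zero, the truncated exponents need not have the right degree; the term
  -- vanishes anyway.
  by_cases hc0 : c = 0
  · rw [hc0, zero_mul, mul_zero]
  have h2 : 1 ≤ (n i.castSucc).1 + (n j).1 := by
    by_contra h
    have h3 : (n i.castSucc).1 = 0 := by omega
    have h4 : (n j).1 = 0 := by omega
    exact hc0 (by simp [hc, h3, h4])
  have h2' : 1 ≤ (n i.castSucc).2 + (n j).2 := by
    by_contra h
    have h3 : (n i.castSucc).2 = 0 := by omega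
    have h4 : (n j).2 = 0 := by omega
    exact hc0 (by simp [hc, h3, h4])
  have hi := (hn i.castSucc).2
  have hj := (hn j).2
  have hbd : b.1 + b.2 + 2 = (n i.castSucc).1 + (n i.castSucc).2 + ((n j).1 + (n j).2) := by
    simp only [hb]
    omega
  have hdi : (n i.castSucc).1 + (n i.castSucc).2 = l i.castSucc := (hn i.castSucc).1
  have hdj : (n j).1 + (n j).2 = l j := (hn j).1
  suffices hz : σ (Fin.cons (mono b) fun k : Fin m => mono (n (j.succAbove (i.succAbove k)))) = 0 by
    rw [hz, mul_zero, mul_zero]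
  refine hw (Nat.succ_ne_zero m)
    (Fin.cons (b.1 + b.2) fun k : Fin m => l (j.succAbove (i.succAbove k))) _ (fun k => ?_) ?_
  · refine Fin.cases ?_ (fun k => ?_) k
    · exact isHomog_mono (by omega)
    · rw [Fin.cons_succ, Fin.cons_succ, ← (hn _).1]
      exact isHomog_mono (hn _).2
  · rw [Fin.sum_univ_succ]
    simp only [Fin.cons_zero, Fin.cons_succ]
    rw [Fin.sum_univ_succAbove _ j, Fin.sum_univ_succAbove _ i,
      Fin.succAbove_of_castSucc_lt j i hij] at hl
    intro h
    apply hl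
    rw [← h]
    zify at hbd hdi hdj
    push_cast
    linarith

theorem d_mem_C {w m : ℕ} (hw : w = 20) {σ : Fun Ham0 m} (hσ : σ ∈ C w m) :
    d m σ ∈ C w (m + 1) := by
  subst hw
  cases m with
  | zero =>
    rw [d_zero_apply]
    exact Submodule.zero_mem _
  | succ m =>
    obtain ⟨h1, h2, h3⟩ := mem_C_succ.1 hσ
    have hA := (mem_cochain_iff.1 h1).1
    refine mem_C_succ.2 ⟨cochain_d h1, fun X hX => ⟨(h2 X hX).2, ?_⟩, d_weightPart h1 h3⟩
    rw [hA.d_lieDer_and_d_d.2, map_zero]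


/-! Integer linear systems: the solution space over `ℝ` is not larger than the one modulo a
prime. -/

/-- Take a maximal set of rows independent modulo p. It has a right inverse modulo p; for an
integral lift of the inverse, the determinant of the product is 1 modulo p, hence a nonzero integer.
So the same rows are independent over ℝ, and the real rank is at least the rank modulo p. -/
theorem finrank_real_le_zmod {p : ℕ} [Fact p.Prime] {ι : Type} [Fintype ι] [DecidableEq ι]
    (rows : Set (ι → ℤ)) (SR : Submodule ℝ (ι → ℝ)) (SP : Submodule (ZMod p) (ι → ZMod p))
    (hR : ∀ c ∈ SR, ∀ r ∈ rows, ∑ i, (r i : ℝ) * c i = 0)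
    (hP : ∀ c : ι → ZMod p, (∀ r ∈ rows, ∑ i, (r i : ZMod p) * c i = 0) → c ∈ SP) :
    Module.finrank ℝ SR ≤ Module.finrank (ZMod p) SP := by
  classical
  obtain ⟨b, hb, hspan, hli⟩ := exists_linearIndependent (ZMod p)
    ((fun r : ι → ℤ => fun i => (r i : ZMod p)) '' rows)
  have := hli.setFinite.fintype
  choose lift hlift hlift' using fun x : b => hb x.2
  let A : Matrix b ι ℤ := Matrix.of lift
  let Ap : Matrix b ι (ZMod p) := A.map (Int.castRingHom (ZMod p))
  let Ar : Matrix b ι ℝ := A.map (Int.castRingHom ℝ)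
  have hrow : Ap.row = fun x : b => (x : ι → ZMod p) := by
    funext x
    exact hlift' x
  have hApli : LinearIndependent (ZMod p) Ap.row := by
    rw [hrow]
    exact hli
  have hAp : Ap.rank = Fintype.card b := hApli.rank_matrix
  have h1 : LinearMap.ker Ap.mulVecLin ≤ SP := by
    intro c hc
    apply hP
    have h2 : ∀ x ∈ Submodule.span (ZMod p) b, ∑ i, x i * c i = 0 := by
      intro x hx
      induction hx using Submodule.span_induction with
      | mem x hx =>
        have h3 := congrFun (LinearMap.mem_ker.1 hc) ⟨x, hx⟩
        have h4 := congrFun hrow ⟨x, hx⟩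
        refine Eq.trans (Finset.sum_congr rfl fun i _ => ?_) h3
        exact congrArg (· * c i) (congrFun h4 i).symm
      | zero => simp
      | add x y _ _ hx hy => simp [add_mul, Finset.sum_add_distrib, hx, hy]
      | smul a x _ hx => simp [mul_assoc, ← Finset.mul_sum, hx]
    intro r hr
    refine h2 (fun i => (r i : ZMod p)) ?_
    rw [hspan]
    exact Submodule.subset_span ⟨r, hr, rfl⟩
  have h2 : SR ≤ LinearMap.ker Ar.mulVecLin := by
    intro c hc
    rw [LinearMap.mem_ker]
    funext x
    exact hR c hc _ (hlift x)
  have hsurj : Function.Surjective Ap.mulVec := by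
    have h3 : LinearMap.range Ap.mulVecLin = ⊤ := by
      apply Submodule.eq_top_of_finrank_eq
      rw [Module.finrank_fintype_fun_eq_card, ← hAp, Matrix.rank]
    exact LinearMap.range_eq_top.1 h3
  obtain ⟨Cp, hCp⟩ := Matrix.mulVec_surjective_iff_exists_right_inverse.1 hsurj
  let Cz : Matrix ι b ℤ := Cp.map fun a => (a.cast : ℤ)
  have hCz : Cz.map (Int.castRingHom (ZMod p)) = Cp := by
    ext i j
    simp [Cz]
  have hdet : (A * Cz).det ≠ 0 := by
    intro h0
    have h3 : ((A * Cz).map (Int.castRingHom (ZMod p))).det = 0 := by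
      rw [← RingHom.mapMatrix_apply, ← RingHom.map_det, h0, map_zero]
    rw [Matrix.map_mul, hCz] at h3
    change (Ap * Cp).det = 0 at h3
    rw [hCp, Matrix.det_one] at h3
    exact one_ne_zero h3
  have hAr : Fintype.card b ≤ Ar.rank := by
    have h3 : ((A * Cz).map (Int.castRingHom ℝ)).det ≠ 0 := by
      rw [← RingHom.mapMatrix_apply, ← RingHom.map_det]
      simpa using hdet
    rw [Matrix.map_mul] at h3
    have h4 := Matrix.rank_of_isUnit _
      ((Matrix.isUnit_iff_isUnit_det _).2 (isUnit_iff_ne_zero.2 h3))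
    rw [← h4]
    exact Matrix.rank_mul_le_left _ _
  have h3 := Submodule.finrank_mono h1
  have h4 := Submodule.finrank_mono h2
  have h5 := Ap.mulVecLin.finrank_range_add_finrank_ker
  have h6 := Ar.mulVecLin.finrank_range_add_finrank_ker
  rw [Module.finrank_fintype_fun_eq_card] at h5 h6
  change Ap.rank + _ = _ at h5
  change Ar.rank + _ = _ at h6
  omega

/-- Functions supported on `I` that satisfy the linear equations with integer coefficients
`rows`. -/
def Sol (K : Type) [Field K] (I : Finset ℕ) (rows : Set (ℕ →₀ ℤ)) : Submodule K (ℕ → K) where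
  carrier := {c | (∀ y ∉ I, c y = 0) ∧ ∀ r ∈ rows, (r.sum fun y a => (a : K) * c y) = 0}
  zero_mem' := ⟨fun _ _ => rfl, fun r _ => by simp⟩
  add_mem' hc hc' := ⟨fun y hy => by rw [Pi.add_apply, hc.1 y hy, hc'.1 y hy, add_zero],
    fun r hr => by simp only [Pi.add_apply, mul_add, Finsupp.sum_add, hc.2 r hr, hc'.2 r hr,
      add_zero]⟩
  smul_mem' a c hc := ⟨fun y hy => by rw [Pi.smul_apply, hc.1 y hy, smul_zero],
    fun r hr => by
      simp only [Pi.smul_apply, smul_eq_mul, mul_left_comm _ a]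
      rw [← Finsupp.mul_sum, hc.2 r hr, mul_zero]⟩

theorem sum_eq_of_support {K : Type} [Field K] {I : Finset ℕ} {c : ℕ → K} (hc : ∀ y ∉ I, c y = 0)
    (r : ℕ →₀ ℤ) : (r.sum fun y a => (a : K) * c y) = ∑ y : I, (r y : K) * c y := by
  rw [Finset.sum_coe_sort I fun y => (r y : K) * c y, Finsupp.sum]
  trans ∑ y ∈ r.support ∪ I, (r y : K) * c y
  · refine Finset.sum_subset Finset.subset_union_left fun y _ hy => ?_
    rw [Finsupp.notMem_support_iff.1 hy, Int.cast_zero, zero_mul]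
  · refine (Finset.sum_subset Finset.subset_union_right fun y _ hy => ?_).symm
    rw [hc y hy, mul_zero]

theorem restrict_injective (K : Type) [Field K] (I : Finset ℕ) (rows : Set (ℕ →₀ ℤ)) :
    Function.Injective ((LinearMap.funLeft K K (Subtype.val : I → ℕ)) ∘ₗ
      (Sol K I rows).subtype) := by
  rw [← LinearMap.ker_eq_bot, LinearMap.ker_eq_bot']
  rintro ⟨c, hc⟩ h
  apply Subtype.ext
  funext y
  by_cases hy : y ∈ I
  · exact congrFun h ⟨y, hy⟩
  · exact hc.1 y hy

instance (K : Type) [Field K] (I : Finset ℕ) (rows : Set (ℕ →₀ ℤ)) :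
    Module.Finite K (Sol K I rows) :=
  Module.Finite.of_injective _ (restrict_injective K I rows)

theorem finrank_Sol_le (p : ℕ) [Fact p.Prime] (I : Finset ℕ) (rows : Set (ℕ →₀ ℤ)) :
    Module.finrank ℝ (Sol ℝ I rows) ≤ Module.finrank (ZMod p) (Sol (ZMod p) I rows) := by
  classical
  rw [← LinearMap.finrank_range_of_inj (restrict_injective ℝ I rows),
    ← LinearMap.finrank_range_of_inj (restrict_injective (ZMod p) I rows)]
  refine finrank_real_le_zmod ((fun (r : ℕ →₀ ℤ) (y : I) => r y) '' rows) _ _ ?_ ?_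
  · rintro _ ⟨⟨c, hc⟩, rfl⟩ _ ⟨r, hr, rfl⟩
    exact (sum_eq_of_support hc.1 r).symm.trans (hc.2 r hr)
  · intro c hc
    have h0 : ∀ y ∉ I, (fun y => if h : y ∈ I then c ⟨y, h⟩ else 0) y = 0 :=
      fun y hy => dif_neg hy
    refine ⟨⟨fun y => if h : y ∈ I then c ⟨y, h⟩ else 0, h0, fun r hr => ?_⟩, ?_⟩
    · rw [sum_eq_of_support h0]
      refine Eq.trans (Finset.sum_congr rfl fun y _ => ?_) (hc _ ⟨r, hr, rfl⟩)
      simp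
    · funext y
      simp [LinearMap.funLeft_apply]


/-! ### The program that bounds the dimension of the closed invariants modulo 8191. -/

/-- Evaluation of `x` before it is passed to `k`. -/
def force {α : Type} (x : ℕ) (k : ℕ → α) : α :=
  Nat.rec (motive := fun _ => α) (k 0) (fun n _ => k (Nat.succ n)) x

/-- `if b then x else y`. -/
def sel {α : Type} (b : Bool) (x y : α) : α := Bool.rec (motive := fun _ => α) y x b

/-- The negative of the inverse of `k` modulo `8191`. -/
def ninv (k : ℕ) : ℕ := Nat.sub 8191 (Nat.mod (Nat.pow k 8189) 8191)

/-- A partial reduction of all digits modulo `8191`; the digits of `M` are `8191`. -/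
def fold (M x : ℕ) : ℕ :=
  force (Nat.land x M) fun a => Nat.add a (Nat.shiftRight (Nat.sub x a) 13)

/-- The raising relation at `z`, without the term at the position of `w0`. -/
def sumE (f : ℕ → ℕ) (z w0 : ℕ) (m : ℕ) : ℕ → ℕ → ℕ → ℕ :=
  Nat.rec (motive := fun _ => ℕ → ℕ → ℕ → ℕ) (fun _ _ _ => 0)
    (fun _ ih r w prev => force (Nat.land r 1023) fun c => force (Nat.land c 31) fun k =>
      (fun rest : ℕ => sel (Nat.beq k 0) rest (sel (Nat.beq c (Nat.succ prev)) rest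
        (sel (Nat.beq w w0) rest (Nat.add (Nat.mul k (force (Nat.sub z w) f)) rest))))
      (force (Nat.shiftRight r 10) fun r' => force (Nat.mul w 1024) fun w' => ih r' w' c)) m

/-- The lowering relation at `z`, without the term at the position of `w0`. -/
def sumF (f : ℕ → ℕ) (z w0 : ℕ) (m : ℕ) : ℕ → ℕ → ℕ :=
  Nat.rec (motive := fun _ => ℕ → ℕ → ℕ) (fun _ _ => 0)
    (fun _ ih r w => force (Nat.land r 1023) fun c =>
      force (Nat.sub (Nat.shiftRight c 5) (Nat.land c 31)) fun k =>
      force (Nat.shiftRight r 10) fun r' =>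
      (fun rest : ℕ => sel (Nat.beq k 0) rest (sel (Nat.beq (Nat.land r' 1023) (Nat.succ c)) rest
        (sel (Nat.beq w w0) rest (Nat.add (Nat.mul k (force (Nat.add z w) f)) rest))))
      (force (Nat.mul w 1024) fun w' => ih r' w')) m

/-- The position of `y` in a list, counted from `n`. -/
def idx (y : ℕ) (fr : List ℕ) : ℕ → ℕ :=
  List.rec (motive := fun _ => ℕ → ℕ) (fun n => n)
    (fun a _ ih n => sel (Nat.beq a y) n (force (Nat.succ n) ih)) fr

/-- Reduction at the last degree: `n` steps raise the exponent of `p` to its maximum. -/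
def redE (m wQ lQ : ℕ) (fr : List ℕ) (off M : ℕ) (n : ℕ) : ℕ → ℕ :=
  Nat.rec (motive := fun _ => ℕ → ℕ) (fun y => Nat.add (Nat.mod (Nat.mul y y) 8191)
      (Nat.shiftLeft 1 (Nat.mul 40 (Nat.succ (idx y fr off)))))
    (fun n ih y => force (Nat.add y wQ) fun z =>
      fold M (fold M (Nat.mul (ninv (Nat.sub lQ n)) (sumE ih z wQ m z 1 0)))) n

/-- Reduction at the first degree: `n` steps lower the exponent of `p` to zero. -/
def redF (m wP lP : ℕ) (M : ℕ) (base : ℕ → ℕ) (n : ℕ) : ℕ → ℕ :=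
  Nat.rec (motive := fun _ => ℕ → ℕ) base
    (fun n ih y => force (Nat.sub y wP) fun z =>
      fold M (fold M (Nat.mul (ninv (Nat.sub lP n)) (sumF ih z wP m z 1)))) n

/-- The digit of `y` at the position of weight `w`. -/
def dg (y w : ℕ) : ℕ := Nat.land (Nat.div y w) 1023

/-- The encoded linear combination of free tuples equal to the tuple `y` of type `T`. -/
def red (m T wP wQ : ℕ) (fr : List ℕ) (off M : ℕ) (y : ℕ) : ℕ :=
  force (Nat.shiftRight (dg T wP) 5) fun lP => force (Nat.shiftRight (dg T wQ) 5) fun lQ =>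
  force (Nat.land (dg y wP) 31) fun n =>
    redF m wP lP M (fun y => force (Nat.sub lQ (Nat.land (dg y wQ) 31)) fun n =>
      redE m wQ lQ fr off M n y) n y

/-- Insertion of the code `a` into a sorted packed tuple, with the sign of the permutation. -/
def insK (f : Bool → ℕ → ℕ) (a : ℕ) (n : ℕ) : ℕ → ℕ → ℕ → Bool → ℕ :=
  Nat.rec (motive := fun _ => ℕ → ℕ → ℕ → Bool → ℕ)
    (fun acc w _ s => f s (Nat.add acc (Nat.mul a w)))
    (fun _ ih acc w R s => force (Nat.land R 1023) fun b =>
      sel (Nat.blt a b) (f s (Nat.add acc (Nat.mul w (Nat.add a (Nat.mul 1024 R)))))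
        (sel (Nat.beq a b) 0
          (force (Nat.add acc (Nat.mul b w)) fun acc' => force (Nat.mul w 1024) fun w' =>
            force (Nat.shiftRight R 10) fun R' => ih acc' w' R' (sel s false true)))) n

/-- The terms of the coboundary with the bracket of `a` and one of the next `n` codes. -/
def rowL (f : ℕ → ℕ) (a : ℕ) (n : ℕ) : ℕ → ℕ → ℕ → Bool → ℕ :=
  Nat.rec (motive := fun _ => ℕ → ℕ → ℕ → Bool → ℕ) (fun _ _ _ _ => 0)
    (fun n ih acc w R s => force (Nat.land R 1023) fun b => force (Nat.shiftRight R 10) fun R' =>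
      force (Nat.mul (Nat.shiftRight a 5) (Nat.land b 31)) fun u =>
      force (Nat.mul (Nat.shiftRight b 5) (Nat.land a 31)) fun v =>
      (fun rest : ℕ => sel (Nat.beq u v) rest (Nat.add (force (Nat.sub (Nat.add a b) 65) fun c =>
        insK (fun s y => Nat.mul
          (sel s (sel (Nat.ble v u) (Nat.sub u v) (Nat.sub 8191 (Nat.sub v u)))
            (sel (Nat.ble v u) (Nat.sub 8191 (Nat.sub u v)) (Nat.sub v u))) (force y f))
          c n acc w R' s) rest))
      (force (Nat.add acc (Nat.mul b w)) fun acc' => force (Nat.mul w 1024) fun w' =>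
        ih acc' w' R' s)) n

/-- The coboundary at a packed tuple of `n` codes. -/
def rowD (f : ℕ → ℕ) (n : ℕ) : ℕ → ℕ → ℕ → Bool → ℕ :=
  Nat.rec (motive := fun _ => ℕ → ℕ → ℕ → Bool → ℕ) (fun _ _ _ _ => 0)
    (fun n ih acc w R s => force (Nat.land R 1023) fun a => force (Nat.shiftRight R 10) fun R' =>
      Nat.add (rowL f a n acc w R' s)
      (force (Nat.add acc (Nat.mul a w)) fun acc' => force (Nat.mul w 1024) fun w' =>
        ih acc' w' R' (sel s false true))) n

/-- The check for a sorted packed tuple of codes with height `h` and weight `W`. -/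
def good (n : ℕ) : ℕ → ℕ → ℕ → ℕ → Bool :=
  Nat.rec (motive := fun _ => ℕ → ℕ → ℕ → ℕ → Bool)
    (fun R _ h W => sel (Nat.beq R 0) (sel (Nat.beq h 0) (Nat.beq W 0) false) false)
    (fun _ ih R prev h W => force (Nat.land R 1023) fun a =>
      force (Nat.shiftRight a 5) fun l => force (Nat.land a 31) fun k =>
      sel (Nat.blt prev a) (sel (Nat.ble k l) (sel (Nat.ble k h) (sel (Nat.ble (Nat.sub l 2) W)
        (force (Nat.shiftRight R 10) fun R' => force (Nat.sub h k) fun h' =>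
          force (Nat.sub W (Nat.sub l 2)) fun W' => ih R' a h' W') false) false) false) false) n

/-- Elimination of the leading digit from the remaining rows. -/
def pivot (K : List ℕ → ℕ) (sh Wm piv c0 : ℕ) (rows : List ℕ) : List ℕ → ℕ :=
  List.rec (motive := fun _ => List ℕ → ℕ) K
    (fun r _ ih acc => force (Nat.mod (Nat.mul (Nat.shiftRight r sh) c0) 8191) fun c =>
      force (Nat.land (Nat.add r (Nat.mul c piv)) Wm) fun v => ih (List.cons v acc)) rows

/-- Search for a pivot in the leading column. -/
def elimCol (K0 K1 : List ℕ → ℕ) (M sh Wm : ℕ) (rows : List ℕ) : List ℕ → ℕ :=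
  List.rec (motive := fun _ => List ℕ → ℕ) K0
    (fun r rs ih acc => force (Nat.mod (Nat.shiftRight r sh) 8191) fun d =>
      sel (Nat.beq d 0) (force (Nat.land r Wm) fun v => ih (List.cons v acc))
        (force (fold M (fold M (fold M r))) fun piv => force (ninv d) fun c0 =>
          pivot K1 sh Wm piv c0 rs acc)) rows

/-- The number of columns without pivot, added to `d`. -/
def elim (M n : ℕ) : List ℕ → ℕ → ℕ :=
  Nat.rec (motive := fun _ => List ℕ → ℕ → ℕ) (fun _ d => d)
    (fun n ih rows d => force (Nat.mul 40 (Nat.succ n)) fun sh =>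
      force (Nat.sub (Nat.pow 2 sh) 1) fun Wm =>
      elimCol (fun rows => force (Nat.succ d) (ih rows)) (fun rows => ih rows d) M sh Wm rows
        List.nil) n

/-- The free tuples of type `T` with given height. -/
def free (wP wQ n : ℕ) : ℕ → ℕ → ℕ → ℕ → ℕ → List ℕ → List ℕ :=
  Nat.rec (motive := fun _ => ℕ → ℕ → ℕ → ℕ → ℕ → List ℕ → List ℕ)
    (fun _ _ _ h y acc => sel (Nat.beq h 0) (List.cons y acc) acc)
    (fun _ ih T w prev h y acc => force (Nat.land T 1023) fun c =>
      force (Nat.shiftRight c 5) fun l =>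
      force (Nat.shiftRight T 10) fun T' => force (Nat.mul w 1024) fun w' =>
      force (sel (Nat.beq w wQ) l 0) fun lo => force (sel (Nat.beq w wP) 0 l) fun hi =>
      Nat.rec (motive := fun _ => ℕ → List ℕ → List ℕ) (fun _ acc => acc)
        (fun _ ih2 k acc => force (Nat.succ k) fun k' => ih2 k'
          (sel (Nat.ble k h) (sel (Nat.blt prev (Nat.add c k))
            (force (Nat.sub h k) fun h' => force (Nat.add y (Nat.mul w (Nat.add c k))) fun y' =>
              force (Nat.add c k) fun c' => ih T' w' c' h' y' acc) acc) acc))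
        (Nat.succ (Nat.sub hi lo)) lo acc) n

/-- Evaluation of a list, which is reversed, and of its length. -/
def norm (K : List ℕ → ℕ → ℕ) (l : List ℕ) : List ℕ → ℕ → ℕ :=
  List.rec (motive := fun _ => List ℕ → ℕ → ℕ) K
    (fun a _ ih acc n => force a fun a => force (Nat.succ n) fun n => ih (List.cons a acc) n) l

/-- The value of tuples treated in later blocks. -/
def later (TM Z y : ℕ) (bs : List (List (ℕ × ℕ × ℕ) × List ℕ × List ℕ × List ℕ)) : ℕ :=
  List.rec (motive := fun _ => ℕ) 0 (fun b _ ih =>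
    List.rec (motive := fun _ => ℕ) ih (fun t _ ih =>
      sel (Nat.beq (Nat.land y TM) t.1) Z ih) b.1) bs

/-- Addition of the reductions for the types of a block to the evaluation `f`. -/
def mkF (m TM M : ℕ) (K : (ℕ → ℕ) → ℕ → ℕ) (ts : List (ℕ × ℕ × ℕ)) : (ℕ → ℕ) → ℕ → ℕ :=
  List.rec (motive := fun _ => (ℕ → ℕ) → ℕ → ℕ) K
    (fun t _ ih f off => force (Nat.pow 1024 t.2.1) fun wP => force (Nat.pow 1024 t.2.2) fun wQ =>
      norm (fun fr off' => ih (fun y => sel (Nat.beq (Nat.land y TM) t.1)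
          (red m t.1 wP wQ fr off M y) (f y)) off')
        (free wP wQ m t.1 1 0 (Nat.add 10 m) 0 List.nil) List.nil off) ts

/-- The values below `Z` of the equations in `xs` that pass the check. -/
def collect (Z : ℕ) (chk : ℕ → Bool) (val : ℕ → ℕ) (K : List ℕ → ℕ) (xs : List ℕ) : List ℕ → ℕ :=
  List.rec (motive := fun _ => List ℕ → ℕ) K
    (fun x _ ih acc => sel (chk x) (force (val x) fun v =>
      sel (Nat.blt v Z) (ih (List.cons v acc)) (ih acc))
      (ih acc)) xs

/-- The sum of the numbers of free columns over all blocks. -/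
def dimB (m TM M N : ℕ) (bs : List (List (ℕ × ℕ × ℕ) × List ℕ × List ℕ × List ℕ)) : ℕ → ℕ :=
  List.rec (motive := fun _ => ℕ → ℕ) (fun d => d)
    (fun b bs ih d => force (Nat.pow 2 (Nat.mul 40 (Nat.succ N))) fun Z =>
      mkF m TM M (fun f n => sel (Nat.ble n N)
        (collect Z (fun x => good m x 95 (Nat.add 11 m) 20) (fun x => sumE f x 0 m x 1 0) (fun r =>
         collect Z (fun x => good m x 95 (Nat.add 9 m) 20) (fun x => sumF f x 0 m x 1) (fun r =>
         collect Z (fun x => good (Nat.succ m) x 95 (Nat.add 11 m) 20)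
            (fun x => rowD (fun y => sel (good m y 95 (Nat.add 10 m) 20) (f y) 0)
              (Nat.succ m) 0 1 x true) (fun r =>
            force (elim M n r d) ih) b.2.1 r) b.2.2.2 r) b.2.2.1 List.nil)
        (Nat.add (Nat.pow 1024 m) d)) b.1 (fun y => later TM Z y bs) 0) bs

/-- An upper bound for the dimension of the closed invariant functions modulo `8191`. -/
def kerDim (m : ℕ) (bs : List (List (ℕ × ℕ × ℕ) × List ℕ × List ℕ × List ℕ)) : ℕ :=
  force (Nat.mul 992 (Nat.div (Nat.sub (Nat.pow 1024 m) 1) 1023)) fun TM =>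
  force (Nat.mul 8191 (Nat.div (Nat.sub (Nat.pow 1099511627776 401) 1) 1099511627775)) fun M =>
    dimB m TM M 400 bs 0

/-- The program evaluates to `D`. -/
def Certified (m : ℕ) (bs : List (List (ℕ × ℕ × ℕ) × List ℕ × List ℕ × List ℕ)) (D : ℕ) : Prop :=
  Nat.beq (kerDim m bs) D = true

instance (m : ℕ) (bs : List (List (ℕ × ℕ × ℕ) × List ℕ × List ℕ × List ℕ)) (D : ℕ) :
    Decidable (Certified m bs D) :=
  inferInstanceAs (Decidable (_ = true))


/-! Numbers packed in base `2 ^ s`. -/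

/-- The recursion on `x` only serves to make the kernel compute `x` to a numeral before entering
`k`, so that unevaluated terms are not duplicated. -/
theorem force_eq {α : Type} (x : ℕ) (k : ℕ → α) : force x k = k x := by
  cases x <;> rfl

theorem sel_eq {α : Type} (b : Bool) (x y : α) : sel b x y = if b = true then x else y := by
  cases b <;> rfl

/-- The number with `n` digits `x i` in base `2 ^ s`. -/
def dsum (s n : ℕ) (x : ℕ → ℕ) : ℕ := ∑ i ∈ Finset.range n, x i * 2 ^ (s * i)

theorem dsum_succ (s n : ℕ) (x : ℕ → ℕ) : dsum s (n + 1) x = dsum s n x + x n * 2 ^ (s * n) :=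
  Finset.sum_range_succ _ _

theorem dsum_succ' (s n : ℕ) (x : ℕ → ℕ) :
    dsum s (n + 1) x = x 0 + 2 ^ s * dsum s n fun i => x (i + 1) := by
  rw [dsum, Finset.sum_range_succ', dsum, Finset.mul_sum, add_comm, mul_zero, pow_zero, mul_one]
  congr 1
  refine Finset.sum_congr rfl fun i _ => ?_
  rw [mul_add, pow_add, mul_one]
  ring

theorem dsum_lt {s n : ℕ} {x : ℕ → ℕ} (hx : ∀ i < n, x i < 2 ^ s) : dsum s n x < 2 ^ (s * n) := by
  induction n with
  | zero => simp [dsum]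
  | succ n ih =>
    rw [dsum_succ, mul_add, pow_add, mul_one]
    have h1 := ih fun i hi => hx i (by omega)
    have h2 : x n + 1 ≤ 2 ^ s := hx n (by omega)
    calc _ < (x n + 1) * 2 ^ (s * n) := by rw [add_mul, one_mul]; omega
      _ ≤ _ := by rw [mul_comm]; exact Nat.mul_le_mul_left _ h2

theorem dsum_div {s n : ℕ} {x : ℕ → ℕ} (hx : ∀ i < n, x i < 2 ^ s) {i : ℕ} (hi : i ≤ n) :
    dsum s n x / 2 ^ (s * i) = dsum s (n - i) fun j => x (i + j) := by
  induction i generalizing n x with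
  | zero => simp
  | succ i ih =>
    obtain ⟨k, rfl⟩ : ∃ k, n = k + 1 := ⟨n - 1, by omega⟩
    rw [mul_add, mul_one, add_comm (s * i), pow_add, ← Nat.div_div_eq_div_mul, dsum_succ',
      Nat.add_mul_div_left _ _ (by positivity), Nat.div_eq_of_lt (hx 0 (by omega)), zero_add,
      ih (fun i hi => hx _ (by omega)) (by omega)]
    rw [Nat.add_sub_add_right]
    congr 1
    funext j
    congr 1
    omega

theorem dsum_mod {s n : ℕ} (hn : 0 < n) {x : ℕ → ℕ} (hx : ∀ i < n, x i < 2 ^ s) :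
    dsum s n x % 2 ^ s = x 0 := by
  obtain ⟨k, rfl⟩ : ∃ k, n = k + 1 := ⟨n - 1, by omega⟩
  rw [dsum_succ', Nat.add_mul_mod_self_left, Nat.mod_eq_of_lt (hx 0 (by omega))]

theorem dsum_digit {s n : ℕ} {x : ℕ → ℕ} (hx : ∀ i < n, x i < 2 ^ s) {i : ℕ} (hi : i < n) :
    dsum s n x / 2 ^ (s * i) % 2 ^ s = x i := by
  rw [dsum_div hx hi.le, dsum_mod (by omega) fun j hj => hx _ (by omega), add_zero]

theorem dsum_congr {s n : ℕ} {x y : ℕ → ℕ} (h : ∀ i < n, x i = y i) : dsum s n x = dsum s n y :=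
  Finset.sum_congr rfl fun i hi => by rw [h i (Finset.mem_range.1 hi)]

theorem dsum_land {s n : ℕ} {x : ℕ → ℕ} (hx : ∀ i < n, x i < 2 ^ s) {M μ : ℕ}
    (hM : ∀ i < n, M / 2 ^ (s * i) % 2 ^ s = μ) :
    dsum s n x &&& M = dsum s n fun i => x i &&& μ := by
  induction n generalizing x M with
  | zero => simp [dsum]
  | succ n ih =>
    rw [← Nat.mod_add_div (dsum s (n + 1) x &&& M) (2 ^ s), Nat.and_mod_two_pow,
      Nat.and_div_two_pow, dsum_mod (by omega) hx, dsum_succ', dsum_succ',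
      Nat.add_mul_div_left _ _ (by positivity), Nat.div_eq_of_lt (hx 0 (by omega)), zero_add,
      ih (fun i hi => hx _ (by omega)) fun i hi => ?_]
    · congr 2
      simpa using hM 0 (by omega)
    · rw [Nat.div_div_eq_div_mul, ← pow_add, add_comm, ← mul_add_one]
      exact hM (i + 1) (by omega)

theorem dsum_add (s n : ℕ) (x y : ℕ → ℕ) :
    dsum s n x + dsum s n y = dsum s n fun i => x i + y i := by
  simp only [dsum, ← Finset.sum_add_distrib, add_mul]

theorem mul_dsum (s n k : ℕ) (x : ℕ → ℕ) : k * dsum s n x = dsum s n fun i => k * x i := by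
  simp only [dsum, Finset.mul_sum, mul_assoc]

/-! Packed linear combinations modulo `8191`. -/

theorem fold_eq (M x : ℕ) : fold M x = (x &&& M) + (x - (x &&& M)) / 8192 := by
  simp only [fold, force_eq]
  exact congrArg (_ + ·) (Nat.shiftRight_eq_div_pow _ 13)

/-- After the low 13 bits of all digits have been masked away, every digit is divisible by 8192, so
a single shift divides all digits at once without crossing between them. -/
theorem fold_dsum {n M : ℕ} (hM : ∀ i < n, M / 2 ^ (40 * i) % 2 ^ 40 = 8191) {x : ℕ → ℕ}
    (hx : ∀ i < n, x i < 2 ^ 40) :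
    fold M (dsum 40 n x) = dsum 40 n fun i => x i % 8192 + x i / 8192 := by
  have h1 : (fun i => x i &&& 8191) = fun i => x i % 8192 :=
    funext fun i => Nat.and_two_pow_sub_one_eq_mod (x i) 13
  have h2 : dsum 40 n x = dsum 40 n (fun i => x i % 8192) +
      8192 * dsum 40 n fun i => x i / 8192 := by
    rw [mul_dsum, dsum_add]
    exact dsum_congr fun i _ => (Nat.mod_add_div _ _).symm
  rw [fold_eq, dsum_land hx hM, h1, ← dsum_add, h2, Nat.add_sub_cancel_left,
    Nat.mul_div_cancel_left _ (by norm_num)]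

/-- Since 8192 = 1 modulo 8191, the low 13 bits and the rest may simply be added. -/
theorem cast_fold (x : ℕ) : ((x % 8192 + x / 8192 : ℕ) : ZMod 8191) = x := by
  conv_rhs => rw [← Nat.mod_add_div x 8192]
  push_cast
  congr 1
  have : ((8192 : ℕ) : ZMod 8191) = 1 := by decide +kernel
  rw [show (8192 : ZMod 8191) = 1 from this, one_mul]

instance fact_prime : Fact (Nat.Prime 8191) := ⟨by norm_num⟩

/-- By Fermat's little theorem, k^8189 is the inverse of k modulo 8191. -/
theorem cast_ninv {k : ℕ} (hk : (k : ZMod 8191) ≠ 0) :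
    (ninv k : ZMod 8191) = -(k : ZMod 8191)⁻¹ := by
  have h1 : ninv k + k ^ 8189 % 8191 = 8191 :=
    Nat.sub_add_cancel (Nat.mod_lt _ (by norm_num)).le
  have h2 : (ninv k : ZMod 8191) + (k : ZMod 8191) ^ 8189 = 0 := by
    have h3 := congrArg (Nat.cast : ℕ → ZMod 8191) h1
    push_cast [ZMod.natCast_mod] at h3
    rw [h3]
    exact ZMod.natCast_self 8191
  rw [eq_neg_of_add_eq_zero_left h2, neg_inj]
  refine eq_inv_of_mul_eq_one_left ?_
  rw [← pow_succ]
  exact ZMod.pow_card_sub_one_eq_one hk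

theorem ninv_le (k : ℕ) : ninv k ≤ 8191 := Nat.sub_le _ _

section Rep

variable {A : Type*} [AddCommGroup A] [Module (ZMod 8191) A]

/-- The number `X` encodes a linear combination of `u 0, …, u (n - 1)` with value `v` and digits
at most `b`; if `e` holds then arbitrary `X ≥ Z` are allowed as well. -/
def Rep (e : Prop) (Z : ℕ) (u : ℕ → A) (n b X : ℕ) (v : A) : Prop :=
  (e ∧ Z ≤ X) ∨ ∃ x : ℕ → ℕ, (∀ i < n, x i ≤ b) ∧ X = dsum 40 n x ∧
    v = ∑ i ∈ Finset.range n, (x i : ZMod 8191) • u i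

variable {e : Prop} {Z : ℕ} {u : ℕ → A} {n b b' X X' : ℕ} {v v' : A}

theorem Rep.zero : Rep e Z u n b 0 0 :=
  Or.inr ⟨fun _ => 0, fun _ _ => Nat.zero_le _, by simp [dsum], by simp⟩

theorem Rep.mono (h : Rep e Z u n b X v) (hb : b ≤ b') : Rep e Z u n b' X v :=
  h.imp id fun ⟨x, h1, h2⟩ => ⟨x, fun i hi => (h1 i hi).trans hb, h2⟩

/-- The exceptional case `Z ≤ X` is stable under sums, and under nonzero multiples in `Rep.mul`, as
all numbers are natural. It thereby acts as a sentinel: a total below Z shows that the exceptional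
case did not occur. -/
theorem Rep.add (h : Rep e Z u n b X v) (h' : Rep e Z u n b' X' v') :
    Rep e Z u n (b + b') (X + X') (v + v') := by
  rcases h with ⟨he, h⟩ | ⟨x, h1, rfl, rfl⟩
  · exact Or.inl ⟨he, h.trans (Nat.le_add_right _ _)⟩
  rcases h' with ⟨he, h⟩ | ⟨x', h1', rfl, rfl⟩
  · exact Or.inl ⟨he, h.trans (Nat.le_add_left _ _)⟩
  refine Or.inr ⟨fun i => x i + x' i, fun i hi => Nat.add_le_add (h1 i hi) (h1' i hi),
    dsum_add _ _ _ _, ?_⟩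
  simp only [Nat.cast_add, add_smul, Finset.sum_add_distrib]

theorem Rep.mul (h : Rep e Z u n b X v) {k : ℕ} (hk : k ≠ 0) :
    Rep e Z u n (k * b) (k * X) ((k : ZMod 8191) • v) := by
  rcases h with ⟨he, h⟩ | ⟨x, h1, rfl, rfl⟩
  · exact Or.inl ⟨he, h.trans (Nat.le_mul_of_pos_left _ (Nat.pos_of_ne_zero hk))⟩
  refine Or.inr ⟨fun i => k * x i, fun i hi => Nat.mul_le_mul_left _ (h1 i hi),
    mul_dsum _ _ _ _, ?_⟩
  simp only [Nat.cast_mul, mul_smul, Finset.smul_sum]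

theorem Rep.mono_e {e' : Prop} (h : Rep e Z u n b X v) (he : e → e') : Rep e' Z u n b X v :=
  h.imp (And.imp_left he) id

theorem Rep.fold (h : Rep False Z u n b X v) {M : ℕ} (hb : b < 2 ^ 40)
    (hM : ∀ i < n, M / 2 ^ (40 * i) % 2 ^ 40 = 8191) :
    Rep False Z u n (8191 + b / 8192) (fold M X) v := by
  rcases h with ⟨⟨⟩, -⟩ | ⟨x, h1, rfl, rfl⟩
  refine Or.inr ⟨fun i => x i % 8192 + x i / 8192, fun i hi => ?_,
    fold_dsum hM fun i hi => (h1 i hi).trans_lt hb, ?_⟩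
  · have := h1 i hi
    have := Nat.div_le_div_right (c := 8192) this
    have := Nat.mod_lt (x i) (show 0 < 8192 by norm_num)
    simp only
    omega
  · exact Finset.sum_congr rfl fun i _ => by rw [cast_fold]

theorem Rep.mem_span (h : Rep False Z u n b X v) :
    v ∈ Submodule.span (ZMod 8191) (u '' Set.Iio n) := by
  rcases h with ⟨⟨⟩, -⟩ | ⟨x, -, -, rfl⟩
  exact Submodule.sum_mem _ fun i hi => Submodule.smul_mem _ _
    (Submodule.subset_span ⟨i, Finset.mem_range.1 hi, rfl⟩)

end Rep

/-! Gaussian elimination. -/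

section Elim

variable {A : Type*} [AddCommGroup A] [Module (ZMod 8191) A] {M : ℕ}

/-- `X` encodes a linear relation between `u 0, …, u (n - 1)`, with digits at most `b`. -/
def Rel (u : ℕ → A) (n b X : ℕ) : Prop :=
  ∃ x : ℕ → ℕ, (∀ i < n, x i ≤ b) ∧ X = dsum 40 n x ∧
    ∑ i ∈ Finset.range n, (x i : ZMod 8191) • u i = 0

theorem dsum_top {n b : ℕ} (hb : b < 2 ^ 40) {x : ℕ → ℕ} (hx : ∀ i < n + 1, x i ≤ b) :
    dsum 40 (n + 1) x >>> (40 * n) = x n ∧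
      dsum 40 (n + 1) x &&& (2 ^ (40 * n) - 1) = dsum 40 n x := by
  have h1 : dsum 40 n x < 2 ^ (40 * n) := dsum_lt fun i hi => (hx i (by omega)).trans_lt hb
  rw [Nat.shiftRight_eq_div_pow, Nat.and_two_pow_sub_one_eq_mod, dsum_succ,
    Nat.add_mul_div_right _ _ (by positivity), Nat.div_eq_of_lt h1, zero_add,
    Nat.add_mul_mod_self_right, Nat.mod_eq_of_lt h1]
  exact ⟨rfl, rfl⟩

theorem cast_eq_zero_of_mod {a : ℕ} (h : a % 8191 = 0) : (a : ZMod 8191) = 0 :=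
  (ZMod.natCast_eq_zero_iff a 8191).2 (Nat.dvd_of_mod_eq_zero h)

theorem Rel.drop {u : ℕ → A} {n b b' : ℕ} (hb : b < 2 ^ 40) (hb' : b ≤ b') {x : ℕ → ℕ}
    (hx : ∀ i < n + 1, x i ≤ b) (hu : ∑ i ∈ Finset.range (n + 1), (x i : ZMod 8191) • u i = 0)
    (h0 : (x n : ZMod 8191) = 0) :
    Rel u n b' (dsum 40 (n + 1) x &&& (2 ^ (40 * n) - 1)) := by
  refine ⟨x, fun i hi => (hx i (by omega)).trans hb', (dsum_top hb hx).2, ?_⟩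
  rwa [Finset.sum_range_succ, h0, zero_smul, add_zero] at hu

theorem pivot_cons (K : List ℕ → ℕ) (sh Wm piv c0 r : ℕ) (rows acc : List ℕ) :
    pivot K sh Wm piv c0 (r :: rows) acc =
      pivot K sh Wm piv c0 rows (((r + (r >>> sh * c0 % 8191) * piv) &&& Wm) :: acc) := by
  simp only [pivot, force_eq]
  rfl

theorem elimCol_cons (K0 K1 : List ℕ → ℕ) (M sh Wm r : ℕ) (rows acc : List ℕ) :
    elimCol K0 K1 M sh Wm (r :: rows) acc =
      if Nat.beq (r >>> sh % 8191) 0 = true then elimCol K0 K1 M sh Wm rows ((r &&& Wm) :: acc)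
      else pivot K1 sh Wm (fold M (fold M (fold M r))) (ninv (r >>> sh % 8191)) rows acc := by
  rw [← sel_eq]
  simp only [elimCol, force_eq]
  rfl

theorem elim_succ (M n : ℕ) (rows : List ℕ) (d : ℕ) :
    elim M (n + 1) rows d = elimCol (fun rows => elim M n rows (d + 1))
        (fun rows => elim M n rows d) M (40 * (n + 1)) (2 ^ (40 * (n + 1)) - 1) rows [] := by
  simp only [elim, force_eq]
  rfl

/-- The multiplier cancels the leading digit modulo 8191. It is below 2^13 and the digits of the
pivot row are at most 2^14, so one elimination step increases a digit by at most 2^27. -/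
theorem pivot_le {u : ℕ → A} {n b t : ℕ} {K : List ℕ → ℕ} (hb : b + 2 ^ 27 < 2 ^ 40)
    {y : ℕ → ℕ} (hy : ∀ i < n + 1, y i ≤ 2 ^ 14)
    (hyu : ∑ i ∈ Finset.range (n + 1), (y i : ZMod 8191) • u i = 0) {d : ℕ}
    (hd : (d : ZMod 8191) ≠ 0) (hyd : (y n : ZMod 8191) = d)
    (hK : ∀ rs : List ℕ, (∀ r ∈ rs, Rel u n (b + 2 ^ 27) r) → t ≤ K rs) (rows acc : List ℕ)
    (hr : ∀ r ∈ rows, Rel u (n + 1) b r) (ha : ∀ r ∈ acc, Rel u n (b + 2 ^ 27) r) :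
    t ≤ pivot K (40 * n) (2 ^ (40 * n) - 1) (dsum 40 (n + 1) y) (ninv d) rows acc := by
  induction rows generalizing acc with
  | nil => exact hK acc ha
  | cons r rows ih =>
    rw [pivot_cons]
    refine ih _ (fun r hr' => hr r (List.mem_cons_of_mem _ hr')) fun r' hr' => ?_
    rcases List.mem_cons.1 hr' with rfl | hr'
    · obtain ⟨x, hx, rfl, hxu⟩ := hr r List.mem_cons_self
      set c := dsum 40 (n + 1) x >>> (40 * n) * ninv d % 8191 with hc
      have hc1 : c < 8191 := Nat.mod_lt _ (by norm_num)
      have hc2 : (c : ZMod 8191) = -(x n * (d : ZMod 8191)⁻¹) := by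
        rw [hc, (dsum_top (by omega) hx).1, ZMod.natCast_mod, Nat.cast_mul, cast_ninv hd, mul_neg]
      rw [mul_dsum, dsum_add]
      refine Rel.drop hb le_rfl (fun i hi => ?_) ?_ ?_
      · have h2 := Nat.mul_le_mul hc1.le (hy i hi)
        have h3 := hx i hi
        omega
      · simp only [Nat.cast_add, Nat.cast_mul, add_smul, mul_smul, Finset.sum_add_distrib, hxu,
          ← Finset.smul_sum, hyu, smul_zero, add_zero]
      · push_cast
        rw [hc2, hyd, neg_mul, mul_assoc, inv_mul_cancel₀ hd, mul_one, add_neg_cancel]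
    · exact ha r' hr'

/-- A row with nonzero leading digit expresses `u n` through the earlier vectors, so the column adds
nothing to the span and `K1` continues without counting it. If there is no such row, `K0` counts the
column. -/
theorem elimCol_le {u : ℕ → A} {n b t : ℕ} {K0 K1 : List ℕ → ℕ} (hb : b + 2 ^ 27 < 2 ^ 40)
    (hM : ∀ i < n + 1, M / 2 ^ (40 * i) % 2 ^ 40 = 8191)
    (h0 : ∀ rs : List ℕ, (∀ r ∈ rs, Rel u n (b + 2 ^ 27) r) → t ≤ K0 rs)
    (h1 : u n ∈ Submodule.span (ZMod 8191) (u '' Set.Iio n) →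
      ∀ rs : List ℕ, (∀ r ∈ rs, Rel u n (b + 2 ^ 27) r) → t ≤ K1 rs) (rows acc : List ℕ)
    (hr : ∀ r ∈ rows, Rel u (n + 1) b r) (ha : ∀ r ∈ acc, Rel u n (b + 2 ^ 27) r) :
    t ≤ elimCol K0 K1 M (40 * n) (2 ^ (40 * n) - 1) rows acc := by
  induction rows generalizing acc with
  | nil => exact h0 acc ha
  | cons r rows ih =>
    obtain ⟨x, hx, rfl, hxu⟩ := hr r List.mem_cons_self
    rw [elimCol_cons, (dsum_top (by omega) hx).1]
    split_ifs with h3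
    · refine ih _ (fun r hr' => hr r (List.mem_cons_of_mem _ hr')) fun r' hr' => ?_
      rcases List.mem_cons.1 hr' with rfl | hr'
      · exact Rel.drop (by omega) (by omega) hx hxu (cast_eq_zero_of_mod (Nat.eq_of_beq_eq_true h3))
      · exact ha r' hr'
    · have hd : ((x n % 8191 : ℕ) : ZMod 8191) ≠ 0 := by
        intro h4
        rw [ZMod.natCast_eq_zero_iff] at h4
        exact h3 (by
          rw [Nat.eq_zero_of_dvd_of_lt h4 (Nat.mod_lt _ (by norm_num))]
          rfl)
      have hxn : (x n : ZMod 8191) ≠ 0 := by rwa [ZMod.natCast_mod] at hd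
      -- Three folds bring digits below 2^40 down to at most 2^14.
      rw [fold_dsum hM fun i hi => (hx i hi).trans_lt (by omega), fold_dsum hM, fold_dsum hM]
      · refine pivot_le hb (fun i hi => ?_) ?_ hd ?_ (h1 ?_) rows acc
          (fun r hr' => hr r (List.mem_cons_of_mem _ hr')) ha
        · have := hx i hi
          omega
        · simpa only [cast_fold] using hxu
        · rw [cast_fold, cast_fold, cast_fold, ZMod.natCast_mod]
        · rw [Finset.sum_range_succ] at hxu
          have h4 : u n = -(x n : ZMod 8191)⁻¹ • ∑ i ∈ Finset.range n, (x i : ZMod 8191) • u i := by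
            rw [eq_neg_of_add_eq_zero_left hxu, smul_neg, neg_smul, neg_neg, smul_smul,
              inv_mul_cancel₀ hxn, one_smul]
          rw [h4]
          exact Submodule.smul_mem _ _ (Submodule.sum_mem _ fun i hi => Submodule.smul_mem _ _
            (Submodule.subset_span ⟨i, Finset.mem_range.1 hi, rfl⟩))
      all_goals
        intro i hi
        have := hx i hi
        omega

/-- The dimension of the span is at most the number of columns without pivot. Column 0 belongs to
the zero vector and is not counted. The hypothesis on b leaves room for growth by 2^27 in each of
the n steps, so that no carries between digits occur. -/
theorem elim_le [Module.Finite (ZMod 8191) A] {u : ℕ → A} (hu : u 0 = 0) (n : ℕ) {b : ℕ}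
    (hb : b + n * 2 ^ 27 < 2 ^ 40) (hM : ∀ i < n + 1, M / 2 ^ (40 * i) % 2 ^ 40 = 8191)
    (rows : List ℕ) (hr : ∀ r ∈ rows, Rel u (n + 1) b r) (d : ℕ) :
    Module.finrank (ZMod 8191) (Submodule.span (ZMod 8191) (u '' Set.Iio (n + 1))) + d ≤
      elim M n rows d := by
  induction n generalizing b rows d with
  | zero =>
    have h1 : u '' Set.Iio (0 + 1) = {0} := by
      rw [zero_add, show Set.Iio 1 = {0} from Set.ext fun i => Nat.lt_one_iff, Set.image_singleton,
        hu]
    rw [h1, Submodule.span_zero_singleton, finrank_bot, zero_add]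
    exact le_rfl
  | succ n ih =>
    have h2 : u '' Set.Iio (n + 1 + 1) = insert (u (n + 1)) (u '' Set.Iio (n + 1)) := by
      rw [← Set.image_insert_eq]
      congr 1
      ext i
      simp only [Set.mem_Iio, Set.mem_insert_iff]
      omega
    rw [elim_succ, h2, Submodule.span_insert]
    refine elimCol_le (by omega) hM (fun rs hrs => ?_) (fun hn rs hrs => ?_) rows [] hr (by simp)
    · refine le_trans ?_ (ih (by omega) (fun i hi => hM i (by omega)) rs hrs (d + 1))
      have h3 := Submodule.finrank_add_le_finrank_add_finrank
        (Submodule.span (ZMod 8191) {u (n + 1)}) (Submodule.span (ZMod 8191) (u '' Set.Iio (n + 1)))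
      have h4 : Module.finrank (ZMod 8191) (Submodule.span (ZMod 8191) {u (n + 1)}) ≤ 1 :=
        (finrank_span_le_card _).trans (by simp)
      omega
    · refine le_trans ?_ (ih (by omega) (fun i hi => hM i (by omega)) rs hrs d)
      rw [sup_eq_right.2 ((Submodule.span_singleton_le_iff_mem _ _).2 hn)]

end Elim


/-! Tuples of codes packed into natural numbers. -/

/-- The codes packed into `y`. -/
def dig (y i : ℕ) : ℕ := y / 2 ^ (10 * i) % 2 ^ 10

theorem dig_lt (y i : ℕ) : dig y i < 2 ^ 10 := Nat.mod_lt _ (by positivity)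

theorem dig_zero (y : ℕ) : dig y 0 = y % 2 ^ 10 := by simp [dig]

theorem dig_succ (y i : ℕ) : dig y (i + 1) = dig (y / 2 ^ 10) i := by
  rw [dig, dig, Nat.div_div_eq_div_mul, ← pow_add, mul_add_one, add_comm]

theorem dig_dsum {m : ℕ} {x : ℕ → ℕ} (hx : ∀ i < m, x i < 2 ^ 10) {i : ℕ} (hi : i < m) :
    dig (dsum 10 m x) i = x i := dsum_digit hx hi

theorem dsum_dig {m y : ℕ} (hy : y < 2 ^ (10 * m)) : dsum 10 m (dig y) = y := by
  induction m generalizing y with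
  | zero =>
    have : y = 0 := by simpa using hy
    simp [dsum, this]
  | succ m ih =>
    have h1 : y / 2 ^ 10 < 2 ^ (10 * m) := by
      rw [Nat.div_lt_iff_lt_mul (by positivity), ← pow_add]
      exact hy
    have h2 := ih h1
    rw [dsum_succ', dig_zero]
    simp only [dig_succ]
    rw [h2, Nat.mod_add_div]

/-- `y` packs an increasing tuple of codes of monomials of weight `20` and height `h`. -/
def Good (m h y : ℕ) : Prop :=
  y < 2 ^ (10 * m) ∧ (fun i : Fin m => dig y i) ∈ N m (fun _ => True) h

theorem good_succ (n R prev h W : ℕ) : good (n + 1) R prev h W =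
    (Nat.blt prev (dig R 0) && (Nat.ble (dig R 0 % 32) (dig R 0 / 32) &&
      (Nat.ble (dig R 0 % 32) h && (Nat.ble (dig R 0 / 32 - 2) W &&
        good n (R / 2 ^ 10) (dig R 0) (h - dig R 0 % 32) (W - (dig R 0 / 32 - 2)))))) := by
  have h1 : Nat.land R 1023 = dig R 0 := by
    rw [dig_zero]
    exact Nat.and_two_pow_sub_one_eq_mod R 10
  have h2 : ∀ a, Nat.land a 31 = a % 32 := fun a => Nat.and_two_pow_sub_one_eq_mod a 5
  have h3 : ∀ a, Nat.shiftRight a 5 = a / 32 := fun a => Nat.shiftRight_eq_div_pow a 5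
  have h4 : Nat.shiftRight R 10 = R / 2 ^ 10 := Nat.shiftRight_eq_div_pow R 10
  have h5 : ∀ b c : Bool, sel b c false = (b && c) := fun b c => by cases b <;> rfl
  simp only [good, force_eq, h1, h2, h3, h4, h5]
  rfl

theorem good_iff' (n R prev h W : ℕ) : good n R prev h W = true ↔ R < 2 ^ (10 * n) ∧
    (∀ i < n, prev < dig R i) ∧ (∀ i j, i < j → j < n → dig R i < dig R j) ∧
    (∀ i < n, dig R i % 32 ≤ dig R i / 32) ∧ ∑ i ∈ Finset.range n, dig R i % 32 = h ∧
    ∑ i ∈ Finset.range n, (dig R i / 32 - 2) = W := by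
  induction n generalizing R prev h W with
  | zero =>
    have : good 0 R prev h W = (Nat.beq R 0 && (Nat.beq h 0 && Nat.beq W 0)) := by
      have h5 : ∀ b c : Bool, sel b c false = (b && c) := fun b c => by cases b <;> rfl
      simp only [good, h5]
      rfl
    rw [this]
    simp only [Bool.and_eq_true, Nat.beq_eq]
    simp [eq_comm]
  | succ n ih =>
    rw [good_succ]
    simp only [Bool.and_eq_true, Nat.ble_eq, Nat.blt_eq, ih]
    simp only [← dig_succ, Finset.sum_range_succ']
    have h1 : R / 2 ^ 10 < 2 ^ (10 * n) ↔ R < 2 ^ (10 * (n + 1)) := by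
      rw [Nat.div_lt_iff_lt_mul (by positivity), ← pow_add]
      rfl
    rw [h1]
    constructor
    · rintro ⟨h2, h3, h4, h5, h6, h7, h8, h9, h10, h11⟩
      refine ⟨h6, ?_, ?_, ?_, by omega, by omega⟩
      · rintro (_ | i) hi
        · exact h2
        · exact h2.trans (h7 i (by omega))
      · rintro (_ | i) (_ | j) hij hj
        · omega
        · exact h7 j (by omega)
        · omega
        · exact h8 i j (by omega) (by omega)
      · rintro (_ | i) hi
        · exact h3
        · exact h9 i (by omega)
    · rintro ⟨h6, h2, h7, h8, rfl, rfl⟩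
      refine ⟨h2 0 (by omega), h8 0 (by omega), by omega, by omega, h6,
        fun i hi => h7 0 (i + 1) (by omega) (by omega),
        fun i j hij hj => h7 (i + 1) (j + 1) (by omega) (by omega),
        fun i hi => h8 (i + 1) (by omega), by omega, by omega⟩

theorem ex_fst_add_snd {c : ℕ} (h : c % 32 ≤ c / 32) : (ex c).1 + (ex c).2 = c / 32 := by
  simp only [ex]
  omega

/-- The starting bound 95 = 3 * 32 - 1 expresses that all degrees are at least 3. -/
theorem good_iff (m h y : ℕ) : good m y 95 h 20 = true ↔ Good m h y := by
  rw [good_iff', Good, N, Set.mem_ofPred_eq]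
  refine and_congr_right fun _ => ?_
  have e1 : ∀ F : ℕ → ℕ, ∑ i ∈ Finset.range m, F (dig y i) = ∑ i : Fin m, F (dig y i) :=
    fun F => Finset.sum_range fun i => F (dig y i)
  constructor
  · rintro ⟨h1, h2, h3, h4, h5⟩
    have h3' : ∀ i : Fin m, dig y i % 32 ≤ dig y i / 32 := fun i => h3 i i.2
    refine ⟨fun i j hij => h2 i j hij j.2, h3', fun i => ?_, ?_, trivial, ?_⟩
    · rw [ex_fst_add_snd (h3' i)]
      have := h1 i i.2
      omega
    · simp only [ex_fst_add_snd (h3' _)]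
      rw [← h5]
      exact (e1 fun c => c / 32 - 2).symm
    · rw [← h4]
      exact (e1 fun c => c % 32).symm
  · rintro ⟨h1, h2, h3, h4, -, h5⟩
    simp only [ex_fst_add_snd (h2 _)] at h3 h4
    refine ⟨fun i hi => ?_, fun i j hij hj => h1 (a := ⟨i, hij.trans hj⟩) (b := ⟨j, hj⟩) hij,
      fun i hi => h2 ⟨i, hi⟩, (e1 fun c => c % 32).trans h5, (e1 fun c => c / 32 - 2).trans h4⟩
    have := h3 ⟨i, hi⟩
    simp only at this
    omega

theorem Good.lt {m h y : ℕ} (hy : Good m h y) {i j : ℕ} (hij : i < j) (hj : j < m) :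
    dig y i < dig y j := ((good_iff' _ _ _ _ _).1 ((good_iff _ _ _).2 hy)).2.2.1 i j hij hj

theorem Good.ge {m h y : ℕ} (hy : Good m h y) {i : ℕ} (hi : i < m) : 95 < dig y i :=
  ((good_iff' _ _ _ _ _).1 ((good_iff _ _ _).2 hy)).2.1 i hi

theorem Good.le {m h y : ℕ} (hy : Good m h y) {i : ℕ} (hi : i < m) :
    dig y i % 32 ≤ dig y i / 32 :=
  ((good_iff' _ _ _ _ _).1 ((good_iff _ _ _).2 hy)).2.2.2.1 i hi

theorem Good.deg_le {m h y : ℕ} (hy : Good m h y) {i : ℕ} (hi : i < m) : dig y i / 32 ≤ 22 := by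
  have h1 := hy.2.2.2.degree_le ⟨i, hi⟩
  have h2 := ex_fst_add_snd (hy.le hi)
  simp only at h1
  omega

/-- A tuple with `j`-th degree `l j` for all `j`. -/
def HasDeg (m : ℕ) (l : ℕ → ℕ) (y : ℕ) : Prop := ∀ j < m, dig y j / 32 = l j

/-! ### Changing one code of a packed tuple. -/

section Update

variable {m h y i : ℕ}

theorem dsum_update {s : ℕ} {x : ℕ → ℕ} {b : ℕ} (hi : i < m) :
    dsum s m (Function.update x i b) + x i * 2 ^ (s * i) = dsum s m x + b * 2 ^ (s * i) := by
  have hi' := Finset.mem_range.2 hi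
  rw [dsum, dsum, ← Finset.add_sum_erase _ _ hi', ← Finset.add_sum_erase _ (fun i => x i * _) hi',
    Function.update_self, Finset.sum_congr rfl fun j hj => by
      rw [Function.update_of_ne (Finset.ne_of_mem_erase hj)]]
  omega

/-- Writing the change of a digit as an equation between sums avoids subtraction and covers raising
and lowering alike. -/
theorem dig_of_update {y' b : ℕ} (hy : y < 2 ^ (10 * m)) (hi : i < m) (hb : b < 2 ^ 10)
    (hy' : y' + dig y i * 2 ^ (10 * i) = y + b * 2 ^ (10 * i)) :
    y' < 2 ^ (10 * m) ∧ ∀ j < m, dig y' j = Function.update (dig y) i b j := by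
  have h1 := dsum_update (s := 10) (x := dig y) (b := b) hi
  rw [dsum_dig hy] at h1
  have h2 : y' = dsum 10 m (Function.update (dig y) i b) := by omega
  have h3 : ∀ j < m, Function.update (dig y) i b j < 2 ^ 10 := by
    intro j _
    by_cases hj : j = i
    · rw [hj, Function.update_self]
      exact hb
    · rw [Function.update_of_ne hj]
      exact dig_lt _ _
  rw [h2]
  exact ⟨dsum_lt h3, fun j hj => dig_dsum h3 hj⟩

theorem dig_add (hy : y < 2 ^ (10 * m)) (hi : i < m) (hb : dig y i + 1 < 2 ^ 10) :
    y + 2 ^ (10 * i) < 2 ^ (10 * m) ∧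
      ∀ j < m, dig (y + 2 ^ (10 * i)) j = Function.update (dig y) i (dig y i + 1) j :=
  dig_of_update hy hi hb (by ring)

theorem pow_le_of_dig_ne_zero (h0 : dig y i ≠ 0) : 2 ^ (10 * i) ≤ y := by
  by_contra hlt
  rw [dig, Nat.div_eq_of_lt (by omega)] at h0
  exact h0 rfl

theorem dig_sub (hy : y < 2 ^ (10 * m)) (hi : i < m) (h0 : dig y i ≠ 0) :
    y - 2 ^ (10 * i) < 2 ^ (10 * m) ∧
      ∀ j < m, dig (y - 2 ^ (10 * i)) j = Function.update (dig y) i (dig y i - 1) j := by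
  refine dig_of_update hy hi (by have := dig_lt y i; omega) ?_
  have := pow_le_of_dig_ne_zero h0
  obtain ⟨k, hk⟩ := Nat.exists_eq_succ_of_ne_zero h0
  rw [hk, Nat.succ_eq_add_one, Nat.add_sub_cancel, add_mul]
  omega

theorem Good.of_update {y' b h' : ℕ} (hy : Good m h y) (hi : i < m)
    (hy' : y' < 2 ^ (10 * m)) (hd : ∀ j < m, dig y' j = Function.update (dig y) i b j)
    (hb : b % 32 ≤ b / 32) (hdeg : b / 32 = dig y i / 32) (hh : h' + dig y i % 32 = h + b % 32)
    (hlo : ∀ j < i, dig y j < b) (hhi : ∀ j, i < j → j < m → b < dig y j) : Good m h' y' := by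
  have h1 : (fun j : Fin m => dig y' j) = Function.update (fun j : Fin m => dig y j) ⟨i, hi⟩ b := by
    funext j
    rw [hd j j.2]
    by_cases hj : j = ⟨i, hi⟩
    · rw [hj]
      simp
    · rw [Function.update_of_ne hj, Function.update_of_ne fun h => hj (Fin.ext h)]
  refine ⟨hy', ?_⟩
  rw [h1]
  refine ⟨fun j k hjk => ?_, fun j => ?_, ?_⟩
  · by_cases hj : j = ⟨i, hi⟩ <;> by_cases hk : k = ⟨i, hi⟩
    · exact absurd hjk (by rw [hj, hk]; exact lt_irrefl _)
    · rw [hj, Function.update_self, Function.update_of_ne hk]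
      exact hhi k (by rw [hj] at hjk; exact hjk) k.2
    · rw [hk, Function.update_self, Function.update_of_ne hj]
      exact hlo j (by rw [hk] at hjk; exact hjk)
    · rw [Function.update_of_ne hj, Function.update_of_ne hk]
      exact hy.2.1 hjk
  · by_cases hj : j = ⟨i, hi⟩
    · rw [hj, Function.update_self]
      exact hb
    · rw [Function.update_of_ne hj]
      exact hy.2.2.1 j
  · refine Wt.of_update (i := ⟨i, hi⟩) (b := ex (dig y i)) (h := h) ?_ ?_ ?_
    · convert hy.2.2.2 using 1
      funext j
      by_cases hj : j = ⟨i, hi⟩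
      · rw [hj, Function.update_self]
      · rw [Function.update_of_ne hj, Function.update_of_ne hj]
    · rw [Function.update_self, ex_fst_add_snd hb, ex_fst_add_snd (hy.le hi), hdeg]
    · rw [Function.update_self]
      simp only [ex]
      omega

theorem HasDeg.of_update {l : ℕ → ℕ} {y' b : ℕ} (hy : HasDeg m l y)
    (hd : ∀ j < m, dig y' j = Function.update (dig y) i b j) (hdeg : b / 32 = dig y i / 32) :
    HasDeg m l y' := by
  intro j hj
  rw [← hy j hj, hd j hj]
  by_cases h : j = i
  · rw [h, Function.update_self, hdeg]
  · rw [Function.update_of_ne h]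

/-- Raising the exponent of `p` at a position where the tuple remains increasing. -/
theorem Good.add (hy : Good m h y) (hi : i < m) (hk : dig y i % 32 < dig y i / 32)
    (hhi : i + 1 < m → dig y (i + 1) ≠ dig y i + 1) : Good m (h + 1) (y + 2 ^ (10 * i)) ∧
      (∀ j < m, dig (y + 2 ^ (10 * i)) j = Function.update (dig y) i (dig y i + 1) j) ∧
      ∀ l, HasDeg m l y → HasDeg m l (y + 2 ^ (10 * i)) := by
  have hd := hy.deg_le hi
  have h1 := dig_add hy.1 hi (by omega)
  have h2 : (dig y i + 1) / 32 = dig y i / 32 := by omega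
  refine ⟨hy.of_update hi h1.1 h1.2 (by omega) h2 (by omega)
    (fun j hj => (hy.lt hj hi).trans (Nat.lt_succ_self _)) fun j hij hj => ?_, h1.2,
    fun l hl => hl.of_update h1.2 h2⟩
  have h3 := hy.lt hij hj
  have h4 := hhi (by omega)
  rcases (show i + 1 ≤ j from hij).eq_or_lt with rfl | h5
  · omega
  · have := hy.lt h5 hj
    have := hy.lt (Nat.lt_add_one i) (show i + 1 < m by omega)
    omega

/-- Lowering the exponent of `p` at a position where the tuple remains increasing. -/
theorem Good.sub (hy : Good m (h + 1) y) (hi : i < m) (hk : dig y i % 32 ≠ 0)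
    (hlo : dig y i ≠ (if i = 0 then 0 else dig y (i - 1)) + 1) : Good m h (y - 2 ^ (10 * i)) ∧
      (∀ j < m, dig (y - 2 ^ (10 * i)) j = Function.update (dig y) i (dig y i - 1) j) ∧
      ∀ l, HasDeg m l y → HasDeg m l (y - 2 ^ (10 * i)) := by
  have hd := hy.le hi
  have h1 := dig_sub hy.1 hi (by omega)
  have h2 : (dig y i - 1) / 32 = dig y i / 32 := by omega
  refine ⟨hy.of_update hi h1.1 h1.2 (by omega) h2 (by omega)
    (fun j hj => ?_) fun j hij hj => lt_of_le_of_lt (Nat.sub_le _ _) (hy.lt hij hj), h1.2,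
    fun l hl => hl.of_update h1.2 h2⟩
  rw [if_neg (by omega)] at hlo
  have h3 := hy.lt hj hi
  have h4 := hy.lt (show i - 1 < i by omega) hi
  rcases (show j ≤ i - 1 by omega).eq_or_lt with rfl | h5
  · omega
  · have := hy.lt h5 (by omega)
    omega

/-- The raised code collides with the next one, so the tuple is no longer strictly increasing. -/
theorem not_good_add (hy : Good m h y) (hi : i + 1 < m) (hk : dig y i % 32 < dig y i / 32)
    (hc : dig y (i + 1) = dig y i + 1) (h' : ℕ) : ¬ Good m h' (y + 2 ^ (10 * i)) := by
  intro h1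
  have hd := hy.deg_le (show i < m by omega)
  have h2 := (dig_add hy.1 (show i < m by omega) (by omega)).2
  have h3 := h1.lt (Nat.lt_succ_self i) hi
  rw [h2 i (by omega), h2 (i + 1) hi, Function.update_self, Function.update_of_ne (by omega)] at h3
  omega

/-- The lowered code collides with the preceding one. At position 0 the fictitious predecessor 0 is
excluded because all codes exceed 95. -/
theorem not_good_sub (hy : Good m h y) (hi : i < m)
    (hc : dig y i = (if i = 0 then 0 else dig y (i - 1)) + 1) (h' : ℕ) :
    ¬ Good m h' (y - 2 ^ (10 * i)) := by
  intro h1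
  have h0 := hy.ge hi
  have hi0 : i ≠ 0 := by
    intro h
    rw [if_pos h] at hc
    omega
  rw [if_neg hi0] at hc
  have h2 := (dig_sub hy.1 hi (by omega)).2
  have h3 := h1.lt (show i - 1 < i by omega) hi
  rw [h2 i hi, h2 (i - 1) (by omega), Function.update_self, Function.update_of_ne (by omega)] at h3
  omega

end Update


/-! Reduction of a tuple by the raising and lowering relations. -/

/-- The equation given by the raising operator at the tuple `z`. -/
def rowE {A : Type*} [AddCommMonoid A] (ev : ℕ → A) (m z : ℕ) : A :=
  ∑ i ∈ Finset.range m, (dig z i % 32) • ev (z - 2 ^ (10 * i))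

/-- The equation given by the lowering operator at the tuple `z`. -/
def rowF {A : Type*} [AddCommMonoid A] (ev : ℕ → A) (m z : ℕ) : A :=
  ∑ i ∈ Finset.range m, (dig z i / 32 - dig z i % 32) • ev (z + 2 ^ (10 * i))

theorem land_1023 (r : ℕ) : Nat.land r 1023 = r % 2 ^ 10 := Nat.and_two_pow_sub_one_eq_mod r 10

theorem land_31 (r : ℕ) : Nat.land r 31 = r % 32 := Nat.and_two_pow_sub_one_eq_mod r 5

theorem shiftRight_5 (r : ℕ) : Nat.shiftRight r 5 = r / 32 := Nat.shiftRight_eq_div_pow r 5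

theorem shiftRight_10 (r : ℕ) : Nat.shiftRight r 10 = r / 2 ^ 10 := Nat.shiftRight_eq_div_pow r 10

theorem pow_mul_1024 (i : ℕ) : Nat.mul (2 ^ (10 * i)) 1024 = 2 ^ (10 * (i + 1)) := by
  rw [mul_add_one, pow_add]
  rfl

theorem div_pow_div (z i : ℕ) : z / 2 ^ (10 * i) / 2 ^ 10 = z / 2 ^ (10 * (i + 1)) := by
  rw [Nat.div_div_eq_div_mul, ← pow_add, mul_add_one]

theorem sumE_step (f : ℕ → ℕ) (z w0 n r w prev : ℕ) : sumE f z w0 (n + 1) r w prev =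
    sel (Nat.beq (Nat.land (Nat.land r 1023) 31) 0)
      (sumE f z w0 n (Nat.shiftRight r 10) (Nat.mul w 1024) (Nat.land r 1023))
    (sel (Nat.beq (Nat.land r 1023) (prev + 1))
      (sumE f z w0 n (Nat.shiftRight r 10) (Nat.mul w 1024) (Nat.land r 1023))
    (sel (Nat.beq w w0)
      (sumE f z w0 n (Nat.shiftRight r 10) (Nat.mul w 1024) (Nat.land r 1023))
    (Nat.land (Nat.land r 1023) 31 * f (z - w) +
      sumE f z w0 n (Nat.shiftRight r 10) (Nat.mul w 1024) (Nat.land r 1023)))) := by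
  simp only [sumE, force_eq]
  rfl

theorem sumF_step (f : ℕ → ℕ) (z w0 n r w : ℕ) : sumF f z w0 (n + 1) r w =
    sel (Nat.beq (Nat.shiftRight (Nat.land r 1023) 5 - Nat.land (Nat.land r 1023) 31) 0)
      (sumF f z w0 n (Nat.shiftRight r 10) (Nat.mul w 1024))
    (sel (Nat.beq (Nat.land (Nat.shiftRight r 10) 1023) (Nat.land r 1023 + 1))
      (sumF f z w0 n (Nat.shiftRight r 10) (Nat.mul w 1024))
    (sel (Nat.beq w w0)
      (sumF f z w0 n (Nat.shiftRight r 10) (Nat.mul w 1024))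
    ((Nat.shiftRight (Nat.land r 1023) 5 - Nat.land (Nat.land r 1023) 31) * f (z + w) +
      sumF f z w0 n (Nat.shiftRight r 10) (Nat.mul w 1024)))) := by
  simp only [sumF, force_eq]
  rfl

theorem sumE_succ (f : ℕ → ℕ) (z w0 n i prev : ℕ) :
    sumE f z w0 (n + 1) (z / 2 ^ (10 * i)) (2 ^ (10 * i)) prev =
      if Nat.beq (dig z i % 32) 0 = true then
        sumE f z w0 n (z / 2 ^ (10 * (i + 1))) (2 ^ (10 * (i + 1))) (dig z i)
      else if Nat.beq (dig z i) (prev + 1) = true then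
        sumE f z w0 n (z / 2 ^ (10 * (i + 1))) (2 ^ (10 * (i + 1))) (dig z i)
      else if Nat.beq (2 ^ (10 * i)) w0 = true then
        sumE f z w0 n (z / 2 ^ (10 * (i + 1))) (2 ^ (10 * (i + 1))) (dig z i)
      else dig z i % 32 * f (z - 2 ^ (10 * i)) +
        sumE f z w0 n (z / 2 ^ (10 * (i + 1))) (2 ^ (10 * (i + 1))) (dig z i) := by
  simp only [sumE_step, land_1023, land_31, shiftRight_10, sel_eq, pow_mul_1024, div_pow_div]
  rfl

theorem sumF_succ (f : ℕ → ℕ) (z w0 n i : ℕ) :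
    sumF f z w0 (n + 1) (z / 2 ^ (10 * i)) (2 ^ (10 * i)) =
      if Nat.beq (dig z i / 32 - dig z i % 32) 0 = true then
        sumF f z w0 n (z / 2 ^ (10 * (i + 1))) (2 ^ (10 * (i + 1)))
      else if Nat.beq (dig z (i + 1)) (dig z i + 1) = true then
        sumF f z w0 n (z / 2 ^ (10 * (i + 1))) (2 ^ (10 * (i + 1)))
      else if Nat.beq (2 ^ (10 * i)) w0 = true then
        sumF f z w0 n (z / 2 ^ (10 * (i + 1))) (2 ^ (10 * (i + 1)))
      else (dig z i / 32 - dig z i % 32) * f (z + 2 ^ (10 * i)) +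
        sumF f z w0 n (z / 2 ^ (10 * (i + 1))) (2 ^ (10 * (i + 1))) := by
  simp only [sumF_step, land_1023, land_31, shiftRight_10, shiftRight_5, sel_eq, pow_mul_1024,
    div_pow_div]
  rfl

section

variable {A : Type*} [AddCommGroup A] [Module (ZMod 8191) A] {e : Prop} {Z : ℕ} {u : ℕ → A}
  {nd b : ℕ} {ev : ℕ → A} {f : ℕ → ℕ} {m z w0 : ℕ}

theorem Rep.nsmul {X : ℕ} {v : A} (h : Rep e Z u nd b X v) {k : ℕ} (hk : k ≠ 0) :
    Rep e Z u nd (k * b) (k * X) (k • v) := by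
  have := h.mul hk
  rwa [Nat.cast_smul_eq_nsmul] at this

/-- Besides the position `w0`, the program only omits terms that are zero: those with coefficient 0
and those in which lowering produces a repeated code. Here n positions remain from i on; each
coefficient is below 32, whence the bound on the digits. -/
theorem sumE_rep_aux
    (hf : ∀ i < m, 2 ^ (10 * i) ≠ w0 → dig z i % 32 ≠ 0 →
      dig z i ≠ (if i = 0 then 0 else dig z (i - 1)) + 1 →
      Rep e Z u nd b (f (z - 2 ^ (10 * i))) (ev (z - 2 ^ (10 * i))))
    (h0 : ∀ i < m, dig z i = (if i = 0 then 0 else dig z (i - 1)) + 1 →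
      ev (z - 2 ^ (10 * i)) = 0) (n i : ℕ) (hi : i + n = m) :
    Rep e Z u nd (n * (32 * b)) (sumE f z w0 n (z / 2 ^ (10 * i)) (2 ^ (10 * i))
      (if i = 0 then 0 else dig z (i - 1))) (∑ j ∈ Finset.range n,
        if 2 ^ (10 * (i + j)) = w0 then 0 else
          (dig z (i + j) % 32) • ev (z - 2 ^ (10 * (i + j)))) := by
  induction n generalizing i with
  | zero => exact Rep.zero
  | succ n ih =>
    have h1 := ih (i + 1) (by omega)
    rw [if_neg (Nat.succ_ne_zero i), Nat.add_sub_cancel] at h1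
    rw [sumE_succ, Finset.sum_range_succ', add_zero]
    rw [Finset.sum_congr rfl fun j _ => by rw [show i + (j + 1) = i + 1 + j by omega]]
    have h2 := h1.mono (show n * (32 * b) ≤ (n + 1) * (32 * b) by gcongr; omega)
    simp only [Nat.beq_eq]
    by_cases hk : dig z i % 32 = 0
    · rw [if_pos hk, hk]
      simpa using h2
    rw [if_neg hk]
    by_cases hc : dig z i = (if i = 0 then 0 else dig z (i - 1)) + 1
    · rw [if_pos hc, h0 i (by omega) hc]
      simpa using h2
    rw [if_neg hc]
    by_cases hw : 2 ^ (10 * i) = w0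
    · rw [if_pos hw, if_pos hw, add_zero]
      exact h2
    rw [if_neg hw, if_neg hw]
    have h3 := ((hf i (by omega) hw hk hc).nsmul hk).mono
      (show dig z i % 32 * b ≤ 32 * b by gcongr; omega)
    have h4 := h3.add h1
    rw [add_comm (_ • _)] at h4
    refine h4.mono (le_of_eq ?_)
    ring

theorem sumE_rep
    (hf : ∀ i < m, 2 ^ (10 * i) ≠ w0 → dig z i % 32 ≠ 0 →
      dig z i ≠ (if i = 0 then 0 else dig z (i - 1)) + 1 →
      Rep e Z u nd b (f (z - 2 ^ (10 * i))) (ev (z - 2 ^ (10 * i))))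
    (h0 : ∀ i < m, dig z i = (if i = 0 then 0 else dig z (i - 1)) + 1 →
      ev (z - 2 ^ (10 * i)) = 0) :
    Rep e Z u nd (m * (32 * b)) (sumE f z w0 m z 1 0) (∑ j ∈ Finset.range m,
        if 2 ^ (10 * j) = w0 then 0 else (dig z j % 32) • ev (z - 2 ^ (10 * j))) := by
  have h := sumE_rep_aux hf h0 m 0 (by omega)
  simpa using h

theorem sumF_rep_aux
    (hf : ∀ i < m, 2 ^ (10 * i) ≠ w0 → dig z i / 32 - dig z i % 32 ≠ 0 →
      dig z (i + 1) ≠ dig z i + 1 →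
      Rep e Z u nd b (f (z + 2 ^ (10 * i))) (ev (z + 2 ^ (10 * i))))
    (h0 : ∀ i < m, dig z (i + 1) = dig z i + 1 → dig z i / 32 - dig z i % 32 ≠ 0 →
      ev (z + 2 ^ (10 * i)) = 0) (n i : ℕ) (hi : i + n = m) :
    Rep e Z u nd (n * (32 * b)) (sumF f z w0 n (z / 2 ^ (10 * i)) (2 ^ (10 * i)))
      (∑ j ∈ Finset.range n, if 2 ^ (10 * (i + j)) = w0 then 0 else
        (dig z (i + j) / 32 - dig z (i + j) % 32) • ev (z + 2 ^ (10 * (i + j)))) := by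
  induction n generalizing i with
  | zero => exact Rep.zero
  | succ n ih =>
    have h1 := ih (i + 1) (by omega)
    rw [sumF_succ, Finset.sum_range_succ', add_zero]
    rw [Finset.sum_congr rfl fun j _ => by rw [show i + (j + 1) = i + 1 + j by omega]]
    have h2 := h1.mono (show n * (32 * b) ≤ (n + 1) * (32 * b) by gcongr; omega)
    simp only [Nat.beq_eq]
    by_cases hk : dig z i / 32 - dig z i % 32 = 0
    · rw [if_pos hk, hk]
      simpa using h2
    rw [if_neg hk]
    by_cases hc : dig z (i + 1) = dig z i + 1
    · rw [if_pos hc, h0 i (by omega) hc hk]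
      simpa using h2
    rw [if_neg hc]
    by_cases hw : 2 ^ (10 * i) = w0
    · rw [if_pos hw, if_pos hw, add_zero]
      exact h2
    rw [if_neg hw, if_neg hw]
    have h3 := ((hf i (by omega) hw hk hc).nsmul hk).mono
      (show (dig z i / 32 - dig z i % 32) * b ≤ 32 * b by
        have := dig_lt z i
        gcongr
        omega)
    have h4 := h3.add h1
    rw [add_comm (_ • _)] at h4
    refine h4.mono (le_of_eq ?_)
    ring

theorem sumF_rep
    (hf : ∀ i < m, 2 ^ (10 * i) ≠ w0 → dig z i / 32 - dig z i % 32 ≠ 0 →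
      dig z (i + 1) ≠ dig z i + 1 →
      Rep e Z u nd b (f (z + 2 ^ (10 * i))) (ev (z + 2 ^ (10 * i))))
    (h0 : ∀ i < m, dig z (i + 1) = dig z i + 1 → dig z i / 32 - dig z i % 32 ≠ 0 →
      ev (z + 2 ^ (10 * i)) = 0) :
    Rep e Z u nd (m * (32 * b)) (sumF f z w0 m z 1) (∑ j ∈ Finset.range m,
        if 2 ^ (10 * j) = w0 then 0 else
          (dig z j / 32 - dig z j % 32) • ev (z + 2 ^ (10 * j))) := by
  have h := sumF_rep_aux hf h0 m 0 (by omega)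
  simpa using h

theorem dig_top {z m : ℕ} (hz : z < 2 ^ (10 * m)) : dig z m = 0 := by
  rw [dig, Nat.div_eq_of_lt hz, Nat.zero_mod]

theorem rowE_rep {h : ℕ} (hz : Good m (h + 1) z) (hev : ∀ y, ¬ Good m h y → ev y = 0)
    (hf : ∀ i < m, 2 ^ (10 * i) ≠ w0 → dig z i % 32 ≠ 0 → Good m h (z - 2 ^ (10 * i)) →
      (∀ j < m, dig (z - 2 ^ (10 * i)) j = Function.update (dig z) i (dig z i - 1) j) →
      (∀ l, HasDeg m l z → HasDeg m l (z - 2 ^ (10 * i))) →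
      Rep e Z u nd b (f (z - 2 ^ (10 * i))) (ev (z - 2 ^ (10 * i)))) :
    Rep e Z u nd (m * (32 * b)) (sumE f z w0 m z 1 0) (∑ j ∈ Finset.range m,
        if 2 ^ (10 * j) = w0 then 0 else (dig z j % 32) • ev (z - 2 ^ (10 * j))) := by
  refine sumE_rep (fun i hi hw hk hc => ?_) fun i hi hc => hev _ (not_good_sub hz hi hc h)
  obtain ⟨h1, h2, h3⟩ := hz.sub hi hk hc
  exact hf i hi hw hk h1 h2 h3

theorem rowF_rep {h : ℕ} (hz : Good m h z) (hev : ∀ y, ¬ Good m (h + 1) y → ev y = 0)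
    (hf : ∀ i < m, 2 ^ (10 * i) ≠ w0 → dig z i / 32 - dig z i % 32 ≠ 0 →
      Good m (h + 1) (z + 2 ^ (10 * i)) →
      (∀ j < m, dig (z + 2 ^ (10 * i)) j = Function.update (dig z) i (dig z i + 1) j) →
      (∀ l, HasDeg m l z → HasDeg m l (z + 2 ^ (10 * i))) →
      Rep e Z u nd b (f (z + 2 ^ (10 * i))) (ev (z + 2 ^ (10 * i)))) :
    Rep e Z u nd (m * (32 * b)) (sumF f z w0 m z 1) (∑ j ∈ Finset.range m,
        if 2 ^ (10 * j) = w0 then 0 else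
          (dig z j / 32 - dig z j % 32) • ev (z + 2 ^ (10 * j))) := by
  refine sumF_rep (fun i hi hw hk hc => ?_) fun i hi hc hk => hev _ ?_
  · obtain ⟨h1, h2, h3⟩ := hz.add hi (by omega) fun _ => hc
    exact hf i hi hw hk h1 h2 h3
  · rcases (show i + 1 ≤ m from hi).eq_or_lt with rfl | h1
    · rw [dig_top hz.1] at hc
      omega
    · exact not_good_add hz h1 (by omega) hc (h + 1)

theorem pow_10_inj {i j : ℕ} : 2 ^ (10 * i) = 2 ^ (10 * j) ↔ i = j := by
  rw [Nat.pow_right_injective le_rfl |>.eq_iff]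
  omega

theorem ninv_ne_zero {k : ℕ} (hk : (k : ZMod 8191) ≠ 0) : ninv k ≠ 0 := by
  intro h
  have := cast_ninv hk
  rw [h, Nat.cast_zero, eq_comm, neg_eq_zero, inv_eq_zero] at this
  exact hk this

/-- The relation is solved for w by division by k. Before reduction the digits are at most 8191 * 20
* 32 * 2^14 ≤ 2^37, and two folds return them to at most 2^14, so the bound is stable under
repetition. -/
theorem Rep.solve {M X k : ℕ} {v w : A} (hm : m ≤ 20)
    (hM : ∀ i < nd, M / 2 ^ (40 * i) % 2 ^ 40 = 8191) (hk0 : k ≠ 0) (hk : k < 8191)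
    (h : Rep False Z u nd (m * (32 * 2 ^ 14)) X v) (hv : v + k • w = 0) :
    Rep False Z u nd (2 ^ 14) (GKF.fold M (GKF.fold M (ninv k * X))) w := by
  have hk' : (k : ZMod 8191) ≠ 0 := by
    rw [Ne, ZMod.natCast_eq_zero_iff]
    exact Nat.not_dvd_of_pos_of_lt (Nat.pos_of_ne_zero hk0) hk
  have h1 := h.mul (ninv_ne_zero hk')
  have hw : (ninv k : ZMod 8191) • v = w := by
    rw [eq_neg_of_add_eq_zero_left hv, cast_ninv hk', ← Nat.cast_smul_eq_nsmul (ZMod 8191),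
      neg_smul,
      smul_neg, neg_neg, smul_smul, inv_mul_cancel₀ hk', one_smul]
  rw [hw] at h1
  have h2 : ninv k * (m * (32 * 2 ^ 14)) ≤ 2 ^ 37 :=
    (Nat.mul_le_mul (ninv_le k) (Nat.mul_le_mul_right _ hm)).trans (by norm_num)
  refine (((h1.mono h2).fold (by norm_num) hM).fold (by norm_num) hM).mono ?_
  norm_num

theorem redE_succ (m wQ lQ : ℕ) (fr : List ℕ) (off M n y : ℕ) :
    redE m wQ lQ fr off M (n + 1) y = fold M (fold M (ninv (lQ - n) *
      sumE (redE m wQ lQ fr off M n) (y + wQ) wQ m (y + wQ) 1 0)) := by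
  simp only [redE, force_eq]
  rfl

theorem redF_succ (m wP lP M : ℕ) (base : ℕ → ℕ) (n y : ℕ) :
    redF m wP lP M base (n + 1) y = fold M (fold M (ninv (lP - n) *
      sumF (redF m wP lP M base n) (y - wP) wP m (y - wP) 1)) := by
  simp only [redF, force_eq]
  rfl

theorem sum_ite_pow {m Q : ℕ} (hQ : Q < m) (t : ℕ → A) :
    (∑ j ∈ Finset.range m, if 2 ^ (10 * j) = 2 ^ (10 * Q) then 0 else t j) + t Q =
      ∑ j ∈ Finset.range m, t j := by
  rw [← Finset.sum_erase_add _ t (Finset.mem_range.2 hQ),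
    ← Finset.sum_erase_add _ _ (Finset.mem_range.2 hQ), if_pos rfl, add_zero]
  congr 1
  exact Finset.sum_congr rfl fun j hj =>
    if_neg fun h => Finset.ne_of_mem_erase hj (pow_10_inj.1 h)

variable {M P Q : ℕ} {l : ℕ → ℕ} {fr : List ℕ} {off : ℕ}

/-- Let z be y with the exponent of p at Q raised by one; it is increasing because all later codes
have larger degree. In the raising relation at z, the tuple y occurs with coefficient the new
exponent, and every other term keeps that exponent at Q, hence is one step closer to the maximum.
Position P stays at exponent 0, as it enters the relation with coefficient 0. -/
theorem redE_rep (hm : m ≤ 20) (hM : ∀ i < nd, M / 2 ^ (40 * i) % 2 ^ 40 = 8191)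
    (hev : ∀ y, ¬ Good m (10 + m) y → ev y = 0)
    (hE : ∀ z, Good m (11 + m) z → rowE ev m z = 0) (hQ : Q < m) (hP : P < m) (hPQ : P ≠ Q)
    (hlQ : ∀ j, Q < j → j < m → l Q < l j)
    (hbase : ∀ y, Good m (10 + m) y → HasDeg m l y → dig y P % 32 = 0 → dig y Q % 32 = l Q →
      Rep False Z u nd (2 ^ 14) (redE m (2 ^ (10 * Q)) (l Q) fr off M 0 y) (ev y))
    (n y : ℕ) (hy : Good m (10 + m) y) (hl : HasDeg m l y) (hyP : dig y P % 32 = 0)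
    (hn : dig y Q % 32 + n = l Q) :
    Rep False Z u nd (2 ^ 14) (redE m (2 ^ (10 * Q)) (l Q) fr off M n y) (ev y) := by
  induction n generalizing y with
  | zero => exact hbase y hy hl hyP hn
  | succ n ih =>
    have hlQ' := hl Q hQ
    have hle := hy.deg_le hQ
    obtain ⟨h1, h2, h3⟩ := hy.add hQ (by omega) fun h => by
      have h4 := hlQ (Q + 1) (by omega) h
      rw [← hl (Q + 1) h] at h4
      omega
    have hzP : dig (y + 2 ^ (10 * Q)) P % 32 = 0 := by
      rw [h2 P hP, Function.update_of_ne hPQ, hyP]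
    have hzQ : dig (y + 2 ^ (10 * Q)) Q = dig y Q + 1 := by rw [h2 Q hQ, Function.update_self]
    have h5 := rowE_rep (e := False) (Z := Z) (u := u) (nd := nd) (b := 2 ^ 14) (w0 := 2 ^ (10 * Q))
      (f := redE m (2 ^ (10 * Q)) (l Q) fr off M n) h1 hev fun i hi hw hk hg hd hl' => by
        have hiQ : i ≠ Q := fun h => hw (by rw [h])
        have hiP : i ≠ P := fun h => hk (by rw [h, hzP])
        refine ih _ hg (hl' l (h3 l hl)) ?_ ?_
        · rw [hd P hP, Function.update_of_ne hiP.symm, hzP]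
        · rw [hd Q hQ, Function.update_of_ne hiQ.symm, hzQ]
          omega
    have h6 := hE _ (by rwa [show 11 + m = 10 + m + 1 by omega])
    rw [rowE, ← sum_ite_pow hQ, Nat.add_sub_cancel, hzQ] at h6
    rw [redE_succ, show l Q - n = (dig y Q + 1) % 32 by omega]
    exact Rep.solve hm hM (by omega) (by omega) h5 h6

/-- The mirror image: the lowering relation is taken at y with one p less at P, which stays
increasing because all earlier codes have smaller degree. The other terms keep the smaller exponent
at P. -/
theorem redF_rep {base : ℕ → ℕ} (hm : m ≤ 20) (hM : ∀ i < nd, M / 2 ^ (40 * i) % 2 ^ 40 = 8191)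
    (hev : ∀ y, ¬ Good m (10 + m) y → ev y = 0)
    (hF : ∀ z, Good m (9 + m) z → rowF ev m z = 0) (hP : P < m)
    (hlP : ∀ j < P, l j < l P)
    (hbase : ∀ y, Good m (10 + m) y → HasDeg m l y → dig y P % 32 = 0 →
      Rep False Z u nd (2 ^ 14) (base y) (ev y))
    (n y : ℕ) (hy : Good m (10 + m) y) (hl : HasDeg m l y) (hn : dig y P % 32 = n) :
    Rep False Z u nd (2 ^ 14) (redF m (2 ^ (10 * P)) (l P) M base n y) (ev y) := by
  induction n generalizing y with
  | zero => exact hbase y hy hl hn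
  | succ n ih =>
    have hlP' := hl P hP
    have hle := hy.deg_le hP
    have hle' := hy.le hP
    rw [show 10 + m = 9 + m + 1 by omega] at hy
    obtain ⟨h1, h2, h3⟩ := hy.sub hP (by omega) (by
      split_ifs with h
      · have := hy.ge hP
        omega
      · have h4 := hlP (P - 1) (by omega)
        rw [← hl (P - 1) (by omega)] at h4
        omega)
    have hzP : dig (y - 2 ^ (10 * P)) P = dig y P - 1 := by rw [h2 P hP, Function.update_self]
    have h5 := rowF_rep (e := False) (Z := Z) (u := u) (nd := nd) (b := 2 ^ 14) (w0 := 2 ^ (10 * P))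
      (f := redF m (2 ^ (10 * P)) (l P) M base n) (ev := ev) h1
      (by rwa [show 9 + m + 1 = 10 + m by omega]) fun i hi hw hk hg hd hl' => by
        have hiP : i ≠ P := fun h => hw (by rw [h])
        rw [show 9 + m + 1 = 10 + m by omega] at hg
        refine ih _ hg (hl' l (h3 l hl)) ?_
        rw [hd P hP, Function.update_of_ne hiP.symm, hzP]
        omega
    have h6 := hF _ h1
    rw [rowF, ← sum_ite_pow hP, Nat.sub_add_cancel (pow_le_of_dig_ne_zero (by omega)), hzP] at h6
    rw [redF_succ, show l P - n = (dig y P - 1) / 32 - (dig y P - 1) % 32 by omega]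
    exact Rep.solve hm hM (by omega) (by omega) h5 h6

/-- Reduction of all tuples of given degrees to those with the smallest code at `P` and the largest
code at `Q`. -/
theorem red_rep {T : ℕ} (hm : m ≤ 20) (hM : ∀ i < nd, M / 2 ^ (40 * i) % 2 ^ 40 = 8191)
    (hev : ∀ y, ¬ Good m (10 + m) y → ev y = 0)
    (hE : ∀ z, Good m (11 + m) z → rowE ev m z = 0)
    (hF : ∀ z, Good m (9 + m) z → rowF ev m z = 0) (hQ : Q < m) (hP : P < m) (hPQ : P ≠ Q)
    (hlQ : ∀ j, Q < j → j < m → dig T Q / 32 < dig T j / 32)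
    (hlP : ∀ j < P, dig T j / 32 < dig T P / 32)
    (hbase : ∀ y, Good m (10 + m) y → HasDeg m (fun i => dig T i / 32) y → dig y P % 32 = 0 →
      dig y Q % 32 = dig T Q / 32 →
      Rep False Z u nd (2 ^ 14) (redE m (2 ^ (10 * Q)) (dig T Q / 32) fr off M 0 y) (ev y))
    (y : ℕ) (hy : Good m (10 + m) y) (hl : HasDeg m (fun i => dig T i / 32) y) :
    Rep False Z u nd (2 ^ 14) (red m T (2 ^ (10 * P)) (2 ^ (10 * Q)) fr off M y) (ev y) := by
  have h1 : red m T (2 ^ (10 * P)) (2 ^ (10 * Q)) fr off M y =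
      redF m (2 ^ (10 * P)) (dig T P / 32) M (fun y =>
        redE m (2 ^ (10 * Q)) (dig T Q / 32) fr off M (dig T Q / 32 - dig y Q % 32) y)
        (dig y P % 32) y := by
    simp only [red, force_eq, dg, land_31, shiftRight_5, land_1023]
    rfl
  rw [h1]
  refine redF_rep (l := fun i => dig T i / 32) hm hM hev hF hP hlP (fun y hy hl hyP => ?_) _ y hy hl
    rfl
  refine redE_rep (l := fun i => dig T i / 32) hm hM hev hE hQ hP hPQ hlQ hbase _ y hy hl hyP ?_
  have h2 := hy.le hQ
  have h3 : dig y Q / 32 = dig T Q / 32 := hl Q hQ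
  omega

end


/-! The coboundary in terms of sorted lists of codes. -/

/-- The number that packs a list of codes. -/
def keyL : List ℕ → ℕ
  | [] => 0
  | a :: L => a + 2 ^ 10 * keyL L

theorem keyL_append (L L' : List ℕ) : keyL (L ++ L') = keyL L + 2 ^ (10 * L.length) * keyL L' := by
  induction L with
  | nil => simp [keyL]
  | cons a L ih =>
    rw [List.cons_append, keyL, keyL, ih, List.length_cons, mul_add_one, pow_add]
    ring

section Spec

variable {A : Type*} [AddCommGroup A]

/-- The value `val (a :: L)` of an alternating map in terms of its values on sorted lists. -/
def insA (a : ℕ) : (List ℕ → A) → List ℕ → A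
  | val, [] => val [a]
  | val, b :: L => if a < b then val (a :: b :: L) else if a = b then 0 else
      -insA a (fun M => val (b :: M)) L

/-- The coefficient in the bracket of the monomials with codes `a` and `b`. -/
def coef (a b : ℕ) : ℤ := (a / 32 : ℕ) * (b % 32 : ℕ) - (b / 32 : ℕ) * (a % 32 : ℕ)

/-- The terms of the coboundary involving the bracket of `a` with an entry of the list. -/
def rowLA (a : ℕ) : (List ℕ → A) → List ℕ → A
  | _, [] => 0
  | val, b :: L => coef a b • insA (a + b - 65) val L + rowLA a (fun M => val (b :: M)) L

/-- The negative of the coboundary. -/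
def rowDA : (List ℕ → A) → List ℕ → A
  | _, [] => 0
  | val, a :: L => rowLA a val L - rowDA (fun M => val (a :: M)) L

variable {A' : Type*} [AddCommGroup A'] (φ : A →+ A')

theorem insA_map (a : ℕ) (val : List ℕ → A) (L : List ℕ) :
    φ (insA a val L) = insA a (fun M => φ (val M)) L := by
  induction L generalizing val with
  | nil => rfl
  | cons b L ih =>
    rw [insA, insA]
    split_ifs
    · rfl
    · exact map_zero φ
    · rw [map_neg, ih]

theorem rowLA_map (a : ℕ) (val : List ℕ → A) (L : List ℕ) :
    φ (rowLA a val L) = rowLA a (fun M => φ (val M)) L := by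
  induction L generalizing val with
  | nil => exact map_zero φ
  | cons b L ih => rw [rowLA, rowLA, map_add, map_zsmul, insA_map, ih]

theorem rowDA_map (val : List ℕ → A) (L : List ℕ) :
    φ (rowDA val L) = rowDA (fun M => φ (val M)) L := by
  induction L generalizing val with
  | nil => exact map_zero φ
  | cons b L ih => rw [rowDA, rowDA, map_sub, rowLA_map, ih]

theorem insA_congr {a : ℕ} {val val' : List ℕ → A} {L : List ℕ} (hL : L.Pairwise (· < ·))
    (h : ∀ M : List ℕ, M.Pairwise (· < ·) → M.Perm (a :: L) → val M = val' M) :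
    insA a val L = insA a val' L := by
  induction L generalizing val val' with
  | nil => exact h [a] (List.pairwise_singleton _ _) (List.Perm.refl _)
  | cons b L ih =>
    rw [List.pairwise_cons] at hL
    rw [insA, insA]
    split_ifs with h1 h2
    · refine h _ ?_ (List.Perm.refl _)
      simp only [List.pairwise_cons, List.mem_cons]
      exact ⟨fun x hx => hx.elim (fun h => h ▸ h1) fun h => h1.trans (hL.1 x h), hL⟩
    · rfl
    · rw [ih hL.2 fun M hM hp => h (b :: M) ?_ ((hp.cons b).trans (List.Perm.swap _ _ _))]
      rw [List.pairwise_cons]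
      refine ⟨fun x hx => ?_, hM⟩
      rcases List.mem_cons.1 (hp.subset hx) with rfl | h3
      · omega
      · exact hL.1 x h3

/-- Only increasing rearrangements are evaluated. An entry b passed over remains in front because a
> 95 makes the bracket code a + c - 65 larger than c, which is larger than b. -/
theorem rowLA_congr {a : ℕ} (ha : 95 < a) {val val' : List ℕ → A} {L : List ℕ}
    (hL : L.Pairwise (· < ·))
    (h : ∀ (b : ℕ) (R M : List ℕ), coef a b ≠ 0 → (b :: R).Perm L → M.Pairwise (· < ·) →
      M.Perm ((a + b - 65) :: R) → val M = val' M) :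
    rowLA a val L = rowLA a val' L := by
  induction L generalizing val val' with
  | nil => rfl
  | cons b L ih =>
    rw [List.pairwise_cons] at hL
    rw [rowLA, rowLA]
    congr 1
    · by_cases h0 : coef a b = 0
      · rw [h0, zero_smul, zero_smul]
      · rw [insA_congr hL.2 fun M hM hp => h b L M h0 (List.Perm.refl _) hM hp]
    · refine ih hL.2 fun c R M hc hp hM hp' => h c (b :: R) (b :: M) hc
        ((List.Perm.swap _ _ _).trans (hp.cons b)) ?_ ((hp'.cons b).trans (List.Perm.swap _ _ _))
      rw [List.pairwise_cons]
      refine ⟨fun x hx => ?_, hM⟩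
      have hc' := hL.1 c (hp.subset List.mem_cons_self)
      rcases List.mem_cons.1 (hp'.subset hx) with rfl | h3
      · omega
      · exact hL.1 x (hp.subset (List.mem_cons_of_mem _ h3))

theorem rowDA_congr {val val' : List ℕ → A} {L : List ℕ} (hL : L.Pairwise (· < ·))
    (hL' : ∀ a ∈ L, 95 < a)
    (h : ∀ (a b : ℕ) (R M : List ℕ), coef a b ≠ 0 → (a :: b :: R).Perm L → M.Pairwise (· < ·) →
      M.Perm ((a + b - 65) :: R) → val M = val' M) :
    rowDA val L = rowDA val' L := by
  induction L generalizing val val' with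
  | nil => rfl
  | cons b L ih =>
    rw [List.pairwise_cons] at hL
    rw [rowDA, rowDA]
    congr 1
    · exact rowLA_congr (hL' b List.mem_cons_self) hL.2 fun c R M hc hp hM hp' =>
        h b c R M hc (hp.cons b) hM hp'
    · refine ih hL.2 (fun a ha => hL' a (List.mem_cons_of_mem _ ha)) fun a c R M hc hp hM hp' =>
        h a c (b :: R) (b :: M) hc ?_ ?_ ((hp'.cons b).trans (List.Perm.swap _ _ _))
      · exact ((List.Perm.swap _ _ _).cons a |>.trans (List.Perm.swap _ _ _)).trans (hp.cons b)
      · rw [List.pairwise_cons]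
        refine ⟨fun x hx => ?_, hM⟩
        have ha := hL.1 a (hp.subset List.mem_cons_self)
        have hc' := hL' c (List.mem_cons_of_mem _
          (hp.subset (List.mem_cons_of_mem _ List.mem_cons_self)))
        rcases List.mem_cons.1 (hp'.subset hx) with rfl | h3
        · omega
        · exact hL.1 x (hp.subset (List.mem_cons_of_mem _ (List.mem_cons_of_mem _ h3)))

end Spec

/-! The kernel program for the coboundary. -/

theorem insK_succ (f : Bool → ℕ → ℕ) (a n acc w R : ℕ) (s : Bool) :
    insK f a (n + 1) acc w R s =
      sel (Nat.blt a (Nat.land R 1023)) (f s (acc + w * (a + 1024 * R)))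
        (sel (Nat.beq a (Nat.land R 1023)) 0
          (insK f a n (acc + Nat.land R 1023 * w) (Nat.mul w 1024) (Nat.shiftRight R 10)
            (sel s false true))) := by
  simp only [insK, force_eq]
  rfl

/-- The coefficient of a term of the coboundary modulo `8191`. -/
def coefK (s : Bool) (u v : ℕ) : ℕ :=
  sel s (sel (Nat.ble v u) (u - v) (8191 - (v - u))) (sel (Nat.ble v u) (8191 - (u - v)) (v - u))

theorem rowL_succ (f : ℕ → ℕ) (a n acc w R : ℕ) (s : Bool) : rowL f a (n + 1) acc w R s =
    sel (Nat.beq (Nat.shiftRight a 5 * Nat.land (Nat.land R 1023) 31)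
        (Nat.shiftRight (Nat.land R 1023) 5 * Nat.land a 31))
      (rowL f a n (acc + Nat.land R 1023 * w) (Nat.mul w 1024) (Nat.shiftRight R 10) s)
      (insK (fun s y => coefK s (Nat.shiftRight a 5 * Nat.land (Nat.land R 1023) 31)
          (Nat.shiftRight (Nat.land R 1023) 5 * Nat.land a 31) * f y)
        (a + Nat.land R 1023 - 65) n acc w (Nat.shiftRight R 10) s +
        rowL f a n (acc + Nat.land R 1023 * w) (Nat.mul w 1024) (Nat.shiftRight R 10) s) := by
  simp only [rowL, force_eq]
  rfl

theorem rowD_succ (f : ℕ → ℕ) (n acc w R : ℕ) (s : Bool) : rowD f (n + 1) acc w R s =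
    rowL f (Nat.land R 1023) n acc w (Nat.shiftRight R 10) s +
      rowD f n (acc + Nat.land R 1023 * w) (Nat.mul w 1024) (Nat.shiftRight R 10)
        (sel s false true) := by
  simp only [rowD, force_eq]
  rfl

/-- `v` or `-v`. -/
def sgn {A : Type*} [AddCommGroup A] (s : Bool) (v : A) : A := if s = true then v else -v

section

variable {A : Type*} [AddCommGroup A] [Module (ZMod 8191) A] {e : Prop} {Z : ℕ} {u : ℕ → A}
  {nd b : ℕ} {ev : ℕ → A}

theorem sgn_flip (s : Bool) (v : A) : sgn (sel s false true) v = -sgn s v := by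
  cases s <;> simp [sgn, sel]

theorem sgn_neg (s : Bool) (v : A) : sgn s (-v) = -sgn s v := by
  cases s <;> simp [sgn]

theorem sgn_add (s : Bool) (v w : A) : sgn s (v + w) = sgn s v + sgn s w := by
  cases s <;> simp [sgn, add_comm]

theorem land_keyL {a : ℕ} (ha : a < 2 ^ 10) (L : List ℕ) : Nat.land (keyL (a :: L)) 1023 = a := by
  rw [land_1023, keyL, Nat.add_mul_mod_self_left, Nat.mod_eq_of_lt ha]

theorem shiftRight_keyL {a : ℕ} (ha : a < 2 ^ 10) (L : List ℕ) :
    Nat.shiftRight (keyL (a :: L)) 10 = keyL L := by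
  rw [shiftRight_10, keyL, Nat.add_mul_div_left _ _ (by positivity), Nat.div_eq_of_lt ha, zero_add]

theorem keyL_concat (pre : List ℕ) (a : ℕ) :
    keyL pre + a * 2 ^ (10 * pre.length) = keyL (pre ++ [a]) := by
  rw [keyL_append, keyL, keyL, mul_zero, add_zero, mul_comm]

/-- The prefix already passed is held as a packed number together with the weight of the next
position; passing an entry flips the sign. -/
theorem insK_rep {F : Bool → ℕ → ℕ} {k : ℤ}
    (hF : ∀ s y, Rep e Z u nd b (F s y) (sgn s (k • ev y))) (a : ℕ) (L pre : List ℕ)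
    (hL : ∀ c ∈ L, c < 2 ^ 10) (s : Bool) :
    Rep e Z u nd b (insK F a L.length (keyL pre) (2 ^ (10 * pre.length)) (keyL L) s)
      (sgn s (k • insA a (fun M => ev (keyL (pre ++ M))) L)) := by
  induction L generalizing pre s with
  | nil =>
    have h := hF s (keyL (pre ++ [a]))
    rw [← keyL_concat] at h
    rw [insA, ← keyL_concat]
    exact h
  | cons c L ih =>
    have hc := hL c List.mem_cons_self
    rw [List.length_cons, insK_succ, land_keyL hc, shiftRight_keyL hc, pow_mul_1024, keyL_concat,
      sel_eq, sel_eq, insA]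
    simp only [Nat.blt_eq, Nat.beq_eq]
    split_ifs
    · have h := hF s (keyL (pre ++ a :: c :: L))
      rw [keyL_append pre, keyL] at h
      rw [keyL_append pre, keyL]
      exact h
    · rw [smul_zero, sgn]
      simp only [neg_zero, ite_self]
      exact Rep.zero
    · have h := ih (pre ++ [c]) (fun x hx => hL x (List.mem_cons_of_mem _ hx)) (sel s false true)
      rw [List.length_append, List.length_singleton] at h
      simp only [List.append_assoc, List.singleton_append] at h
      rw [sgn_flip, ← sgn_neg, ← smul_neg] at h
      exact h

/-- The signed coefficient is replaced by a natural number congruent to it modulo 8191. This number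
is nonzero as p ≠ q, so that the sentinel survives the multiplication. -/
theorem coefK_rep {s : Bool} {p q X : ℕ} {v : A} (hpq : p ≠ q) (hp : p < 8191) (hq : q < 8191)
    (h : Rep e Z u nd b X v) :
    Rep e Z u nd (8191 * b) (coefK s p q * X) (sgn s (((p : ℤ) - q) • v)) := by
  have h0 : coefK s p q ≠ 0 ∧ coefK s p q ≤ 8191 ∧
      ((coefK s p q : ℕ) : ZMod 8191) = if s = true then ((p : ZMod 8191) - q) else -(p - q) := by
    have h8 : ((8191 : ℕ) : ZMod 8191) = 0 := ZMod.natCast_self 8191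
    simp only [coefK, sel_eq, Nat.ble_eq]
    split_ifs with h1 h2 h2
    · refine ⟨by omega, by omega, ?_⟩
      rw [Nat.cast_sub h2]
    · refine ⟨by omega, by omega, ?_⟩
      rw [Nat.cast_sub (by omega), Nat.cast_sub (by omega), h8]
      ring
    · refine ⟨by omega, by omega, ?_⟩
      rw [Nat.cast_sub (by omega), Nat.cast_sub (by omega), h8]
      ring
    · refine ⟨by omega, by omega, ?_⟩
      rw [Nat.cast_sub (by omega)]
      ring
  have h1 := (h.mul h0.1).mono (Nat.mul_le_mul_right b h0.2.1)
  rw [h0.2.2] at h1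
  have h2 : ((p : ℤ) - q) • v = ((p : ZMod 8191) - q) • v := by
    rw [← Int.cast_smul_eq_zsmul (ZMod 8191)]
    push_cast
    rfl
  rw [sgn, h2, ← neg_smul]
  split_ifs at h1 ⊢ <;> exact h1

theorem rowL_rep {f : ℕ → ℕ} (hf : ∀ y, Rep e Z u nd b (f y) (ev y)) {a : ℕ} (ha : a < 2 ^ 10)
    (L pre : List ℕ) (hL : ∀ c ∈ L, c < 2 ^ 10) (s : Bool) :
    Rep e Z u nd (L.length * (8191 * b))
      (rowL f a L.length (keyL pre) (2 ^ (10 * pre.length)) (keyL L) s)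
      (sgn s (rowLA a (fun M => ev (keyL (pre ++ M))) L)) := by
  induction L generalizing pre with
  | nil =>
    rw [rowLA, sgn]
    simp only [neg_zero, ite_self]
    exact Rep.zero
  | cons c L ih =>
    have hc := hL c List.mem_cons_self
    have hL' : ∀ x ∈ L, x < 2 ^ 10 := fun x hx => hL x (List.mem_cons_of_mem _ hx)
    rw [List.length_cons, rowL_succ, land_keyL hc, shiftRight_keyL hc, pow_mul_1024, keyL_concat,
      sel_eq, rowLA, land_31, land_31, shiftRight_5, shiftRight_5]
    have h := ih (pre ++ [c]) hL'
    rw [List.length_append, List.length_singleton] at h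
    simp only [List.append_assoc, List.singleton_append] at h
    have hp : a / 32 * (c % 32) < 8191 :=
      (Nat.mul_le_mul (show a / 32 ≤ 31 by omega) (show c % 32 ≤ 31 by omega)).trans_lt
        (by norm_num)
    have hq : c / 32 * (a % 32) < 8191 :=
      (Nat.mul_le_mul (show c / 32 ≤ 31 by omega) (show a % 32 ≤ 31 by omega)).trans_lt
        (by norm_num)
    have hcoef : coef a c = ((a / 32 * (c % 32) : ℕ) : ℤ) - (c / 32 * (a % 32) : ℕ) := by
      rw [coef]
      push_cast
      rfl
    simp only [Nat.beq_eq]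
    split_ifs with h1
    · rw [hcoef, h1, sub_self, zero_smul, zero_add]
      refine h.mono ?_
      gcongr
      omega
    · have h2 := insK_rep (k := coef a c) (ev := ev)
        (F := fun s y => coefK s (a / 32 * (c % 32)) (c / 32 * (a % 32)) * f y)
        (fun s y => by rw [hcoef]; exact coefK_rep h1 hp hq (hf y)) (a + c - 65) L pre hL' s
      rw [sgn_add]
      refine (h2.add h).mono (le_of_eq ?_)
      ring

theorem rowD_rep {f : ℕ → ℕ} (hf : ∀ y, Rep e Z u nd b (f y) (ev y)) {n : ℕ}
    (L pre : List ℕ) (hn : L.length ≤ n) (hL : ∀ c ∈ L, c < 2 ^ 10) (s : Bool) :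
    Rep e Z u nd (L.length * (n * (8191 * b)))
      (rowD f L.length (keyL pre) (2 ^ (10 * pre.length)) (keyL L) s)
      (sgn s (rowDA (fun M => ev (keyL (pre ++ M))) L)) := by
  induction L generalizing pre s with
  | nil =>
    rw [rowDA, sgn]
    simp only [neg_zero, ite_self]
    exact Rep.zero
  | cons c L ih =>
    have hc := hL c List.mem_cons_self
    have hL' : ∀ x ∈ L, x < 2 ^ 10 := fun x hx => hL x (List.mem_cons_of_mem _ hx)
    rw [List.length_cons] at hn
    rw [List.length_cons, rowD_succ, land_keyL hc, shiftRight_keyL hc, pow_mul_1024, keyL_concat,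
      rowDA]
    have h := ih (pre ++ [c]) (by omega) hL' (sel s false true)
    rw [List.length_append, List.length_singleton] at h
    simp only [List.append_assoc, List.singleton_append] at h
    rw [sgn_flip, ← sgn_neg] at h
    have h2 := (rowL_rep hf hc L pre hL' s).mono
      (show L.length * (8191 * b) ≤ n * (8191 * b) by gcongr; omega)
    rw [sub_eq_add_neg, sgn_add]
    refine (h2.add h).mono (le_of_eq ?_)
    ring

end

/-- The list of codes packed in `x`. -/
def digL (n x : ℕ) : List ℕ := (List.range n).map (dig x)

theorem length_digL (n x : ℕ) : (digL n x).length = n := by simp [digL]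

theorem digL_succ (n x : ℕ) : digL (n + 1) x = dig x 0 :: digL n (x / 2 ^ 10) := by
  rw [digL, List.range_succ_eq_map, List.map_cons, List.map_map, digL]
  congr 1
  exact List.map_congr_left fun i _ => dig_succ x i

theorem keyL_digL {n x : ℕ} (hx : x < 2 ^ (10 * n)) : keyL (digL n x) = x := by
  induction n generalizing x with
  | zero =>
    have : x = 0 := by simpa using hx
    rw [this]
    rfl
  | succ n ih =>
    rw [digL_succ, keyL, ih, dig_zero, Nat.mod_add_div]
    rw [Nat.div_lt_iff_lt_mul (by positivity), ← pow_add]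
    exact hx

theorem mem_digL_lt {n x c : ℕ} (hc : c ∈ digL n x) : c < 2 ^ 10 := by
  obtain ⟨i, -, rfl⟩ := List.mem_map.1 hc
  exact dig_lt x i


/-! Correctness of the kernel program. -/

/-- The digits `k` in a given interval, passed to `body` one after the other. -/
def freeLoop (body : ℕ → List ℕ → List ℕ) (n : ℕ) : ℕ → List ℕ → List ℕ :=
  Nat.rec (motive := fun _ => ℕ → List ℕ → List ℕ) (fun _ acc => acc)
    (fun _ ih k acc => ih (k + 1) (body k acc)) n

theorem free_succ (wP wQ n T w prev h y : ℕ) (acc : List ℕ) :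
    free wP wQ (n + 1) T w prev h y acc =
      freeLoop (fun k acc => sel (Nat.ble k h) (sel (Nat.blt prev (Nat.land T 1023 + k))
        (free wP wQ n (Nat.shiftRight T 10) (Nat.mul w 1024) (Nat.land T 1023 + k) (h - k)
          (y + w * (Nat.land T 1023 + k)) acc) acc) acc)
        (sel (Nat.beq w wP) 0 (Nat.shiftRight (Nat.land T 1023) 5) -
          sel (Nat.beq w wQ) (Nat.shiftRight (Nat.land T 1023) 5) 0 + 1)
        (sel (Nat.beq w wQ) (Nat.shiftRight (Nat.land T 1023) 5) 0) acc := by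
  simp only [free, freeLoop, force_eq]
  rfl

theorem freeLoop_subset {body : ℕ → List ℕ → List ℕ} (hb : ∀ k acc, acc ⊆ body k acc) (n k : ℕ)
    (acc : List ℕ) : acc ⊆ freeLoop body n k acc := by
  induction n generalizing k acc with
  | zero => exact List.Subset.refl _
  | succ n ih => exact List.Subset.trans (hb k acc) (ih (k + 1) (body k acc))

theorem mem_freeLoop {body : ℕ → List ℕ → List ℕ} (hb : ∀ k acc, acc ⊆ body k acc) {x j : ℕ}
    (hx : ∀ acc, x ∈ body j acc) (n k : ℕ) (acc : List ℕ) (h1 : k ≤ j) (h2 : j < k + n) :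
    x ∈ freeLoop body n k acc := by
  induction n generalizing k acc with
  | zero => omega
  | succ n ih =>
    rcases h1.eq_or_lt with rfl | h3
    · exact freeLoop_subset hb n (k + 1) _ (hx acc)
    · exact ih (k + 1) (body k acc) h3 (by omega)

theorem free_subset (wP wQ n T w prev h y : ℕ) (acc : List ℕ) :
    acc ⊆ free wP wQ n T w prev h y acc := by
  induction n generalizing T w prev h y acc with
  | zero =>
    have : free wP wQ 0 T w prev h y acc = sel (Nat.beq h 0) (y :: acc) acc := rfl
    rw [this, sel_eq]
    split_ifs
    · exact List.subset_cons_self _ _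
    · exact List.Subset.refl _
  | succ n ih =>
    rw [free_succ]
    refine freeLoop_subset (fun k acc => ?_) _ _ _
    rw [sel_eq, sel_eq]
    split_ifs
    · exact ih ..
    · exact List.Subset.refl _
    · exact List.Subset.refl _

theorem mod_pow_add (x i : ℕ) :
    x % 2 ^ (10 * i) + 2 ^ (10 * i) * dig x i = x % 2 ^ (10 * (i + 1)) := by
  rw [dig, mul_add_one, pow_add, Nat.mod_mul]

theorem mem_free {m P Q T x : ℕ} (hT : ∀ i < m, dig T i = 32 * (dig x i / 32))
    (hle : ∀ i < m, dig x i % 32 ≤ dig x i / 32) (hx : x < 2 ^ (10 * m))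
    (hlt : ∀ i j, i < j → j < m → dig x i < dig x j) (h0 : 0 < dig x 0)
    (hP : dig x P % 32 = 0) (hQ : dig x Q % 32 = dig x Q / 32) (n i : ℕ) (hi : i + n = m)
    (acc : List ℕ) :
    x ∈ free (2 ^ (10 * P)) (2 ^ (10 * Q)) n (T / 2 ^ (10 * i)) (2 ^ (10 * i))
      (if i = 0 then 0 else dig x (i - 1)) (∑ j ∈ Finset.range n, dig x (i + j) % 32)
      (x % 2 ^ (10 * i)) acc := by
  induction n generalizing i acc with
  | zero =>
    rw [add_zero] at hi
    subst hi
    rw [Nat.mod_eq_of_lt hx]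
    exact List.mem_cons_self
  | succ n ih =>
    rw [free_succ, shiftRight_10, div_pow_div, pow_mul_1024, land_1023, shiftRight_5]
    have hTi : T / 2 ^ (10 * i) % 2 ^ 10 = 32 * (dig x i / 32) := hT i (by omega)
    have hlei := hle i (by omega)
    rw [hTi, Nat.mul_div_cancel_left _ (by norm_num)]
    refine mem_freeLoop (j := dig x i % 32) (fun k acc => ?_) (fun acc => ?_) _ _ _ ?_ ?_
    · rw [sel_eq, sel_eq]
      split_ifs <;> first | exact free_subset .. | exact List.Subset.refl _
    · rw [Nat.div_add_mod, sel_eq, sel_eq]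
      have h1 : ∑ j ∈ Finset.range (n + 1), dig x (i + j) % 32 =
          ∑ j ∈ Finset.range n, dig x (i + 1 + j) % 32 + dig x i % 32 := by
        rw [Finset.sum_range_succ', add_zero]
        congr 1
        exact Finset.sum_congr rfl fun j _ => by rw [show i + (j + 1) = i + 1 + j by omega]
      have h2 : (if i = 0 then 0 else dig x (i - 1)) < dig x i := by
        split_ifs with h
        · rw [h]
          exact h0
        · exact hlt _ _ (by omega) (by omega)
      rw [h1, if_pos (Nat.ble_eq.mpr (Nat.le_add_left _ _)), if_pos (Nat.blt_eq.mpr h2),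
        Nat.add_sub_cancel, mod_pow_add]
      have h3 := ih (i + 1) (by omega) acc
      rwa [if_neg (Nat.succ_ne_zero i), Nat.add_sub_cancel] at h3
    · rw [sel_eq]
      simp only [Nat.beq_eq, pow_10_inj]
      split_ifs with h
      · rw [h, hQ]
      · exact Nat.zero_le _
    · rw [sel_eq, sel_eq]
      simp only [Nat.beq_eq, pow_10_inj]
      split_ifs with h h' h'
      · rw [← h'] at hP
        omega
      · omega
      · rw [← h'] at hP
        omega
      · omega

theorem norm_eq (K : List ℕ → ℕ → ℕ) (l acc : List ℕ) (n : ℕ) :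
    norm K l acc n = K (l.reverse ++ acc) (n + l.length) := by
  induction l generalizing acc n with
  | nil => rfl
  | cons a l ih =>
    have h : norm K (a :: l) acc n = norm K l (a :: acc) (n + 1) := by
      simp only [norm, force_eq]
    rw [h, ih, List.reverse_cons, List.append_assoc, List.singleton_append, List.length_cons]
    congr 1
    omega

/-- The tuples of a type that span the invariant functionals, in the order used by `mkF`. -/
def freeList (m : ℕ) (t : ℕ × ℕ × ℕ) : List ℕ :=
  (free (2 ^ (10 * t.2.1)) (2 ^ (10 * t.2.2)) m t.1 1 0 (10 + m) 0 []).reverse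

theorem pow_1024 (i : ℕ) : Nat.pow 1024 i = 2 ^ (10 * i) := by
  rw [pow_mul]
  rfl

theorem mkF_cons (m TM M : ℕ) (K : (ℕ → ℕ) → ℕ → ℕ) (t : ℕ × ℕ × ℕ) (ts : List (ℕ × ℕ × ℕ))
    (f : ℕ → ℕ) (off : ℕ) : mkF m TM M K (t :: ts) f off =
      mkF m TM M K ts (fun y => sel (Nat.beq (Nat.land y TM) t.1)
        (red m t.1 (2 ^ (10 * t.2.1)) (2 ^ (10 * t.2.2)) (freeList m t) off M y) (f y))
        (off + (freeList m t).length) := by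
  have h : mkF m TM M K (t :: ts) f off =
      norm (fun fr off' => mkF m TM M K ts (fun y => sel (Nat.beq (Nat.land y TM) t.1)
        (red m t.1 (Nat.pow 1024 t.2.1) (Nat.pow 1024 t.2.2) fr off M y) (f y)) off')
        (free (Nat.pow 1024 t.2.1) (Nat.pow 1024 t.2.2) m t.1 1 0 (10 + m) 0 []) [] off := by
    simp only [mkF, force_eq]
    rfl
  rw [h, norm_eq, pow_1024, pow_1024, List.append_nil, freeList, List.length_reverse]

/-- The conditions on the positions used to reduce the tuples of a type. -/
def TypeOK (m : ℕ) (t : ℕ × ℕ × ℕ) : Prop :=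
  t.2.1 < m ∧ t.2.2 < m ∧ t.2.1 ≠ t.2.2 ∧
    (∀ j < m, t.2.2 < j → dig t.1 t.2.2 / 32 < dig t.1 j / 32) ∧
    ∀ j < t.2.1, dig t.1 j / 32 < dig t.1 t.2.1 / 32

instance (m : ℕ) (t : ℕ × ℕ × ℕ) : Decidable (TypeOK m t) := by
  unfold TypeOK
  infer_instance

theorem idx_eq (y : ℕ) (l : List ℕ) (n : ℕ) (hy : y ∈ l) :
    ∃ k, idx y l n = n + k ∧ k < l.length ∧ l.getD k 0 = y := by
  induction l generalizing n with
  | nil => cases hy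
  | cons a l ih =>
    have h : idx y (a :: l) n = sel (Nat.beq a y) n (idx y l (n + 1)) := by
      simp only [idx, force_eq]
    rw [h, sel_eq]
    by_cases hay : a = y
    · refine ⟨0, ?_, by simp, by simpa using hay⟩
      rw [if_pos (by rw [hay]; exact Nat.beq_refl y), add_zero]
    · obtain ⟨k, h1, h2, h3⟩ := ih (n + 1) ((List.mem_cons.1 hy).resolve_left fun h => hay h.symm)
      refine ⟨k + 1, ?_, by simpa using h2, by simpa using h3⟩
      rw [if_neg fun h => hay (Nat.eq_of_beq_eq_true h), h1]
      omega

section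

variable {A : Type*} [AddCommGroup A] [Module (ZMod 8191) A] {Z : ℕ} {ev : ℕ → A} {m : ℕ}

/-- The values of `ev` on a list, preceded by `0`. -/
def uL (ev : ℕ → A) (l : List ℕ) (i : ℕ) : A := if i = 0 then 0 else ev (l.getD (i - 1) 0)

/-- Column 0 stands for the zero vector, so the residue t stored there does not affect the value
represented. -/
theorem tag_rep {e : Prop} {u : ℕ → A} (hu : u 0 = 0) {nd j t : ℕ} (hj : j ≠ 0) (hjn : j < nd)
    (ht : t ≤ 8191) : Rep e Z u nd (2 ^ 14) (t + 2 ^ (40 * j)) (u j) := by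
  refine Or.inr ⟨fun i => (if i = 0 then t else 0) + if i = j then 1 else 0, fun i _ => ?_, ?_, ?_⟩
  · simp only
    split_ifs <;> omega
  · rw [← dsum_add, dsum, dsum]
    simp only [ite_mul, zero_mul, one_mul, Finset.sum_ite_eq', Finset.mem_range]
    rw [if_pos (by omega), if_pos hjn, mul_zero, pow_zero, mul_one]
  · rw [Finset.sum_eq_single j]
    · simp [hj]
    · intro i _ hi
      by_cases h0 : i = 0
      · rw [h0, hu, smul_zero]
      · simp [hi, h0]
    · exact fun h => absurd (Finset.mem_range.2 hjn) h

/-- The digit 992 = 31 * 32 of the mask keeps the degree bits of a code and deletes the exponent of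
p. -/
theorem land_type {m TM y T : ℕ} (hTM : ∀ i < m, TM / 2 ^ (10 * i) % 2 ^ 10 = 992)
    (hy : y < 2 ^ (10 * m)) (hT : y &&& TM = T) : ∀ i < m, dig T i = 32 * (dig y i / 32) := by
  have h1 : ∀ a < 1024, a &&& 992 = 32 * (a / 32) := by decide +kernel
  intro i hi
  rw [← dsum_dig hy, dsum_land (fun i _ => dig_lt y i) hTM] at hT
  have h2 : ∀ i, dig y i &&& 992 = 32 * (dig y i / 32) := fun i => h1 _ (dig_lt y i)
  simp only [h2] at hT
  rw [← hT]
  exact dig_dsum (fun i _ => by have := dig_lt y i; omega) hi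

/-- Each type overrides the evaluation on its own tuples by the reduction to its free tuples,
numbered from the columns already used; `pre` holds the free tuples of the types treated so far.
When the types are exhausted, the evaluation represents `ev` on all good tuples. -/
theorem mkF_le {TM M : ℕ} {fl : List ℕ} {t0 : ℕ} {K : (ℕ → ℕ) → ℕ → ℕ} {e : ℕ → Prop} (hm : m ≤ 20)
    (hTM : ∀ i < m, TM / 2 ^ (10 * i) % 2 ^ 10 = 992)
    (hM : fl.length ≤ 400 → ∀ i < fl.length + 1, M / 2 ^ (40 * i) % 2 ^ 40 = 8191)
    (hev : ∀ y, ¬ Good m (10 + m) y → ev y = 0)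
    (hE : ∀ z, Good m (11 + m) z → rowE ev m z = 0)
    (hF : ∀ z, Good m (9 + m) z → rowF ev m z = 0)
    (hK : ∀ f : ℕ → ℕ, (fl.length ≤ 400 → ∀ y, Good m (10 + m) y →
      Rep (e y) Z (uL ev fl) (fl.length + 1) (2 ^ 14) (f y) (ev y)) → t0 ≤ K f fl.length)
    (ts : List (ℕ × ℕ × ℕ)) (hts : ∀ t ∈ ts, TypeOK m t) (f : ℕ → ℕ) (pre : List ℕ)
    (hfl : fl = pre ++ ts.flatMap (freeList m))
    (hf : fl.length ≤ 400 → ∀ y, Good m (10 + m) y → (∀ t ∈ ts, y &&& TM ≠ t.1) →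
      Rep (e y) Z (uL ev fl) (fl.length + 1) (2 ^ 14) (f y) (ev y)) :
    t0 ≤ mkF m TM M K ts f pre.length := by
  induction ts generalizing f pre with
  | nil =>
    have h : pre = fl := by simpa using hfl.symm
    rw [h]
    exact hK f fun h400 y hy => hf h400 y hy (by simp)
  | cons t ts ih =>
    rw [mkF_cons, ← List.length_append]
    refine ih (fun t ht => hts t (List.mem_cons_of_mem _ ht)) _ _
      (by rw [hfl, List.flatMap_cons, List.append_assoc]) fun h400 y hy hty => ?_
    rw [sel_eq]
    split_ifs with h
    · replace h : y &&& TM = t.1 := Nat.eq_of_beq_eq_true h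
      obtain ⟨h1, h2, h3, h4, h5⟩ := hts t List.mem_cons_self
      have hdeg := land_type hTM hy.1 h
      refine (red_rep hm (hM h400) hev hE hF h2 h1 h3 (fun j hj hjm => h4 j hjm hj) h5
        (fun x hx hxl hxP hxQ => ?_) y hy (fun j hj => ?_)).mono_e False.elim
      · have hxt : ∀ i < m, dig t.1 i = 32 * (dig x i / 32) := fun i hi => by
          have e1 : dig x i / 32 = dig t.1 i / 32 := hxl i hi
          have e2 := hdeg i hi
          omega
        have hmem : x ∈ freeList m t := by
          rw [freeList, List.mem_reverse]
          have hQ : dig x t.2.2 % 32 = dig x t.2.2 / 32 := by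
            rw [hxQ]
            exact (hxl _ h2).symm
          have h6 := mem_free hxt (fun i hi => hx.le hi) hx.1 (fun i j => hx.lt)
            (by have := hx.ge (show 0 < m by omega); omega) hxP hQ m 0 (by omega) []
          have h7 : ∑ j ∈ Finset.range m, dig x (0 + j) % 32 = 10 + m := by
            have := ((good_iff' _ _ _ _ _).1 ((good_iff _ _ _).2 hx)).2.2.2.2.1
            simpa using this
          rw [h7] at h6
          simpa [Nat.mod_one] using h6
        obtain ⟨k, hk1, hk2, hk3⟩ := idx_eq x _ pre.length hmem
        have hlen : pre.length + k < fl.length := by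
          rw [hfl, List.length_append, List.flatMap_cons, List.length_append]
          omega
        -- The column of a free tuple is its position in the whole list plus 1, since column 0 is
        -- reserved.
        have h8 : redE m (2 ^ (10 * t.2.2)) (dig t.1 t.2.2 / 32) (freeList m t) pre.length M 0 x =
            x * x % 8191 + 2 ^ (40 * (pre.length + k + 1)) := by
          have : redE m (2 ^ (10 * t.2.2)) (dig t.1 t.2.2 / 32) (freeList m t) pre.length M 0 x =
            x * x % 8191 + 1 <<< (40 * (idx x (freeList m t) pre.length + 1)) := rfl
          rw [this, hk1, Nat.shiftLeft_eq, one_mul]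
        have h9 : uL ev fl (pre.length + k + 1) = ev x := by
          rw [uL, if_neg (Nat.succ_ne_zero _), Nat.add_sub_cancel, hfl,
            List.getD_append_right _ _ _ _ (by omega), Nat.add_sub_cancel_left, List.flatMap_cons,
            List.getD_append _ _ _ _ hk2, hk3]
        rw [h8, ← h9]
        exact tag_rep (by simp [uL]) (by omega) (by omega) (Nat.mod_lt _ (by norm_num)).le
      · have e2 := hdeg j hj
        simp only
        omega
    · refine hf h400 y hy fun t' ht' => ?_
      rcases List.mem_cons.1 ht' with rfl | ht'
      · exact fun h' => h (Nat.beq_eq.mpr h')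
      · exact hty t' ht'

/-- Failing tuples and values that reach the sentinel are dropped, so every row kept is a relation.
-/
theorem collect_le {Z t0 : ℕ} {chk : ℕ → Bool} {val : ℕ → ℕ} {K : List ℕ → ℕ} {R : ℕ → Prop}
    (xs acc : List ℕ) (hv : ∀ x ∈ xs, chk x = true → val x < Z → R (val x)) (ha : ∀ r ∈ acc, R r)
    (hK : ∀ acc : List ℕ, (∀ r ∈ acc, R r) → t0 ≤ K acc) : t0 ≤ collect Z chk val K xs acc := by
  induction xs generalizing acc with
  | nil => exact hK acc ha
  | cons x xs ih =>
    have h : collect Z chk val K (x :: xs) acc =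
        sel (chk x) (sel (Nat.blt (val x) Z) (collect Z chk val K xs (val x :: acc))
          (collect Z chk val K xs acc)) (collect Z chk val K xs acc) := by
      simp only [collect, force_eq]
    have hv' : ∀ x ∈ xs, chk x = true → val x < Z → R (val x) :=
      fun y hy => hv y (List.mem_cons_of_mem _ hy)
    rw [h, sel_eq, sel_eq]
    split_ifs with h1 h2
    · refine ih _ hv' fun r hr => ?_
      rcases List.mem_cons.1 hr with rfl | hr
      · exact hv x List.mem_cons_self h1 (Nat.blt_eq.mp h2)
      · exact ha r hr
    · exact ih _ hv' ha
    · exact ih _ hv' ha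

theorem Rep.rel {u : ℕ → A} {e : Prop} {nd b X : ℕ} (h : Rep e Z u nd b X 0) (hX : X < Z) :
    Rel u nd b X := by
  rcases h with ⟨-, h⟩ | ⟨x, h1, h2, h3⟩
  · omega
  · exact ⟨x, h1, h2, h3.symm⟩

end

/-- The types, and the rows from the coboundary, the raising and the lowering operator. -/
abbrev Block : Type := List (ℕ × ℕ × ℕ) × List ℕ × List ℕ × List ℕ

theorem later_eq (TM Z y : ℕ) (bs : List Block) : later TM Z y bs = Z ∨
    later TM Z y bs = 0 ∧ ∀ b ∈ bs, ∀ t ∈ b.1, y &&& TM ≠ t.1 := by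
  induction bs with
  | nil => exact Or.inr ⟨rfl, by simp⟩
  | cons b bs ih =>
    obtain ⟨ts, r⟩ := b
    have h0 : ∀ t ts, later TM Z y ((t :: ts, r) :: bs) =
        sel (Nat.beq (y &&& TM) t.1) Z (later TM Z y ((ts, r) :: bs)) := fun t ts => rfl
    induction ts with
    | nil =>
      have h1 : later TM Z y (([], r) :: bs) = later TM Z y bs := rfl
      rw [h1]
      refine ih.imp id (And.imp id fun h b hb => ?_)
      rcases List.mem_cons.1 hb with rfl | hb
      · simp
      · exact h b hb
    | cons t ts ih2 =>
      rw [h0, sel_eq]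
      split_ifs with h1
      · exact Or.inl rfl
      · refine ih2.imp id (And.imp id fun h b hb t' ht' => ?_)
        rcases List.mem_cons.1 hb with rfl | hb
        · rcases List.mem_cons.1 ht' with rfl | ht'
          · exact fun h' => h1 (Nat.beq_eq.mpr h')
          · exact h (ts, r) List.mem_cons_self t' ht'
        · exact h b (List.mem_cons_of_mem _ hb) t' ht'

/-- The tuples whose type occurs in a list of blocks. -/
def HasType (TM : ℕ) (bs : List Block) (y : ℕ) : Prop := ∃ b ∈ bs, ∃ t ∈ b.1, y &&& TM = t.1

/-- Invariant closed functions modulo `8191` on the tuples whose type occurs in `bs`. -/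
def W (m TM : ℕ) (bs : List Block) : Submodule (ZMod 8191) (ℕ → ZMod 8191) where
  carrier := {c | (∀ y, ¬ (Good m (10 + m) y ∧ HasType TM bs y) → c y = 0) ∧
    (∀ z, Good m (11 + m) z → rowE c m z = 0) ∧ (∀ z, Good m (9 + m) z → rowF c m z = 0) ∧
    ∀ x, Good (m + 1) (11 + m) x → rowDA (fun M => c (keyL M)) (digL (m + 1) x) = 0}
  zero_mem' := ⟨fun _ _ => rfl, fun z _ => by simp [rowE], fun z _ => by simp [rowF], fun x _ => by
    have := rowDA_map (0 : ZMod 8191 →+ ZMod 8191) (fun _ => 0) (digL (m + 1) x)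
    simpa using this.symm⟩
  add_mem' := by
    rintro c c' ⟨h1, h2, h3, h4⟩ ⟨h1', h2', h3', h4'⟩
    refine ⟨fun y hy => ?_, fun z hz => ?_, fun z hz => ?_, fun x hx => ?_⟩
    · rw [Pi.add_apply, h1 y hy, h1' y hy, add_zero]
    · have h := congrArg₂ (· + ·) (h2 z hz) (h2' z hz)
      simpa [rowE, mul_add, Finset.sum_add_distrib] using h
    · have h := congrArg₂ (· + ·) (h3 z hz) (h3' z hz)
      simpa [rowF, mul_add, Finset.sum_add_distrib] using h
    · have e1 := rowDA_map (AddMonoidHom.fst (ZMod 8191) (ZMod 8191))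
        (fun M => (c (keyL M), c' (keyL M))) (digL (m + 1) x)
      have e2 := rowDA_map (AddMonoidHom.snd (ZMod 8191) (ZMod 8191))
        (fun M => (c (keyL M), c' (keyL M))) (digL (m + 1) x)
      have e3 := rowDA_map (AddMonoidHom.fst (ZMod 8191) (ZMod 8191) +
        AddMonoidHom.snd (ZMod 8191) (ZMod 8191))
        (fun M => (c (keyL M), c' (keyL M))) (digL (m + 1) x)
      exact e3.symm.trans ((congrArg₂ (· + ·) (e1.trans (h4 x hx)) (e2.trans (h4' x hx))).trans
        (add_zero 0))
  smul_mem' := by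
    rintro a c ⟨h1, h2, h3, h4⟩
    refine ⟨fun y hy => ?_, fun z hz => ?_, fun z hz => ?_, fun x hx => ?_⟩
    · rw [Pi.smul_apply, h1 y hy, smul_zero]
    · have h := congrArg (a * ·) (h2 z hz)
      simpa [rowE, Finset.mul_sum, mul_left_comm] using h
    · have h := congrArg (a * ·) (h3 z hz)
      simpa [rowF, Finset.mul_sum, mul_left_comm] using h
    · have e := rowDA_map (AddMonoidHom.mulLeft a) (fun M => c (keyL M)) (digL (m + 1) x)
      rw [h4 x hx, map_zero] at e
      exact e.symm

theorem restrictW_injective (m TM : ℕ) (bs : List Block) :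
    Function.Injective ((LinearMap.funLeft (ZMod 8191) (ZMod 8191)
      (Subtype.val : Finset.range (2 ^ (10 * m)) → ℕ)) ∘ₗ (W m TM bs).subtype) := by
  rw [← LinearMap.ker_eq_bot, LinearMap.ker_eq_bot']
  rintro ⟨c, hc⟩ h
  apply Subtype.ext
  funext y
  by_cases hy : y < 2 ^ (10 * m)
  · exact congrFun h ⟨y, Finset.mem_range.2 hy⟩
  · exact hc.1 y fun h => hy h.1.1

instance finite_W (m TM : ℕ) (bs : List Block) : Module.Finite (ZMod 8191) (W m TM bs) :=
  Module.Finite.of_injective _ (restrictW_injective m TM bs)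

theorem finrank_W_le (m TM : ℕ) (bs : List Block) :
    Module.finrank (ZMod 8191) (W m TM bs) ≤ 2 ^ (10 * m) := by
  have h := LinearMap.finrank_le_finrank_of_injective (restrictW_injective m TM bs)
  rwa [Module.finrank_fintype_fun_eq_card, Fintype.card_coe, Finset.card_range] at h

/-- Evaluation at a tuple. -/
def evW (m TM : ℕ) (bs : List Block) (y : ℕ) : Module.Dual (ZMod 8191) (W m TM bs) :=
  LinearMap.proj y ∘ₗ (W m TM bs).subtype


theorem dimB_cons (m TM M N : ℕ) (b : Block) (bs : List Block) (d : ℕ) :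
    dimB m TM M N (b :: bs) d =
      mkF m TM M (fun f n => sel (Nat.ble n N)
        (collect (2 ^ (40 * (N + 1))) (fun x => good m x 95 (11 + m) 20)
          (fun x => sumE f x 0 m x 1 0) (fun r =>
          collect (2 ^ (40 * (N + 1))) (fun x => good m x 95 (9 + m) 20)
            (fun x => sumF f x 0 m x 1) (fun r =>
            collect (2 ^ (40 * (N + 1))) (fun x => good (m + 1) x 95 (11 + m) 20)
              (fun x => rowD (fun y => sel (good m y 95 (10 + m) 20) (f y) 0) (m + 1) 0 1 x true)
              (fun r => dimB m TM M N bs (elim M n r d)) b.2.1 r) b.2.2.2 r) b.2.2.1 [])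
        (1024 ^ m + d)) b.1 (fun y => later TM (2 ^ (40 * (N + 1))) y bs) 0 := by
  simp only [dimB, force_eq]
  rfl

section

variable {m TM : ℕ} {bs : List Block}

theorem evW_eq_zero {y : ℕ} (hy : ¬ (Good m (10 + m) y ∧ HasType TM bs y)) :
    evW m TM bs y = 0 := LinearMap.ext fun c => c.2.1 y hy

theorem rowE_evW {z : ℕ} (hz : Good m (11 + m) z) : rowE (evW m TM bs) m z = 0 := by
  refine LinearMap.ext fun c => ?_
  rw [LinearMap.zero_apply, ← c.2.2.1 z hz, rowE, LinearMap.sum_apply]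
  rfl

theorem rowF_evW {z : ℕ} (hz : Good m (9 + m) z) : rowF (evW m TM bs) m z = 0 := by
  refine LinearMap.ext fun c => ?_
  rw [LinearMap.zero_apply, ← c.2.2.2.1 z hz, rowF, LinearMap.sum_apply]
  rfl

theorem rowD_evW {x : ℕ} (hx : Good (m + 1) (11 + m) x) :
    rowDA (fun M => evW m TM bs (keyL M)) (digL (m + 1) x) = 0 := by
  refine LinearMap.ext fun c => ?_
  have h := rowDA_map (LinearMap.applyₗ c :
    Module.Dual (ZMod 8191) (W m TM bs) →ₗ[ZMod 8191] ZMod 8191).toAddMonoidHom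
    (fun M => evW m TM bs (keyL M)) (digL (m + 1) x)
  exact h.trans (c.2.2.2.2 x hx)

/-- The common zeros in one space of the functionals that determine the first block. -/
theorem finrank_W_cons_le {b : Block} (S : Submodule (ZMod 8191) (Module.Dual (ZMod 8191)
    (W m TM (b :: bs)))) (hS : ∀ y, Good m (10 + m) y → (∃ t ∈ b.1, y &&& TM = t.1) →
      evW m TM (b :: bs) y ∈ S) :
    Module.finrank (ZMod 8191) (W m TM (b :: bs)) ≤
      Module.finrank (ZMod 8191) (W m TM bs) + Module.finrank (ZMod 8191) S := by
  -- The functions annihilated by S vanish on the first block and hence lie in `W m TM bs`; their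
  -- codimension is the dimension of S.
  have h1 := Subspace.finrank_add_finrank_dualCoannihilator_eq S
  rw [← h1, add_comm]
  refine Nat.add_le_add_right ?_ _
  have h2 : ∀ c : S.dualCoannihilator, ((W m TM (b :: bs)).subtype ∘ₗ
      S.dualCoannihilator.subtype) c ∈ W m TM bs := by
    rintro ⟨⟨c, hc⟩, hcS⟩
    refine ⟨fun y hy => ?_, hc.2⟩
    by_cases h : Good m (10 + m) y ∧ HasType TM (b :: bs) y
    · obtain ⟨hg, b', hb', t, ht, hyt⟩ := h
      rcases List.mem_cons.1 hb' with rfl | hb'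
      · exact (Submodule.mem_dualCoannihilator _).1 hcS _ (hS y hg ⟨t, ht, hyt⟩)
      · exact absurd ⟨hg, b', hb', t, ht, hyt⟩ hy
    · exact hc.1 y h
  refine LinearMap.finrank_le_finrank_of_injective
    (f := LinearMap.codRestrict (W m TM bs) _ h2) fun c c' h => ?_
  exact Subtype.ext (Subtype.ext (congrArg (Subtype.val : W m TM bs → _) h))

/-- Block triangular elimination: the evaluations at the first block lie in the span of the columns,
whose dimension `elim` bounds, and the functions vanishing on this block are left to the remaining
blocks. A block with more than 400 free tuples only receives the trivial bound 1024 ^ m. -/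
theorem dimB_le {M : ℕ} (hm : m ≤ 20) (hTM : ∀ i < m, TM / 2 ^ (10 * i) % 2 ^ 10 = 992)
    (hM : ∀ i < 401, M / 2 ^ (40 * i) % 2 ^ 40 = 8191) (bs : List Block)
    (hbs : ∀ b ∈ bs, ∀ t ∈ b.1, TypeOK m t) (d : ℕ) :
    Module.finrank (ZMod 8191) (W m TM bs) + d ≤ dimB m TM M 400 bs d := by
  induction bs generalizing d with
  | nil =>
    have h : W m TM [] = ⊥ := by
      rw [eq_bot_iff]
      intro c hc
      rw [Submodule.mem_bot]
      funext y
      refine hc.1 y ?_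
      rintro ⟨-, b, hb, -⟩
      cases hb
    rw [h, finrank_bot, zero_add]
    exact le_rfl
  | cons b bs ih =>
    rw [dimB_cons]
    -- With `w0 = 0` no position is skipped, so the sums below are the full relations.
    have hne : ∀ i : ℕ, ¬ (2 ^ (10 * i) = 0) := fun i => by positivity
    set Z := 2 ^ (40 * (400 + 1)) with hZ
    set ev := evW m TM (b :: bs) with hev
    set fl := b.1.flatMap (freeList m) with hfl
    have hev0 : ∀ y, ¬ Good m (10 + m) y → ev y = 0 := fun y hy => evW_eq_zero fun h => hy h.1
    refine mkF_le (Z := Z) (ev := ev) (fl := fl) (pre := [])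
      (e := fun y => ¬ ∃ t ∈ b.1, y &&& TM = t.1) hm hTM
      (fun h i hi => hM i (by omega)) hev0 (fun z hz => rowE_evW hz) (fun z hz => rowF_evW hz)
      ?_ b.1
      (hbs b List.mem_cons_self) _ (by rw [List.nil_append]) ?_
    · intro f hf
      rw [sel_eq]
      split_ifs with h400
      · replace h400 := Nat.ble_eq.mp h400
        have hf' := hf h400
        replace hf := fun y hy => (hf' y hy).mono_e fun _ => trivial
        refine collect_le (R := Rel (uL ev fl) (fl.length + 1) (2 ^ 36)) _ _ (fun x _ hx hlt => ?_)
          (by simp) fun r hr => ?_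
        · refine Rep.rel (e := True) (Z := Z) ?_ hlt
          have hx' := (good_iff _ _ _).1 hx
          rw [← rowE_evW (bs := b :: bs) (TM := TM) hx', ← hev]
          rw [show 11 + m = 10 + m + 1 by omega] at hx'
          have h := rowE_rep (e := True) (Z := Z) (u := uL ev fl) (nd := fl.length + 1)
            (b := 2 ^ 14) (w0 := 0) (f := f) hx' hev0 fun i _ _ _ hg _ _ => hf _ hg
          simp only [hne, if_false] at h
          exact h.mono ((Nat.mul_le_mul_right _ hm).trans (by norm_num))
        refine collect_le (R := Rel (uL ev fl) (fl.length + 1) (2 ^ 36)) _ _ (fun x _ hx hlt => ?_)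
          hr fun r hr => ?_
        · refine Rep.rel (e := True) (Z := Z) ?_ hlt
          have hx' := (good_iff _ _ _).1 hx
          rw [← rowF_evW (bs := b :: bs) (TM := TM) hx', ← hev]
          have h := rowF_rep (e := True) (Z := Z) (u := uL ev fl) (nd := fl.length + 1)
            (b := 2 ^ 14) (w0 := 0) (f := f) (ev := ev) hx'
            (by rwa [show 9 + m + 1 = 10 + m by omega]) fun i _ _ _ hg _ _ => hf _ (by
              rwa [show 9 + m + 1 = 10 + m by omega] at hg)
          simp only [hne, if_false] at h
          exact h.mono ((Nat.mul_le_mul_right _ hm).trans (by norm_num))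
        refine collect_le (R := Rel (uL ev fl) (fl.length + 1) (2 ^ 36)) _ _ (fun x _ hx hlt => ?_)
          hr fun r hr => ?_
        · refine Rep.rel (e := True) (Z := Z) ?_ hlt
          have hx' := (good_iff _ _ _).1 hx
          rw [← rowD_evW (bs := b :: bs) (TM := TM) hx', ← hev]
          have h := rowD_rep (e := True) (Z := Z) (u := uL ev fl) (nd := fl.length + 1)
            (b := 2 ^ 14) (f := fun y => sel (good m y 95 (10 + m) 20) (f y) 0) (ev := ev)
            (fun y => ?_) (n := m + 1) (digL (m + 1) x) [] (length_digL _ _).le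
            (fun c hc => mem_digL_lt hc) true
          · rw [keyL_digL hx'.1, length_digL] at h
            -- The digits are at most 21 * 21 * 8191 * 2^14 < 2^36.
            refine h.mono ((Nat.mul_le_mul (Nat.succ_le_succ hm)
              (Nat.mul_le_mul_right _ (Nat.succ_le_succ hm))).trans (by norm_num))
          · rw [sel_eq]
            split_ifs with hg
            · exact hf y ((good_iff _ _ _).1 hg)
            · rw [hev0 y fun h => hg ((good_iff _ _ _).2 h)]
              exact Rep.zero
        have h1 := finrank_W_cons_le
          (Submodule.span (ZMod 8191) (uL ev fl '' Set.Iio (fl.length + 1)))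
          fun y hy ht => ?_
        · have h2 := elim_le (M := M) (u := uL ev fl) rfl fl.length (b := 2 ^ 36) (by omega)
            (fun i hi => hM i (by omega)) r hr d
          have h3 := ih (fun b' hb' => hbs b' (List.mem_cons_of_mem _ hb'))
            (elim M fl.length r d)
          omega
        · exact ((hf' y hy).mono_e fun h => h ht).mem_span
      · rw [show 1024 ^ m = 2 ^ (10 * m) from pow_1024 m]
        exact Nat.add_le_add_right (finrank_W_le m TM (b :: bs)) d
    · intro _ y hy hyb
      rcases later_eq TM Z y bs with h | ⟨h, h'⟩
      · exact Or.inl ⟨fun ⟨t, ht, hyt⟩ => hyb t ht hyt, h.ge⟩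
      · rw [h, hev, evW_eq_zero]
        · exact Rep.zero
        · rintro ⟨-, b', hb', t, ht, hyt⟩
          rcases List.mem_cons.1 hb' with rfl | hb'
          · exact hyb t ht hyt
          · exact h' b' hb' t ht hyt

/-- The mask that selects the degrees of the codes packed in a number. -/
def mask (m : ℕ) : ℕ := 992 * ((1024 ^ m - 1) / 1023)

theorem mask_digit : ∀ m < 21, ∀ i < m, mask m / 2 ^ (10 * i) % 2 ^ 10 = 992 := by decide +kernel

theorem finrank_W_le_kerDim (hm : m ≤ 20) (bs : List Block)
    (hbs : ∀ b ∈ bs, ∀ t ∈ b.1, TypeOK m t) :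
    Module.finrank (ZMod 8191) (W m (mask m) bs) ≤ kerDim m bs := by
  have h : kerDim m bs = dimB m (mask m)
      (8191 * ((1099511627776 ^ 401 - 1) / 1099511627775)) 400 bs 0 := by
    rw [kerDim, force_eq, force_eq]
    rfl
  have hM : ∀ i < 401, 8191 * ((1099511627776 ^ 401 - 1) / 1099511627775) / 2 ^ (40 * i) % 2 ^ 40 =
      8191 := by
    decide +kernel
  rw [h]
  exact dimB_le hm (mask_digit m (by omega)) hM bs hbs 0

end


/-! Values of cochains on lists of codes. -/

/-- The value on the monomials with codes in a list of length `m`. -/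
def evalL (m : ℕ) (σ : Fun Ham0 m) (L : List ℕ) : ℝ := σ fun i => mono (ex (L.getD i 0))

theorem evalL_cons {m : ℕ} (σ : Fun Ham0 (m + 1)) (a : ℕ) (L : List ℕ) :
    evalL (m + 1) σ (a :: L) = evalL m (ip (mono (ex a)) σ) L := by
  rw [evalL, evalL, ip_apply]
  congr 1
  funext i
  refine Fin.cases ?_ (fun i => ?_) i <;> simp

theorem ip_ip {m : ℕ} {σ : Fun Ham0 (m + 2)} (h : IsAlt σ) (X Y : Ham0) :
    ip X (ip Y σ) = -ip Y (ip X σ) := by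
  funext v
  simp only [ip_apply, Pi.neg_apply]
  exact h.map_cons_cons Y X v

/-- Moving a past a smaller entry b is a transposition of the first two arguments, which changes the
sign; equal entries give 0. -/
theorem evalL_insA {m : ℕ} {σ : Fun Ham0 (m + 1)} (h : IsAlt σ) (a : ℕ) (L : List ℕ)
    (hL : L.length = m) : evalL (m + 1) σ (a :: L) = insA a (evalL (m + 1) σ) L := by
  induction L generalizing m with
  | nil => rfl
  | cons b L ih =>
    obtain ⟨m, rfl⟩ : ∃ k, m = k + 1 := ⟨L.length, hL.symm⟩
    have hL' : L.length = m := by simpa using hL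
    rw [insA]
    split_ifs with h1 h2
    · rfl
    · subst h2
      have h3 := ip_ip h (mono (ex a)) (mono (ex a))
      have h4 := congrFun h3 fun i => mono (ex (L.getD i 0))
      rw [evalL_cons, evalL_cons]
      change ip _ (ip _ σ) _ = -ip _ (ip _ σ) _ at h4
      change ip _ (ip _ σ) _ = 0
      linarith
    · simp only [evalL_cons σ b]
      have h3 := ih (h.ip (mono (ex b))) hL'
      change _ = insA a (fun M => evalL (m + 1) (ip (mono (ex b)) σ) M) L at h3
      rw [← h3, evalL_cons, evalL_cons, evalL_cons, ip_ip h]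
      rfl

/-- Brackets add degrees and subtract 2, and add exponents of p and subtract 1; in codes this is a +
b - 65. The degree bound keeps the exponent within its five bits. If the coefficient is 0 the code
may be meaningless, but both sides vanish. -/
theorem lie_mono_code {a b : ℕ} (ha : a % 32 ≤ a / 32 ∧ 3 ≤ a / 32)
    (hb : b % 32 ≤ b / 32 ∧ 3 ≤ b / 32) (hab : a / 32 + b / 32 ≤ 24) :
    ⁅mono (ex a), mono (ex b)⁆ = (coef a b : ℝ) • mono (ex (a + b - 65)) := by
  have ha' := ex_fst_add_snd ha.1
  have hb' := ex_fst_add_snd hb.1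
  rw [lie_mono (by omega) (by omega)]
  have h1 : ((ex a).1 * (ex b).2 - (ex a).2 * (ex b).1 : ℝ) = coef a b := by
    simp only [ex, coef]
    rw [Nat.cast_sub ha.1, Nat.cast_sub hb.1, Int.cast_sub, Int.cast_mul, Int.cast_mul]
    simp only [Int.cast_natCast]
    ring
  rw [h1]
  by_cases h0 : coef a b = 0
  · rw [h0, Int.cast_zero, zero_smul, zero_smul]
  · congr 2
    have h2 : a % 32 + b % 32 ≠ 0 := by
      intro h
      refine h0 ?_
      rw [coef, show a % 32 = 0 by omega, show b % 32 = 0 by omega]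
      simp
    have h3 : ¬ (a % 32 = a / 32 ∧ b % 32 = b / 32) := by
      rintro ⟨h, h'⟩
      refine h0 ?_
      rw [coef, h, h']
      ring
    simp only [ex]
    ext <;> simp only <;> omega

/-- All entries are codes of monomials, and brackets of entries have small degree. -/
def Small (L : List ℕ) : Prop := (∀ a ∈ L, a % 32 ≤ a / 32 ∧ 3 ≤ a / 32) ∧
  L.Pairwise fun a b => a / 32 + b / 32 ≤ 24

theorem Small.tail {a : ℕ} {L : List ℕ} (h : Small (a :: L)) : Small L :=
  ⟨fun b hb => h.1 b (List.mem_cons_of_mem _ hb), (List.pairwise_cons.1 h.2).2⟩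

theorem IsAlt.ip_smul {m : ℕ} {σ : Fun Ham0 (m + 1)} (h : IsAlt σ) (c : ℝ) (X : Ham0) :
    GKF.ip (c • X) σ = c • GKF.ip X σ := by
  obtain ⟨φ, rfl⟩ := h
  funext v
  exact congrFun (congrArg DFunLike.coe (map_smul φ.curryLeft c X)) v

/-- By induction along the list, with `ip_lieDer` splitting off the bracket of a with the first
entry and `evalL_insA` sorting that bracket into the rest. -/
theorem evalL_lieDer {m : ℕ} {σ : Fun Ham0 m} (h : IsAlt σ) (a : ℕ) (L : List ℕ)
    (hL : L.length = m) (hs : Small (a :: L)) :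
    evalL m (lieDer (mono (ex a)) m σ) L = -rowLA a (evalL m σ) L := by
  induction L generalizing m with
  | nil =>
    subst hL
    have h1 : lieDer (mono (ex a)) ([] : List ℕ).length σ = 0 := lieDer_zero_apply _ _
    rw [h1, rowLA, neg_zero]
    rfl
  | cons b L ih =>
    obtain ⟨m, rfl⟩ : ∃ k, m = k + 1 := ⟨L.length, hL.symm⟩
    have hL' : L.length = m := by simpa using hL
    have hs' : Small (a :: L) := ⟨fun x hx => hs.1 x (by
      rcases List.mem_cons.1 hx with rfl | hx
      · exact List.mem_cons_self
      · exact List.mem_cons_of_mem _ (List.mem_cons_of_mem _ hx)),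
      hs.2.sublist ((List.sublist_cons_self b L).cons_cons a)⟩
    have h1 := ih (h.ip (mono (ex b))) hL' hs'
    have h2 := evalL_insA h (a + b - 65) L hL'
    rw [evalL_cons] at h2
    have h3 : evalL (m + 1) (lieDer (mono (ex a)) (m + 1) σ) (b :: L) =
        evalL m (lieDer (mono (ex a)) m (ip (mono (ex b)) σ)) L -
          coef a b * evalL m (ip (mono (ex (a + b - 65))) σ) L := by
      rw [evalL_cons, ip_lieDer, lie_mono_code (hs.1 a List.mem_cons_self)
        (hs.1 b (List.mem_cons_of_mem _ List.mem_cons_self))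
        ((List.pairwise_cons.1 hs.2).1 b List.mem_cons_self), h.ip_smul]
      rfl
    rw [h3, rowLA, h1, h2, zsmul_eq_mul]
    simp only [evalL_cons σ b]
    ring

/-- Contraction with the first entry and Cartan's formula reproduce the recursion of `rowDA`. -/
theorem evalL_d {m : ℕ} {σ : Fun Ham0 m} (h : IsAlt σ) (L : List ℕ) (hL : L.length = m + 1)
    (hs : Small L) : evalL (m + 1) (d m σ) L = -rowDA (evalL m σ) L := by
  induction m generalizing L with
  | zero =>
    obtain ⟨a, rfl⟩ := List.length_eq_one_iff.1 hL
    rw [d_zero_apply]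
    simp [rowDA, rowLA, evalL]
  | succ m ih =>
    obtain ⟨a, L, rfl⟩ := List.exists_cons_of_length_eq_add_one hL
    have hL' : L.length = m + 1 := by simpa using hL
    have h1 := ih (h.ip (mono (ex a))) L hL' hs.tail
    have h2 := evalL_lieDer h a L hL' hs
    rw [evalL_cons, h.ip_d, rowDA, neg_sub]
    simp only [evalL_cons σ a]
    have h3 : evalL (m + 1) (lieDer (mono (ex a)) (m + 1) σ - d m (ip (mono (ex a)) σ)) L =
        evalL (m + 1) (lieDer (mono (ex a)) (m + 1) σ) L -
          evalL (m + 1) (d m (ip (mono (ex a)) σ)) L := rfl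
    rw [h3, h1, h2]
    ring

theorem getD_digL {n x i : ℕ} (hi : i < n) : (digL n x).getD i 0 = dig x i := by
  simp [digL, hi]

theorem evalL_digL {m : ℕ} (σ : Fun Ham0 m) (x : ℕ) :
    evalL m σ (digL m x) = σ fun i : Fin m => mono (ex (dig x i)) := by
  rw [evalL]
  congr 1
  funext i
  rw [getD_digL i.2]

/-! The type of a tuple. -/

/-- The condition on the degrees of a tuple that its type occurs in a list of blocks. -/
def TypeP (bs : List Block) (s : Multiset ℕ) : Prop :=
  ∃ b ∈ bs, ∃ t ∈ b.1, keyL ((s.sort (· ≤ ·)).map (32 * ·)) = t.1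

theorem keyL_map_range (n : ℕ) (x : ℕ → ℕ) : keyL ((List.range n).map x) = dsum 10 n x := by
  induction n generalizing x with
  | zero => rfl
  | succ n ih => rw [List.range_succ_eq_map, List.map_cons, List.map_map, keyL, ih, dsum_succ']; rfl

/-- The codes of a good tuple increase, so their degrees are already sorted and the masked number
packs the sorted multiset of degrees. -/
theorem land_mask {m h y : ℕ} (hm : m ≤ 20) (hy : Good m h y) : y &&& mask m =
    keyL (((Finset.univ.val.map fun i : Fin m => (ex (dig y i)).1 + (ex (dig y i)).2).sort
      (· ≤ ·)).map (32 * ·)) := by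
  have h1 : (Finset.univ.val.map fun i : Fin m => (ex (dig y i)).1 + (ex (dig y i)).2) =
      ((List.range m).map fun i => dig y i / 32 : List ℕ) := by
    simp only [fun i : Fin m => ex_fst_add_snd (hy.le i.2)]
    rw [Fin.univ_val_map]
    congr 1
    refine List.ext_getElem (by simp) fun i hi hi' => by simp
  have h2 : ((List.range m).map fun i => dig y i / 32).Pairwise (· ≤ ·) := by
    rw [List.pairwise_map]
    refine List.pairwise_lt_range.imp_of_mem fun {i j} hi hj hij => ?_
    exact Nat.div_le_div_right (hy.lt hij (List.mem_range.1 hj)).le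
  rw [h1, Multiset.coe_sort, List.mergeSort_eq_self (· ≤ ·) h2, List.map_map, keyL_map_range]
  have h3 := land_type (mask_digit m (by omega)) hy.1 rfl
  conv_lhs => rw [← dsum_dig (m := m) (y := y &&& mask m) (Nat.and_le_left.trans_lt hy.1)]
  exact dsum_congr h3

theorem hasType_iff {m h y : ℕ} (hm : m ≤ 20) (hy : Good m h y) (bs : List Block) :
    HasType (mask m) bs y ↔
      TypeP bs (Finset.univ.val.map fun i : Fin m => (ex (dig y i)).1 + (ex (dig y i)).2) := by
  rw [HasType, TypeP, land_mask hm hy]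

theorem mem_N_iff {m h y : ℕ} (hm : m ≤ 20) (hy : Good m h y) (bs : List Block) :
    (fun i : Fin m => dig y i) ∈ N m (TypeP bs) h ↔ HasType (mask m) bs y := by
  rw [hasType_iff hm hy]
  exact ⟨fun h => h.2.2.2.2.1, fun h => ⟨hy.2.1, hy.2.2.1, hy.2.2.2.1, hy.2.2.2.2.1, h,
    hy.2.2.2.2.2.2⟩⟩

theorem exists_good {m h : ℕ} {P : Multiset ℕ → Prop} {f : Fin m → ℕ} (hf : f ∈ N m P h) :
    ∃ y, Good m h y ∧ ∀ i : Fin m, dig y i = f i := by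
  have h1 : ∀ i < m, (if h : i < m then f ⟨i, h⟩ else 0) < 2 ^ 10 := fun i hi => by
    rw [dif_pos hi]
    exact (ex_lt hf _).trans (by norm_num)
  have h2 : ∀ i : Fin m, dig (dsum 10 m fun i => if h : i < m then f ⟨i, h⟩ else 0) i = f i :=
    fun i => (dig_dsum h1 i.2).trans (dif_pos i.2)
  refine ⟨_, ⟨dsum_lt h1, ?_⟩, h2⟩
  simp only [h2]
  exact ⟨hf.1, hf.2.1, hf.2.2.1, hf.2.2.2.1, trivial, hf.2.2.2.2.2⟩

/-! From real cochains to functions modulo `8191`. -/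

/-- The row that evaluates at `y`. -/
def sg (y : ℕ) : ℕ →₀ ℤ := Finsupp.single y 1

/-- The equations for closed invariant cochains. -/
def rows (m : ℕ) : Set (ℕ →₀ ℤ) :=
  {r | (∃ z, Good m (11 + m) z ∧ r = rowE sg m z) ∨ (∃ z, Good m (9 + m) z ∧ r = rowF sg m z) ∨
    ∃ x, Good (m + 1) (11 + m) x ∧ r = rowDA (fun M => sg (keyL M)) (digL (m + 1) x)}

/-- Evaluation of a row at a function. -/
def evalRow {K : Type} [Field K] (c : ℕ → K) : (ℕ →₀ ℤ) →+ K :=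
  Finsupp.liftAddHom fun y => (AddMonoidHom.mulRight (c y)).comp (Int.castAddHom K)

theorem evalRow_apply {K : Type} [Field K] (c : ℕ → K) (r : ℕ →₀ ℤ) :
    evalRow c r = r.sum fun y a => (a : K) * c y := rfl

theorem evalRow_sg {K : Type} [Field K] (c : ℕ → K) (y : ℕ) : evalRow c (sg y) = c y := by
  rw [evalRow_apply, sg, Finsupp.sum_single_index (by simp), Int.cast_one, one_mul]

theorem evalRow_rowE {K : Type} [Field K] (c : ℕ → K) (m z : ℕ) :
    evalRow c (rowE sg m z) = rowE c m z := by
  simp only [rowE, map_sum, map_nsmul, evalRow_sg]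

theorem evalRow_rowF {K : Type} [Field K] (c : ℕ → K) (m z : ℕ) :
    evalRow c (rowF sg m z) = rowF c m z := by
  simp only [rowF, map_sum, map_nsmul, evalRow_sg]

theorem evalRow_rowDA {K : Type} [Field K] (c : ℕ → K) (L : List ℕ) :
    evalRow c (rowDA (fun M => sg (keyL M)) L) = rowDA (fun M => c (keyL M)) L := by
  rw [rowDA_map]
  simp only [evalRow_sg]

open scoped Classical in
/-- The tuples whose type occurs in `bs`. -/
def tuples (m : ℕ) (bs : List Block) : Finset ℕ :=
  (Finset.range (2 ^ (10 * m))).filter fun y => Good m (10 + m) y ∧ HasType (mask m) bs y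

open scoped Classical in
theorem mem_tuples {m : ℕ} {bs : List Block} {y : ℕ} :
    y ∈ tuples m bs ↔ Good m (10 + m) y ∧ HasType (mask m) bs y := by
  rw [tuples, Finset.mem_filter, Finset.mem_range]
  exact ⟨fun h => h.2, fun h => ⟨h.1.1, h⟩⟩

theorem Sol_le_W (m : ℕ) (bs : List Block) :
    Sol (ZMod 8191) (tuples m bs) (rows m) ≤ W m (mask m) bs := by
  intro c hc
  refine ⟨fun y hy => hc.1 y fun h => hy (mem_tuples.1 h), fun z hz => ?_, fun z hz => ?_,
    fun x hx => ?_⟩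
  · rw [← evalRow_rowE]
    exact hc.2 _ (Or.inl ⟨z, hz, rfl⟩)
  · rw [← evalRow_rowF]
    exact hc.2 _ (Or.inr (Or.inl ⟨z, hz, rfl⟩))
  · rw [← evalRow_rowDA]
    exact hc.2 _ (Or.inr (Or.inr ⟨x, hx, rfl⟩))

open scoped Classical in
/-- The values of a cochain on the packed tuples. -/
def pack (m : ℕ) (bs : List Block) (σ : Fun Ham0 m) (y : ℕ) : ℝ :=
  if y ∈ tuples m bs then σ fun i : Fin m => mono (ex (dig y i)) else 0

section

variable {m : ℕ} {bs : List Block} {σ : Fun Ham0 m}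

/-- If the type of y does not occur in `bs`, the left side is 0 by definition and the right side by
the support condition on σ. -/
theorem pack_good (hm : m ≤ 20) (hσ : σ ∈ V m (TypeP bs) (10 + m)) {y : ℕ}
    (hy : Good m (10 + m) y) : pack m bs σ y = σ fun i : Fin m => mono (ex (dig y i)) := by
  rw [pack]
  split_ifs with h
  · rfl
  · refine (hσ.2 _ (fun i => ?_) fun hw => h (mem_tuples.2 ⟨hy, ?_⟩)).symm
    · have := hy.2.2.2.1 i
      simp only at this
      omega
    · exact (mem_N_iff hm hy bs).1 ⟨hy.2.1, hy.2.2.1, hw⟩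

theorem pack_not_good {y : ℕ} (hy : ¬ Good m (10 + m) y) : pack m bs σ y = 0 :=
  if_neg fun h => hy (mem_tuples.1 h).1

/-- If lowering creates a repetition, the packed function is 0 at this number because it packs no
good tuple, and the cochain is 0 by alternation. -/
theorem pack_sub (hm : m ≤ 20) (hσ : σ ∈ V m (TypeP bs) (10 + m)) {z i : ℕ}
    (hz : Good m (11 + m) z) (hi : i < m) (hk : dig z i % 32 ≠ 0) :
    pack m bs σ (z - 2 ^ (10 * i)) =
      σ fun j : Fin m => mono (ex (Function.update (dig z) i (dig z i - 1) j)) := by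
  rw [show 11 + m = 10 + m + 1 by omega] at hz
  by_cases hc : dig z i = (if i = 0 then 0 else dig z (i - 1)) + 1
  · rw [pack_not_good (not_good_sub hz hi hc _)]
    obtain ⟨φ, rfl⟩ := hσ.1
    have h0 : i ≠ 0 := by
      intro h
      have := hz.ge hi
      rw [if_pos h] at hc
      omega
    rw [if_neg h0] at hc
    refine (φ.map_eq_zero_of_eq _ (i := ⟨i - 1, by omega⟩) (j := ⟨i, hi⟩) ?_ ?_).symm
    · simp only [Function.update_self]
      rw [Function.update_of_ne (by omega), hc, Nat.add_sub_cancel]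
    · intro h
      have := congrArg Fin.val h
      simp only at this
      omega
  · obtain ⟨h1, h2, -⟩ := hz.sub hi hk hc
    rw [pack_good hm hσ h1]
    congr 1
    funext j
    rw [h2 j j.2]

theorem pack_add (hm : m ≤ 20) (hσ : σ ∈ V m (TypeP bs) (10 + m)) {z i : ℕ}
    (hz : Good m (9 + m) z) (hi : i < m) (hk : dig z i % 32 < dig z i / 32) :
    pack m bs σ (z + 2 ^ (10 * i)) =
      σ fun j : Fin m => mono (ex (Function.update (dig z) i (dig z i + 1) j)) := by
  by_cases hc : i + 1 < m ∧ dig z (i + 1) = dig z i + 1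
  · rw [pack_not_good (not_good_add hz hc.1 hk hc.2 _)]
    obtain ⟨φ, rfl⟩ := hσ.1
    refine (φ.map_eq_zero_of_eq _ (i := ⟨i, hi⟩) (j := ⟨i + 1, hc.1⟩) ?_ ?_).symm
    · simp only [Function.update_self]
      rw [Function.update_of_ne (by omega), hc.2]
    · intro h
      have := congrArg Fin.val h
      simp only at this
      omega
  · obtain ⟨h1, h2, -⟩ := hz.add hi hk fun h h' => hc ⟨h, h'⟩
    rw [show 9 + m + 1 = 10 + m by omega] at h1
    rw [pack_good hm hσ h1]
    congr 1
    funext j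
    rw [h2 j j.2]

theorem update_ex {z i b : ℕ} (j : Fin m) (hi : i < m) :
    Function.update (fun j : Fin m => ex (dig z j)) ⟨i, hi⟩ (ex b) j =
      ex (Function.update (dig z) i b j) := by
  by_cases h : j = ⟨i, hi⟩
  · rw [h]
    simp
  · rw [Function.update_of_ne h, Function.update_of_ne fun h' => h (Fin.ext h')]

theorem rowE_pack (hm : m ≤ 20) (hσ : σ ∈ V m (TypeP bs) (10 + m))
    (h0 : lieDer (mono (2, 0)) m σ = 0) {z : ℕ} (hz : Good m (11 + m) z) :
    rowE (pack m bs σ) m z = 0 := by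
  have hn : ∀ i : Fin m, 2 ≤ (ex (dig z i)).1 + (ex (dig z i)).2 := fun i => by
    have := hz.2.2.2.1 i
    simp only at this
    omega
  have h1 := lieDer_mono_apply (mem_cochain_iff.1 hσ.1).1 (a := (2, 0)) (by simp) hn
  rw [h0, Pi.zero_apply, eq_comm, neg_eq_zero] at h1
  -- The factor 2 comes from {q², ·} = 2q ∂/∂p.
  have h2 : (2 : ℝ) * rowE (pack m bs σ) m z = 0 := by
    rw [← h1, rowE, Finset.sum_range, Finset.mul_sum]
    refine Finset.sum_congr rfl fun i _ => ?_
    by_cases hk : dig z i % 32 = 0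
    · simp [ex, hk]
    · rw [pack_sub hm hσ hz i.2 hk, nsmul_eq_mul]
      have h3 : (2 + (ex (dig z i)).1 - 1, 0 + (ex (dig z i)).2 - 1) = ex (dig z i - 1) := by
        have := hz.le i.2
        simp only [ex]
        ext <;> simp only <;> omega
      simp only [h3, update_ex _ i.2]
      simp only [ex]
      push_cast
      ring
  linarith

theorem rowF_pack (hm : m ≤ 20) (hσ : σ ∈ V m (TypeP bs) (10 + m))
    (h0 : lieDer (mono (0, 2)) m σ = 0) {z : ℕ} (hz : Good m (9 + m) z) :
    rowF (pack m bs σ) m z = 0 := by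
  have hn : ∀ i : Fin m, 2 ≤ (ex (dig z i)).1 + (ex (dig z i)).2 := fun i => by
    have := hz.2.2.2.1 i
    simp only at this
    omega
  have h1 := lieDer_mono_apply (mem_cochain_iff.1 hσ.1).1 (a := (0, 2)) (by simp) hn
  rw [h0, Pi.zero_apply, eq_comm, neg_eq_zero] at h1
  -- The factor -2 comes from {p², ·} = -2p ∂/∂q.
  have h2 : (-2 : ℝ) * rowF (pack m bs σ) m z = 0 := by
    rw [← h1, rowF, Finset.sum_range, Finset.mul_sum]
    refine Finset.sum_congr rfl fun i _ => ?_
    by_cases hk : dig z i % 32 < dig z i / 32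
    · rw [pack_add hm hσ hz i.2 hk, nsmul_eq_mul]
      have h3 : (0 + (ex (dig z i)).1 - 1, 2 + (ex (dig z i)).2 - 1) = ex (dig z i + 1) := by
        have := hz.deg_le i.2
        simp only [ex]
        ext <;> simp only <;> omega
      simp only [h3, update_ex _ i.2]
      simp only [ex]
      push_cast
      ring
    · rw [Nat.sub_eq_zero_of_le (by omega)]
      simp [ex, Nat.sub_eq_zero_of_le (show dig z i / 32 ≤ dig z i % 32 by omega)]
  linarith

end


theorem sum_map_digL (F : ℕ → ℕ) (n x : ℕ) :
    ((digL n x).map F).sum = ∑ i ∈ Finset.range n, F (dig x i) := by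
  rw [digL, List.map_map]
  rfl

theorem keyL_eq_dsum (M : List ℕ) : keyL M = dsum 10 M.length fun i => M.getD i 0 := by
  rw [← keyL_map_range]
  congr 1
  refine List.ext_getElem (by simp) fun i h h' => ?_
  simp [h]

theorem digL_keyL {M : List ℕ} (hM : ∀ c ∈ M, c < 2 ^ 10) : digL M.length (keyL M) = M := by
  refine List.ext_getElem (length_digL _ _) fun i h h' => ?_
  have h1 : ∀ i < M.length, M.getD i 0 < 2 ^ 10 := fun i hi => by
    rw [List.getD_eq_getElem _ _ hi]
    exact hM _ (List.getElem_mem hi)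
  have h2 := dig_dsum h1 h'
  rw [← keyL_eq_dsum, List.getD_eq_getElem _ _ h'] at h2
  simpa [digL] using h2

theorem good_digL {n h x : ℕ} (hx : Good n h x) : (digL n x).Pairwise (· < ·) ∧
    (∀ a ∈ digL n x, a % 32 ≤ a / 32 ∧ 95 < a) ∧ ((digL n x).map (· % 32)).sum = h ∧
    ((digL n x).map (· / 32 - 2)).sum = 20 := by
  obtain ⟨-, h2, h3, h4, h5, h6⟩ := (good_iff' _ _ _ _ _).1 ((good_iff _ _ _).2 hx)
  rw [sum_map_digL, sum_map_digL]
  refine ⟨?_, fun a ha => ?_, h5, h6⟩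
  · rw [digL, List.pairwise_map]
    exact List.pairwise_lt_range.imp_of_mem fun {i j} hi hj hij => h3 i j hij (List.mem_range.1 hj)
  · obtain ⟨i, hi, rfl⟩ := List.mem_map.1 ha
    exact ⟨h4 i (List.mem_range.1 hi), h2 i (List.mem_range.1 hi)⟩

theorem good_keyL {M : List ℕ} {h : ℕ} (hlt : ∀ c ∈ M, c < 2 ^ 10) (h1 : M.Pairwise (· < ·))
    (h2 : ∀ a ∈ M, a % 32 ≤ a / 32 ∧ 95 < a) (h3 : (M.map (· % 32)).sum = h)
    (h4 : (M.map (· / 32 - 2)).sum = 20) : Good M.length h (keyL M) := by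
  have hd := digL_keyL hlt
  rw [← hd, sum_map_digL] at h3 h4
  rw [← hd] at h1 h2
  rw [← good_iff, good_iff']
  rw [digL, List.pairwise_map] at h1
  refine ⟨?_, fun i hi => (h2 _ (List.mem_map.2 ⟨i, List.mem_range.2 hi, rfl⟩)).2,
    fun i j hij hj => ?_, fun i hi => (h2 _ (List.mem_map.2 ⟨i, List.mem_range.2 hi, rfl⟩)).1, h3,
    h4⟩
  · rw [keyL_eq_dsum]
    refine dsum_lt fun i hi => ?_
    rw [List.getD_eq_getElem _ _ hi]
    exact hlt _ (List.getElem_mem hi)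
  · have := List.pairwise_iff_getElem.1 h1 i j (by simpa using hij.trans hj) (by simpa using hj) hij
    simpa using this

/-- Two entries of a tuple of weight 20 have degrees l and l' with (l - 2) + (l' - 2) ≤ 20. -/
theorem small_of_good {n h x : ℕ} (hx : Good n h x) : Small (digL n x) := by
  refine ⟨fun a ha => ?_, ?_⟩
  · have := (good_digL hx).2.1 a ha
    omega
  · rw [digL, List.pairwise_map]
    refine List.pairwise_lt_range.imp_of_mem fun {i j} hi hj hij => ?_
    have h1 := (good_digL hx).2.2.2
    rw [sum_map_digL] at h1
    have h2 := Finset.sum_le_sum_of_subset (f := fun i => dig x i / 32 - 2)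
      (show {i, j} ⊆ Finset.range n by
        intro k hk
        rw [Finset.mem_insert, Finset.mem_singleton] at hk
        rcases hk with rfl | rfl
        · simpa using hi
        · simpa using hj)
    rw [h1, Finset.sum_pair hij.ne] at h2
    omega

/-- A bracket with nonzero coefficient preserves the weight and lowers the height by 1, so at a good
tuple of height 11 + m the coboundary evaluates only good tuples of height 10 + m, on which packing
agrees with σ. -/
theorem rowDA_pack {m : ℕ} {bs : List Block} {σ : Fun Ham0 m} (hm : m ≤ 20)
    (hσ : σ ∈ V m (TypeP bs) (10 + m)) (h0 : d m σ = 0) {x : ℕ}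
    (hx : Good (m + 1) (11 + m) x) :
    rowDA (fun M => pack m bs σ (keyL M)) (digL (m + 1) x) = 0 := by
  obtain ⟨h1, h2, h3, h4⟩ := good_digL hx
  have hs := small_of_good hx
  have h5 := evalL_d (mem_cochain_iff.1 hσ.1).1 (digL (m + 1) x) (length_digL _ _) hs
  rw [h0] at h5
  have h6 : rowDA (evalL m σ) (digL (m + 1) x) = 0 := by
    exact neg_eq_zero.1 h5.symm
  rw [← h6]
  refine rowDA_congr h1 (fun a ha => (h2 a ha).2) fun a b R M hc hp hM hp' => ?_
  have hlen := hp.length_eq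
  have hlen' := hp'.length_eq
  rw [length_digL] at hlen
  simp only [List.length_cons] at hlen hlen'
  have hlen'' : M.length = m := by omega
  rw [← (hp.map _).sum_eq] at h3 h4
  have ha := hs.1 a (hp.subset (by simp))
  have hb := hs.1 b (hp.subset (by simp))
  have hab := (List.pairwise_cons.1 ((hp.symm.pairwise_iff (R := fun a b => a / 32 + b / 32 ≤ 24)
    (fun {a b} h => by omega)).1 hs.2)).1 b (by simp)
  have h7 : a % 32 + b % 32 ≠ 0 := by
    intro h
    refine hc ?_
    rw [coef, show a % 32 = 0 by omega, show b % 32 = 0 by omega]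
    simp
  have h8 : ¬ (a % 32 = a / 32 ∧ b % 32 = b / 32) := by
    rintro ⟨h, h'⟩
    refine hc ?_
    rw [coef, h, h']
    ring
  simp only [List.map_cons, List.sum_cons] at h3 h4
  have hvalid : ∀ c ∈ M, c % 32 ≤ c / 32 ∧ 95 < c := by
    intro c hcM
    rcases List.mem_cons.1 (hp'.subset hcM) with rfl | h
    · omega
    · exact h2 c (hp.subset (List.mem_cons_of_mem _ (List.mem_cons_of_mem _ h)))
  have hlt : ∀ c ∈ M, c < 2 ^ 10 := by
    intro c hcM
    rcases List.mem_cons.1 (hp'.subset hcM) with rfl | h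
    · omega
    · exact mem_digL_lt (hp.subset (List.mem_cons_of_mem _ (List.mem_cons_of_mem _ h)))
  have hg : Good M.length (10 + m) (keyL M) := by
    refine good_keyL hlt hM hvalid ?_ ?_
    · rw [(hp'.map _).sum_eq, List.map_cons, List.sum_cons]
      omega
    · rw [(hp'.map _).sum_eq, List.map_cons, List.sum_cons]
      omega
  have hd := digL_keyL hlt
  rw [hlen''] at hg hd
  rw [pack_good hm hσ hg]
  exact (evalL_digL σ _).symm.trans (by rw [hd])

/-- Packing as a linear map. -/
def packₗ (m : ℕ) (bs : List Block) : Fun Ham0 m →ₗ[ℝ] (ℕ → ℝ) where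
  toFun := pack m bs
  map_add' σ τ := by
    funext y
    simp only [pack, Pi.add_apply]
    split_ifs <;> simp
  map_smul' c σ := by
    funext y
    simp only [pack, Pi.smul_apply, RingHom.id_apply]
    split_ifs <;> simp

theorem pack_mem_Sol {m : ℕ} {bs : List Block} {σ : Fun Ham0 m} (hm : m ≤ 20)
    (hσ : σ ∈ R m (TypeP bs)) (h0 : d m σ = 0) : pack m bs σ ∈ Sol ℝ (tuples m bs) (rows m) := by
  refine ⟨fun y hy => if_neg hy, ?_⟩
  rintro r (⟨z, hz, rfl⟩ | ⟨z, hz, rfl⟩ | ⟨x, hx, rfl⟩) <;> rw [← evalRow_apply]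
  · rw [evalRow_rowE]
    exact rowE_pack hm hσ.1 (R_lieDer hσ (mono_mem_sp2 rfl)) hz
  · rw [evalRow_rowF]
    exact rowF_pack hm hσ.1 hσ.2 hz
  · rw [evalRow_rowDA]
    exact rowDA_pack hm hσ.1 h0 hx

/-- The dimension of the closed invariant cochains with types in `bs`. -/
theorem finrank_R_inf_ker_le {m : ℕ} (hm : m ≤ 20) (bs : List Block)
    (hbs : ∀ b ∈ bs, ∀ t ∈ b.1, TypeOK m t) :
    Module.finrank ℝ ↥(R m (TypeP bs) ⊓ LinearMap.ker (d m)) ≤ kerDim m bs := by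
  -- Packing embeds the closed invariants into the real solutions of the integral system. Their
  -- dimension is at most that of the solutions modulo 8191, which lie in `W`, and the program
  -- bounds the latter.
  refine le_trans ?_ (((finrank_Sol_le 8191 (tuples m bs) (rows m)).trans
    (Submodule.finrank_mono (Sol_le_W m bs))).trans (finrank_W_le_kerDim hm bs hbs))
  have h1 : ∀ σ : ↥(R m (TypeP bs) ⊓ LinearMap.ker (d m)),
      (packₗ m bs ∘ₗ (R m (TypeP bs) ⊓ LinearMap.ker (d m)).subtype) σ ∈
        Sol ℝ (tuples m bs) (rows m) := fun σ => pack_mem_Sol hm σ.2.1 σ.2.2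
  refine LinearMap.finrank_le_finrank_of_injective
    (f := LinearMap.codRestrict (Sol ℝ (tuples m bs) (rows m)) _ h1) ?_
  rw [← LinearMap.ker_eq_bot, LinearMap.ker_eq_bot']
  rintro ⟨σ, hσ, hσ'⟩ h
  have h2 : pack m bs σ = 0 := congrArg Subtype.val h
  apply Subtype.ext
  have h4 : evalN m (TypeP bs) (10 + m) ⟨σ, hσ.1⟩ = 0 := by
    funext f
    obtain ⟨y, hy, hyf⟩ := exists_good f.2
    have h3 := congrFun h2 y
    rw [pack_good hm hσ.1 hy] at h3
    simp only [hyf] at h3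
    exact h3
  have h5 := evalN_injective m (TypeP bs) (10 + m) (h4.trans (map_zero _).symm)
  rw [Subtype.ext_iff] at h5
  exact h5


/-! Counting tuples by their types. -/

/-- The sum of `B ^ f a` determines the number of elements with `f a = h`. -/
theorem sum_pow_digit {α : Type*} (A : Finset α) (f : α → ℕ) {B : ℕ} (hB : A.card < B) (h : ℕ) :
    (∑ a ∈ A, B ^ f a) / B ^ h % B = (A.filter fun a => f a = h).card := by
  have hB0 : 0 < B := by omega
  -- No carries: fewer than B terms, each at most B ^ (h - 1), stay below B ^ h.
  have h1 : ∑ a ∈ A.filter (fun a => f a < h), B ^ f a < B ^ h := by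
    rcases Nat.eq_zero_or_pos h with rfl | hh
    · simp
    · calc ∑ a ∈ A.filter (fun a => f a < h), B ^ f a
          ≤ ∑ a ∈ A.filter (fun a => f a < h), B ^ (h - 1) := by
            refine Finset.sum_le_sum fun a ha => Nat.pow_le_pow_right hB0 ?_
            have := (Finset.mem_filter.1 ha).2
            omega
        _ ≤ A.card * B ^ (h - 1) := by
            rw [Finset.sum_const, smul_eq_mul]
            exact Nat.mul_le_mul_right _ (Finset.card_filter_le _ _)
        _ < B * B ^ (h - 1) := Nat.mul_lt_mul_of_pos_right hB (by positivity)
        _ = B ^ h := by rw [← pow_succ', Nat.sub_add_cancel hh]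
  obtain ⟨q, hq⟩ : B ^ (h + 1) ∣ ∑ a ∈ A.filter (fun a => ¬ f a < h ∧ f a ≠ h), B ^ f a := by
    refine Finset.dvd_sum fun a ha => pow_dvd_pow _ ?_
    have := (Finset.mem_filter.1 ha).2
    omega
  have h2 : ∑ a ∈ A, B ^ f a = ∑ a ∈ A.filter (fun a => f a < h), B ^ f a +
      B ^ h * ((A.filter fun a => f a = h).card + B * q) := by
    rw [← Finset.sum_filter_add_sum_filter_not A fun a => f a < h,
      ← Finset.sum_filter_add_sum_filter_not (A.filter fun a => ¬ f a < h) fun a => f a = h,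
      Finset.filter_filter, Finset.filter_filter, hq, pow_succ]
    have h3 : A.filter (fun a => ¬ f a < h ∧ f a = h) = A.filter fun a => f a = h :=
      Finset.filter_congr fun a _ => by omega
    have h4 : ∑ a ∈ A.filter (fun a => f a = h), B ^ f a =
        (A.filter fun a => f a = h).card * B ^ h := by
      rw [← smul_eq_mul, ← Finset.sum_const]
      exact Finset.sum_congr rfl fun a ha => by rw [(Finset.mem_filter.1 ha).2]
    rw [h3, h4]
    ring
  rw [h2, Nat.add_mul_div_left _ _ (by positivity), Nat.div_eq_of_lt h1, zero_add,
    Nat.add_mul_mod_self_left, Nat.mod_eq_of_lt ((Finset.card_filter_le _ _).trans_lt hB)]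

/-- The decreasing lists of codes below `p` with given degrees. -/
def tup : List ℕ → ℕ → Finset (List ℕ)
  | [], _ => {[]}
  | l :: T, p => ((Finset.range (l + 1)).filter fun k => 32 * l + k < p).biUnion fun k =>
      (tup T (32 * l + k)).image (List.cons (32 * l + k))

theorem mem_tup {T : List ℕ} (hT : ∀ l ∈ T, l < 32) (p : ℕ) (L : List ℕ) : L ∈ tup T p ↔
    L.Pairwise (· > ·) ∧ (∀ c ∈ L, c < p) ∧ L.map (· / 32) = T ∧ ∀ c ∈ L, c % 32 ≤ c / 32 := by
  induction T generalizing p L with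
  | nil =>
    rw [tup, Finset.mem_singleton]
    constructor
    · rintro rfl
      simp
    · rintro ⟨-, -, h, -⟩
      simpa using h
  | cons l T ih =>
    have hl := hT l List.mem_cons_self
    simp only [tup, Finset.mem_biUnion, Finset.mem_filter, Finset.mem_range, Finset.mem_image,
      ih fun l' hl' => hT l' (List.mem_cons_of_mem _ hl')]
    constructor
    · rintro ⟨k, ⟨hk, hp⟩, L, ⟨h1, h2, h3, h4⟩, rfl⟩
      refine ⟨List.pairwise_cons.2 ⟨h2, h1⟩, ?_, ?_, ?_⟩
      · intro c hc
        rcases List.mem_cons.1 hc with rfl | hc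
        · exact hp
        · exact (h2 c hc).trans hp
      · rw [List.map_cons, h3]
        congr 1
        omega
      · intro c hc
        rcases List.mem_cons.1 hc with rfl | hc
        · omega
        · exact h4 c hc
    · rintro ⟨h1, h2, h3, h4⟩
      cases L with
      | nil => cases h3
      | cons c L =>
        rw [List.map_cons, List.cons.injEq] at h3
        have hc := h4 c List.mem_cons_self
        have hc' : 32 * l + c % 32 = c := by omega
        refine ⟨c % 32, ⟨by omega, by rw [hc']; exact h2 c List.mem_cons_self⟩, L, ?_, by rw [hc']⟩
        rw [hc']
        exact ⟨(List.pairwise_cons.1 h1).2, (List.pairwise_cons.1 h1).1, h3.2,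
          fun c hc => h4 c (List.mem_cons_of_mem _ hc)⟩

/-- The generating function of the heights on `tup T p`, evaluated at `B`. -/
def gf (B : ℕ) (T : List ℕ) (p : ℕ) : ℕ := ∑ L ∈ tup T p, B ^ (L.map (· % 32)).sum

theorem gf_nil (B p : ℕ) : gf B [] p = 1 := by
  rw [gf, tup]
  simp

theorem gf_cons (B : ℕ) {l : ℕ} (hl : l < 32) (T : List ℕ) (p : ℕ) : gf B (l :: T) p =
    ∑ k ∈ (Finset.range (l + 1)).filter fun k => 32 * l + k < p, B ^ k * gf B T (32 * l + k) := by
  rw [gf, tup, Finset.sum_biUnion]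
  · refine Finset.sum_congr rfl fun k hk => ?_
    have hk' : k < l + 1 := Finset.mem_range.1 (Finset.mem_filter.1 hk).1
    rw [Finset.sum_image (List.cons_injective.injOn), gf, Finset.mul_sum]
    refine Finset.sum_congr rfl fun L _ => ?_
    rw [List.map_cons, List.sum_cons, pow_add, show (32 * l + k) % 32 = k by omega]
  · intro k _ k' _ hkk'
    rw [Function.onFun, Finset.disjoint_left]
    intro L h h'
    obtain ⟨M, -, rfl⟩ := Finset.mem_image.1 h
    obtain ⟨M', -, hM'⟩ := Finset.mem_image.1 h'
    rw [List.cons.injEq] at hM'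
    omega

/-- Below the code 32 l + k, exactly the exponents j < k are allowed in degree l, so the values for
k = 0, …, l + 1 are partial sums of one series. -/
theorem gf_cons_le (B : ℕ) {l : ℕ} (hl : l < 32) (T : List ℕ) {k : ℕ} (hk : k ≤ l + 1) :
    gf B (l :: T) (32 * l + k) = ∑ j ∈ Finset.range k, B ^ j * gf B T (32 * l + j) := by
  rw [gf_cons B hl]
  congr 1
  ext j
  simp only [Finset.mem_filter, Finset.mem_range]
  omega

theorem gf_cons_eq (B : ℕ) {l : ℕ} (hl : l < 32) (T : List ℕ) {p : ℕ} (hp : 33 * l < p) :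
    gf B (l :: T) p = gf B (l :: T) (32 * l + (l + 1)) := by
  rw [gf_cons B hl, gf_cons B hl]
  congr 1
  ext j
  simp only [Finset.mem_filter, Finset.mem_range]
  omega

/-- The entry with index `k`, or `0`. -/
def nth (r : List ℕ) : ℕ → ℕ :=
  List.rec (motive := fun _ => ℕ → ℕ) (fun _ => 0)
    (fun a _ ih k => Nat.rec (motive := fun _ => ℕ) a (fun k _ => ih k) k) r

theorem nth_eq (r : List ℕ) (k : ℕ) : nth r k = r.getD k 0 := by
  induction r generalizing k with
  | nil => rfl
  | cons a r ih => cases k with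
    | zero => rfl
    | succ k => exact (ih k).trans List.getD_cons_succ.symm

/-- The list of `n` entries `v`. -/
def rep (v n : ℕ) : List ℕ :=
  Nat.rec (motive := fun _ => List ℕ) List.nil (fun _ ih => List.cons v ih) n

theorem rep_eq (v n : ℕ) : rep v n = List.replicate n v := by
  induction n with
  | zero => rfl
  | succ n ih => exact congrArg (List.cons v) ih

/-- Partial sums of a power series. -/
def psum (B : ℕ) (r : List ℕ) : ℕ → ℕ → List ℕ :=
  List.rec (motive := fun _ => ℕ → ℕ → List ℕ) (fun s _ => List.cons s List.nil)
    (fun a _ ih s j => List.cons s (force (Nat.add s (Nat.mul (Nat.pow B j) a)) fun s' =>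
      force (Nat.succ j) fun j' => ih s' j')) r

theorem psum_cons (B a : ℕ) (r : List ℕ) (s j : ℕ) :
    psum B (a :: r) s j = s :: psum B r (s + B ^ j * a) (j + 1) := by
  change s :: force _ _ = _
  rw [force_eq, force_eq]
  rfl

theorem getD_psum (B : ℕ) (r : List ℕ) (s j : ℕ) {k : ℕ} (hk : k ≤ r.length) :
    (psum B r s j).getD k 0 = s + ∑ i ∈ Finset.range k, B ^ (j + i) * r.getD i 0 := by
  induction r generalizing s j k with
  | nil =>
    obtain rfl : k = 0 := by simpa using hk
    simp [psum]
  | cons a r ih =>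
    cases k with
    | zero => simp [psum_cons]
    | succ k =>
      rw [psum_cons, List.getD_cons_succ, ih _ _ (by simpa using hk), Finset.sum_range_succ']
      simp only [List.getD_cons_succ, List.getD_cons_zero, add_zero, add_assoc, add_comm 1]
      ring

theorem length_psum (B : ℕ) (r : List ℕ) (s j : ℕ) : (psum B r s j).length = r.length + 1 := by
  induction r generalizing s j with
  | nil => rfl
  | cons a r ih => rw [psum_cons, List.length_cons, ih, List.length_cons]

/-- The list of the values `gf B T (32 * l + k)`, where `l` is the first entry of `T`. -/
def gfL (B : ℕ) (T : List ℕ) : List ℕ :=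
  List.rec (motive := fun _ => List ℕ) List.nil (fun l T ih =>
    psum B (List.rec (motive := fun _ => List ℕ) (rep 1 (Nat.succ l)) (fun l' _ _ =>
      sel (Nat.beq l l') ih (force (nth ih (Nat.succ l')) fun v => rep v (Nat.succ l))) T) 0 0) T

theorem gfL_singleton (B l : ℕ) : gfL B [l] = psum B (List.replicate (l + 1) 1) 0 0 := by
  rw [← rep_eq]
  rfl

theorem gfL_cons_cons (B l l' : ℕ) (T : List ℕ) : gfL B (l :: l' :: T) =
    psum B (if l = l' then gfL B (l' :: T) else
      List.replicate (l + 1) ((gfL B (l' :: T)).getD (l' + 1) 0)) 0 0 := by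
  rw [← nth_eq, ← rep_eq]
  change psum B (sel (Nat.beq l l') (gfL B (l' :: T)) (force _ _)) 0 0 = _
  rw [force_eq, sel_eq]
  simp only [Nat.beq_eq]
  rfl

/-- Dynamic programming over the degrees. If two consecutive degrees agree, the exponents must
decrease strictly and the preceding table supplies the coefficients. If the degree drops, any
exponent is allowed next and each coefficient is the last entry of the preceding table. -/
theorem gfL_spec (B : ℕ) {T : List ℕ} (hT : ∀ l ∈ T, l < 32) (hs : T.Pairwise (· ≥ ·)) :
    ∀ l ∈ T.head?, l + 2 ≤ (gfL B T).length ∧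
      ∀ k ≤ l + 1, (gfL B T).getD k 0 = gf B T (32 * l + k) := by
  induction T with
  | nil => simp
  | cons l T ih =>
    intro l₁ h₁
    obtain rfl : l = l₁ := by simpa using h₁
    have hl := hT l List.mem_cons_self
    replace ih := ih (fun l' hl' => hT l' (List.mem_cons_of_mem _ hl')) (List.pairwise_cons.1 hs).2
    suffices h : ∃ r : List ℕ, gfL B (l :: T) = psum B r 0 0 ∧ l + 1 ≤ r.length ∧
        ∀ k ≤ l, r.getD k 0 = gf B T (32 * l + k) by
      obtain ⟨r, h1, h2, h3⟩ := h
      rw [h1, length_psum]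
      refine ⟨by omega, fun k hk => ?_⟩
      rw [getD_psum B r 0 0 (by omega), gf_cons_le B hl T hk, zero_add]
      refine Finset.sum_congr rfl fun i hi => ?_
      rw [zero_add, h3 i (by have := Finset.mem_range.1 hi; omega)]
    cases T with
    | nil =>
      refine ⟨_, gfL_singleton B l, by simp, fun k hk => ?_⟩
      rw [gf_nil]
      rw [List.getD_replicate _ (by omega)]
    | cons l' T =>
      obtain ⟨h1, h2⟩ := ih l' rfl
      have hle : l ≥ l' := (List.pairwise_cons.1 hs).1 l' List.mem_cons_self
      have hl' : l' < 32 := hT l' (by simp)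
      by_cases h : l = l'
      · subst h
        exact ⟨_, by rw [gfL_cons_cons, if_pos rfl], by omega, fun k hk => h2 k (by omega)⟩
      · refine ⟨_, by rw [gfL_cons_cons, if_neg h], by simp, fun k hk => ?_⟩
        rw [List.getD_replicate _ (by omega), gf_cons_eq B hl' T (by omega)]
        exact h2 _ le_rfl

/-- The value of `gf B T` at a large bound. -/
def gfT (B : ℕ) (T : List ℕ) : ℕ :=
  List.rec (motive := fun _ => ℕ) 1 (fun l _ _ => nth (gfL B T) (Nat.succ l)) T

theorem gfT_eq (B : ℕ) {T : List ℕ} (hT : ∀ l ∈ T, l < 31) (hs : T.Pairwise (· ≥ ·)) :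
    gfT B T = gf B T 1024 := by
  cases T with
  | nil => exact (gf_nil _ _).symm
  | cons l T =>
    have hl := hT l List.mem_cons_self
    rw [gf_cons_eq B (by omega) T (by omega)]
    exact (nth_eq _ _).trans
      ((gfL_spec B (fun l hl => (hT l hl).trans (by norm_num)) hs l rfl).2 _ le_rfl)

/-- The decreasing lists of `n` degrees between `3` and `hi` with weight `w`. -/
def parts : ℕ → ℕ → ℕ → List (List ℕ)
  | 0, w, _ => if w = 0 then [[]] else []
  | n + 1, w, hi => (List.range (w - n)).flatMap fun i =>
      if i + 3 ≤ hi ∧ w ≤ (n + 1) * (i + 1) then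
        (parts n (w - (i + 1)) (i + 3)).map (List.cons (i + 3))
      else []

theorem mem_parts (n w hi : ℕ) (T : List ℕ) : T ∈ parts n w hi ↔ T.length = n ∧
    T.Pairwise (· ≥ ·) ∧ (∀ l ∈ T, 3 ≤ l ∧ l ≤ hi) ∧ (T.map (· - 2)).sum = w := by
  induction n generalizing w hi T with
  | zero =>
    rw [parts]
    constructor
    · intro h
      split_ifs at h with hw
      · rw [List.mem_singleton] at h
        simp [h, hw]
      · cases h
    · rintro ⟨h1, -, -, h4⟩
      obtain rfl := List.eq_nil_of_length_eq_zero h1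
      have : w = 0 := by simpa using h4.symm
      simp [this]
  | succ n ih =>
    simp only [parts, List.mem_flatMap, List.mem_range]
    constructor
    · rintro ⟨i, hi', h⟩
      split_ifs at h with h1
      · obtain ⟨T, hT, rfl⟩ := List.mem_map.1 h
        obtain ⟨h2, h3, h4, h5⟩ := (ih _ _ _).1 hT
        refine ⟨by simp [h2], List.pairwise_cons.2 ⟨fun l hl => (h4 l hl).2, h3⟩, ?_, ?_⟩
        · intro l hl
          rcases List.mem_cons.1 hl with rfl | hl
          · omega
          · have := h4 l hl
            omega
        · rw [List.map_cons, List.sum_cons, h5]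
          omega
      · cases h
    · rintro ⟨h1, h2, h3, h4⟩
      cases T with
      | nil => cases h1
      | cons l T =>
        have hl := h3 l List.mem_cons_self
        rw [List.map_cons, List.sum_cons] at h4
        -- The pruning in `parts` loses nothing: each of the other n entries contributes between 1
        -- and the contribution l - 2 of the largest one.
        have h5 := List.sum_le_card_nsmul (T.map (· - 2)) (l - 2) fun x hx => by
          obtain ⟨l', hl', rfl⟩ := List.mem_map.1 hx
          exact Nat.sub_le_sub_right ((List.pairwise_cons.1 h2).1 l' hl') 2
        have h6 := List.card_nsmul_le_sum (T.map (· - 2)) 1 fun x hx => by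
          obtain ⟨l', hl', rfl⟩ := List.mem_map.1 hx
          have := h3 l' (List.mem_cons_of_mem _ hl')
          omega
        rw [List.length_map, show T.length = n by simpa using h1, smul_eq_mul] at h5 h6
        refine ⟨l - 3, by omega, ?_⟩
        rw [show l - 3 + 3 = l by omega, show l - 3 + 1 = l - 2 by omega,
          if_pos ⟨hl.2, by rw [add_one_mul]; omega⟩]
        refine List.mem_map.2 ⟨T, (ih _ _ _).2 ⟨by simpa using h1, (List.pairwise_cons.1 h2).2,
          fun l' hl' => ⟨(h3 l' (List.mem_cons_of_mem _ hl')).1,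
            (List.pairwise_cons.1 h2).1 l' hl'⟩, by omega⟩, rfl⟩

theorem nodup_parts (n w hi : ℕ) : (parts n w hi).Nodup := by
  induction n generalizing w hi with
  | zero =>
    rw [parts]
    split_ifs <;> simp
  | succ n ih =>
    rw [parts, List.nodup_flatMap]
    constructor
    · intro i _
      split_ifs
      · exact (ih _ _).map List.cons_injective
      · exact List.nodup_nil
    · refine List.nodup_range.imp fun {i j} hij => ?_
      rw [Function.onFun, List.disjoint_left]
      intro T h h'
      split_ifs at h with h1
      · split_ifs at h' with h2
        · obtain ⟨M, -, rfl⟩ := List.mem_map.1 h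
          obtain ⟨M', -, hM'⟩ := List.mem_map.1 h'
          rw [List.cons.injEq] at hM'
          omega
        · cases h'
      · cases h

/-- The sum of the generating functions of the types that satisfy `b`. -/
def total (B m : ℕ) (b : List ℕ → Bool) : ℕ :=
  (((parts m 20 22).filter b).map (gfT B)).sum

/-- The lists of codes with types that satisfy `b`. -/
def tups (m : ℕ) (b : List ℕ → Bool) : Finset (List ℕ) :=
  ((parts m 20 22).filter b).toFinset.biUnion fun T => tup T 1024

theorem lt_of_mem_parts {m : ℕ} {T : List ℕ} (hT : T ∈ parts m 20 22) : ∀ l ∈ T, l < 31 :=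
  fun l hl => (((mem_parts _ _ _ _).1 hT).2.2.1 l hl).2.trans_lt (by norm_num)

theorem sum_tups (B m : ℕ) (b : List ℕ → Bool) :
    ∑ L ∈ tups m b, B ^ (L.map (· % 32)).sum = total B m b := by
  rw [tups, Finset.sum_biUnion, total, ← List.sum_toFinset _ ((nodup_parts m 20 22).filter b)]
  · refine Finset.sum_congr rfl fun T hT => ?_
    have hT' := List.mem_of_mem_filter (List.mem_toFinset.1 hT)
    rw [gfT_eq B (lt_of_mem_parts hT') ((mem_parts _ _ _ _).1 hT').2.1, gf]
  · intro T hT T' hT' hne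
    have h := List.mem_of_mem_filter (List.mem_toFinset.1 hT)
    have h' := List.mem_of_mem_filter (List.mem_toFinset.1 hT')
    rw [Function.onFun, Finset.disjoint_left]
    intro L hL hL'
    refine hne ?_
    rw [← ((mem_tup (fun l hl => (lt_of_mem_parts h l hl).trans (by norm_num)) _ _).1 hL).2.2.1,
      ← ((mem_tup (fun l hl => (lt_of_mem_parts h' l hl).trans (by norm_num)) _ _).1 hL').2.2.1]

theorem mem_tups (m : ℕ) (b : List ℕ → Bool) (L : List ℕ) : L ∈ tups m b ↔
    L.length = m ∧ L.Pairwise (· > ·) ∧ (∀ c ∈ L, c % 32 ≤ c / 32 ∧ 3 ≤ c / 32) ∧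
      (L.map (· / 32 - 2)).sum = 20 ∧ b (L.map (· / 32)) = true := by
  simp only [tups, Finset.mem_biUnion, List.mem_toFinset, List.mem_filter]
  constructor
  · rintro ⟨T, ⟨hT, hb⟩, hL⟩
    obtain ⟨h1, h2, rfl, h4⟩ :=
      (mem_tup (fun l hl => (lt_of_mem_parts hT l hl).trans (by norm_num)) _ _).1 hL
    obtain ⟨h5, -, h6, h7⟩ := (mem_parts _ _ _ _).1 hT
    rw [List.map_map] at h7
    exact ⟨by simpa using h5, h1, fun c hc => ⟨h4 c hc, (h6 _ (List.mem_map_of_mem hc)).1⟩, h7, hb⟩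
  · rintro ⟨h1, h2, h3, h4, h5⟩
    have h22 : ∀ c ∈ L, c / 32 ≤ 22 := fun c hc => by
      have := List.single_le_sum (l := L.map (· / 32 - 2)) (fun _ _ => Nat.zero_le _) _
        (List.mem_map_of_mem hc)
      omega
    have hT : L.map (· / 32) ∈ parts m 20 22 := by
      refine (mem_parts _ _ _ _).2 ⟨by simpa using h1, ?_, ?_, by rwa [List.map_map]⟩
      · rw [List.pairwise_map]
        exact h2.imp fun h => Nat.div_le_div_right h.le
      · simp only [List.mem_map]
        rintro _ ⟨c, hc, rfl⟩
        exact ⟨(h3 c hc).2, h22 c hc⟩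
    refine ⟨_, ⟨hT, h5⟩, ?_⟩
    rw [mem_tup fun l hl => (lt_of_mem_parts hT l hl).trans (by norm_num)]
    refine ⟨h2, fun c hc => ?_, rfl, fun c hc => (h3 c hc).1⟩
    have := h22 c hc
    omega

/-- Reversal turns increasing tuples into the decreasing lists enumerated by `tups`; the test `b`
has to agree with P only on the degree lists that actually occur. -/
theorem ncard_N {m : ℕ} {P : Multiset ℕ → Prop} {b : List ℕ → Bool}
    (hb : ∀ T ∈ parts m 20 22, b T = true ↔ P T) (h : ℕ) :
    (N m P h).ncard = ((tups m b).filter fun L => (L.map (· % 32)).sum = h).card := by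
  rw [← Set.ncard_coe_finset]
  have hinj : Function.Injective fun f : Fin m → ℕ => (List.ofFn f).reverse :=
    List.reverse_injective.comp List.ofFn_injective
  rw [← Set.ncard_image_of_injective _ hinj]
  congr 1
  have key : ∀ f : Fin m → ℕ, f ∈ N m P h ↔
      (List.ofFn f).reverse ∈ (tups m b).filter fun L => (L.map (· % 32)).sum = h := by
    intro f
    have e1 : ∀ F : ℕ → ℕ, ((List.ofFn f).reverse.map F).sum = ∑ i, F (f i) := fun F => by
      rw [List.map_reverse, List.sum_reverse, List.map_ofFn, List.sum_ofFn]
      rfl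
    rw [Finset.mem_filter, mem_tups, e1, e1, List.pairwise_reverse, List.length_reverse,
      List.length_ofFn]
    have e2 : (List.ofFn f).Pairwise (fun a b => b > a) ↔ StrictMono f := by
      rw [List.pairwise_ofFn]
      exact Iff.rfl
    rw [e2]
    have e3 : (∀ c ∈ (List.ofFn f).reverse, c % 32 ≤ c / 32 ∧ 3 ≤ c / 32) ↔
        ∀ i, f i % 32 ≤ f i / 32 ∧ 3 ≤ f i / 32 := by
      simp [List.mem_ofFn]
    rw [e3]
    by_cases hle : ∀ i, f i % 32 ≤ f i / 32
    · have e4 : ∀ i, (ex (f i)).1 + (ex (f i)).2 = f i / 32 := fun i => ex_fst_add_snd (hle i)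
      have e5 : ((List.ofFn f).reverse.map (· / 32) : Multiset ℕ) =
          Finset.univ.val.map fun i : Fin m => (ex (f i)).1 + (ex (f i)).2 := by
        simp only [e4]
        rw [Fin.univ_val_map, List.map_reverse, List.map_ofFn, Multiset.coe_reverse]
        rfl
      constructor
      · rintro ⟨h1, h2, h3, h4, h5, h6⟩
        simp only [e4] at h3 h4
        have h7 : ((List.ofFn f).reverse.map (· / 32)) ∈ parts m 20 22 := by
          have := (mem_tups m (fun _ => true) (List.ofFn f).reverse).2
            ⟨by simp, by rw [List.pairwise_reverse]; exact e2.2 h1, e3.2 fun i => ⟨h2 i, h3 i⟩,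
              (e1 _).trans h4, rfl⟩
          simp only [tups, Finset.mem_biUnion, List.mem_toFinset, List.mem_filter] at this
          obtain ⟨T, ⟨hT, -⟩, hL⟩ := this
          rwa [((mem_tup (fun l hl => (lt_of_mem_parts hT l hl).trans (by norm_num)) _ _).1
            hL).2.2.1]
        exact ⟨⟨rfl, h1, fun i => ⟨h2 i, h3 i⟩, h4, (hb _ h7).2 (by rw [e5]; exact h5)⟩, h6⟩
      · rintro ⟨⟨-, h1, h2, h4, h5⟩, h6⟩
        have h7 : ((List.ofFn f).reverse.map (· / 32)) ∈ parts m 20 22 := by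
          have := (mem_tups m b (List.ofFn f).reverse).2
            ⟨by simp, by rw [List.pairwise_reverse]; exact e2.2 h1, e3.2 h2,
              (e1 _).trans h4, h5⟩
          simp only [tups, Finset.mem_biUnion, List.mem_toFinset, List.mem_filter] at this
          obtain ⟨T, ⟨hT, -⟩, hL⟩ := this
          rwa [((mem_tup (fun l hl => (lt_of_mem_parts hT l hl).trans (by norm_num)) _ _).1
            hL).2.2.1]
        refine ⟨h1, hle, fun i => ?_, ?_, ?_, h6⟩
        · rw [e4]
          exact (h2 i).2
        · simp only [e4]
          exact h4
        · have := (hb _ h7).1 h5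
          rwa [e5] at this
    · exact ⟨fun h => absurd h.2.1 hle, fun h => absurd (fun i => (h.1.2.2.1 i).1) hle⟩
  ext L
  constructor
  · rintro ⟨f, hf, rfl⟩
    exact (key f).1 hf
  · intro hL
    have hlen : L.reverse.length = m := by
      rw [List.length_reverse]
      exact ((mem_tups _ _ _).1 (Finset.mem_filter.1 hL).1).1
    subst hlen
    have h1 : (List.ofFn L.reverse.get).reverse = L := by rw [List.ofFn_get, List.reverse_reverse]
    refine ⟨L.reverse.get, (key _).2 ?_, h1⟩
    rw [h1]
    exact hL

/-- The dimension of `R m P` from the generating functions. -/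
theorem finrank_R_eq {m : ℕ} {P : Multiset ℕ → Prop} {b : List ℕ → Bool}
    (hb : ∀ T ∈ parts m 20 22, b T = true ↔ P T) {B : ℕ} (hB : total 1 m b < B) :
    Module.finrank ℝ (R m P) =
      total B m b / B ^ (10 + m) % B - total B m b / B ^ (9 + m) % B := by
  have hB' : (tups m b).card < B := by
    rw [← sum_tups] at hB
    simpa using hB
  rw [← sum_tups, sum_pow_digit _ _ hB', sum_pow_digit _ _ hB', ← ncard_N hb, ← ncard_N hb,
    ← finrank_R, Nat.add_sub_cancel]


/-! Dimensions of cochains, cocycles and coboundaries. -/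

/-- Check that the dimension of the invariant cochains with types in `b` is `c`. -/
def checkDim (m : ℕ) (b : List ℕ → Bool) (c : ℕ) : Bool :=
  sel (Nat.blt (total 1 m b) 18446744073709551616)
    (force (total 18446744073709551616 m b) fun t => Nat.beq c
      (Nat.sub (Nat.mod (Nat.div t (Nat.pow 18446744073709551616 (Nat.add 10 m)))
        18446744073709551616) (Nat.mod (Nat.div t (Nat.pow 18446744073709551616 (Nat.add 9 m)))
        18446744073709551616))) false

/-- At B = 1 the generating function is the number of tuples; the first test shows that it is below
the base 2^64, so the digits at 10 + m and 9 + m are the two counts. -/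
theorem finrank_R_of_checkDim {m : ℕ} {P : Multiset ℕ → Prop} {b : List ℕ → Bool}
    (hb : ∀ T ∈ parts m 20 22, b T = true ↔ P T) {c : ℕ} (h : checkDim m b c = true) :
    Module.finrank ℝ (R m P) = c := by
  rw [checkDim, sel_eq, force_eq] at h
  split_ifs at h with h1
  rw [Nat.blt_eq] at h1
  rw [finrank_R_eq hb h1]
  exact (Nat.eq_of_beq_eq_true h).symm

theorem finrank_C_of_checkDim {m c : ℕ} (h : checkDim (m + 1) (fun _ => true) c = true) :
    Module.finrank ℝ (C 20 (m + 1)) = c := by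
  rw [C_eq_R]
  exact finrank_R_of_checkDim (fun _ _ => by simp) h

/-- The check that a type occurs in a list of blocks. -/
def hasType (bs : List Block) (T : List ℕ) : Bool :=
  force (keyL (T.reverse.map (32 * ·))) fun k => bs.any fun b => b.1.any fun t => Nat.beq k t.1

theorem hasType_iff_typeP (bs : List Block) {m : ℕ} {T : List ℕ} (hT : T ∈ parts m 20 22) :
    hasType bs T = true ↔ TypeP bs T := by
  have h1 : ((T : Multiset ℕ).sort (· ≤ ·)) = T.reverse := by
    rw [← Multiset.coe_reverse, Multiset.coe_sort, List.mergeSort_eq_self (· ≤ ·)]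
    rw [List.pairwise_reverse]
    exact ((mem_parts _ _ _ _).1 hT).2.1
  rw [hasType, force_eq, TypeP, h1]
  simp only [List.any_eq_true, Nat.beq_eq]

theorem finrank_map_add (m : ℕ) (S : Submodule ℝ (Fun Ham0 m)) [Module.Finite ℝ S] :
    Module.finrank ℝ (S.map (d m)) + Module.finrank ℝ ↥(S ⊓ LinearMap.ker (d m)) =
      Module.finrank ℝ S := by
  have h := LinearMap.finrank_range_add_finrank_ker ((d m).domRestrict S)
  rw [LinearMap.range_domRestrict, LinearMap.ker_domRestrict] at h
  rw [← h]
  congr 1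
  rw [← Submodule.finrank_map_subtype_eq S, Submodule.map_comap_subtype]

/-- A certificate bounds the rank of the coboundary operator from below. -/
theorem le_finrank_B {n : ℕ} (bs : List Block) (D e r : ℕ) (hn : 0 < n) (hk : n ≤ 20)
    (hbs : ∀ b ∈ bs, ∀ t ∈ b.1, TypeOK n t) (hD : Certified n bs D)
    (he : checkDim n (hasType bs) e = true) (hr : r + D = e) :
    r ≤ Module.finrank ℝ (B 20 (n + 1)) := by
  obtain ⟨k, rfl⟩ : ∃ k, n = k + 1 := ⟨n - 1, by omega⟩
  have := finite_R (k + 1) (TypeP bs)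
  have := finite_R (k + 1) fun _ => True
  have h1 := finrank_R_inf_ker_le hk bs hbs
  rw [Nat.eq_of_beq_eq_true hD] at h1
  have h2 := finrank_R_of_checkDim (fun T hT => hasType_iff_typeP bs hT) he
  have h3 := finrank_map_add (k + 1) (R (k + 1) (TypeP bs))
  -- Restriction to the chosen types can only make the image smaller, so the rank found there is a
  -- lower bound.
  have h4 : (R (k + 1) (TypeP bs)).map (d (k + 1)) ≤ B 20 (k + 1 + 1) :=
    Submodule.map_mono (R_le_C k _)
  have : Module.Finite ℝ (B 20 (k + 1 + 1)) := by
    rw [B, C_eq_R]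
    infer_instance
  have h5 : r ≤ Module.finrank ℝ ((R (k + 1) (TypeP bs)).map (d (k + 1))) := by omega
  exact h5.trans (Submodule.finrank_mono h4)

theorem finite_C_succ (m : ℕ) : Module.Finite ℝ (C 20 (m + 1)) := by
  rw [C_eq_R]
  exact finite_R _ _

theorem B_le_Z (m : ℕ) : B 20 m ≤ Z 20 m := by
  cases m with
  | zero => exact bot_le
  | succ m =>
    rintro _ ⟨σ, hσ, rfl⟩
    exact ⟨d_mem_C rfl hσ, (mem_cochain_iff.1 hσ.1.1).1.d_lieDer_and_d_d.2⟩

/-- In degree 0 the domain is a point, all conditions on cochains are vacuous, d is zero, and there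
are no coboundaries. -/
theorem finrank_C_zero : Module.Finite ℝ (C 20 0) ∧ Module.finrank ℝ (C 20 0) = 1 ∧
    betti 20 0 = 1 := by
  have h1 : C 20 0 = ⊤ := by
    rw [eq_top_iff]
    rintro σ -
    refine ⟨⟨⟨ContinuousAlternatingMap.constOfIsEmpty ℝ Ham0 (Fin 0) (σ 0), ?_⟩, ?_⟩,
      fun h => absurd rfl h⟩
    · funext v
      exact congrArg σ (Subsingleton.elim _ _)
    · simp only [SetLike.mem_coe, Submodule.mem_iInf]
      intro X _
      exact ⟨rfl, rfl⟩
  have h2 : Module.finrank ℝ (Fun Ham0 0) = 1 := by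
    rw [(LinearEquiv.funUnique (Fin 0 → Ham0) ℝ ℝ).finrank_eq, Module.finrank_self]
  have h3 : Z 20 0 = ⊤ := by
    rw [Z, h1, top_inf_eq, LinearMap.ker_eq_top]
    rfl
  have h4 : Module.Finite ℝ (Fun Ham0 0) := Module.finite_of_finrank_eq_succ h2
  refine ⟨inferInstance, by rw [h1, finrank_top, h2], ?_⟩
  have h5 : betti 20 0 + _ = _ :=
    Submodule.finrank_quotient_add_finrank ((B 20 0).submoduleOf (Z 20 0))
  have h6 : Module.finrank ℝ ((B 20 0).submoduleOf (Z 20 0)) = 0 :=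
    (Submodule.submoduleOfEquivOfLe (B_le_Z 0)).finrank_eq.trans (finrank_bot _ _)
  rw [h6, h3, finrank_top, h2] at h5
  exact h5

/-- By rank-nullity, the bound on the outgoing rank leaves at most r' dimensions for the cocycles,
and the coboundaries, which are cocycles, already have dimension at least r'. -/
theorem betti_eq_zero {m r r' : ℕ} (h : Module.finrank ℝ (C 20 (m + 1)) = r' + r)
    (h1 : r' ≤ Module.finrank ℝ (B 20 (m + 1))) (h2 : r ≤ Module.finrank ℝ (B 20 (m + 2))) :
    betti 20 (m + 1) = 0 := by
  have := finite_C_succ m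
  have h3 := finrank_map_add (m + 1) (C 20 (m + 1))
  have : Module.Finite ℝ (Z 20 (m + 1)) := Submodule.finiteDimensional_of_le inf_le_left
  have h4 : B 20 (m + 1) = Z 20 (m + 1) := by
    refine Submodule.eq_of_le_of_finrank_le (B_le_Z _) ?_
    change Module.finrank ℝ (B 20 (m + 2)) + Module.finrank ℝ (Z 20 (m + 1)) = _ at h3
    omega
  have h5 : betti 20 (m + 1) + _ = _ :=
    Submodule.finrank_quotient_add_finrank ((B 20 (m + 1)).submoduleOf (Z 20 (m + 1)))
  rw [(Submodule.submoduleOfEquivOfLe (B_le_Z _)).finrank_eq, h4] at h5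
  omega

/-- More than 20 arguments of weight at least 1 each cannot have total weight 20. -/
theorem finrank_C_of_le {m : ℕ} (hm : 20 ≤ m) : Module.finrank ℝ (C 20 (m + 1)) = 0 := by
  have h1 : ∀ h, N (m + 1) (fun _ => True) h = ∅ := fun h => by
    rw [Set.eq_empty_iff_forall_notMem]
    intro f hf
    have h2 : ∑ i, ((ex (f i)).1 + (ex (f i)).2 - 2) = 20 := hf.2.2.2.1
    have h3 := Finset.card_nsmul_le_sum Finset.univ
      (fun i : Fin (m + 1) => (ex (f i)).1 + (ex (f i)).2 - 2) 1 fun i _ => by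
        have := hf.2.2.1 i
        simp only at this
        omega
    rw [Finset.card_univ, Fintype.card_fin, smul_eq_mul] at h3
    omega
  have h4 := finrank_R (m + 1) fun _ => True
  rw [h1, h1, Set.ncard_empty] at h4
  rw [C_eq_R]
  exact h4


/-! ### Certificates for the rank of the coboundary in degrees 3 to 10. -/

set_option maxRecDepth 100000

/-- The types and equations used in degree 3. -/
def cert3 : List (List (ℕ × ℕ × ℕ) × List ℕ × List ℕ × List ℕ) := [([(402882784, 0, 2)],
  [248275764448], [], []),
([(369393856, 1, 2), (335839456, 1, 2), (436437184, 1, 2)], [352492652641, 309475875013,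
  309477971140], [], []),
([(402980992, 1, 2)], [343839840385], [], []),
([(302285056, 1, 2)], [319203546208], [], []),
([(436502656, 1, 2)], [460870255744], [], []),
([(335806720, 0, 2)], [319173165154], [], []),
([(369361120, 1, 2)], [390036914275], [], []),
([(403013728, 1, 2)], [378199578721], [], []),
([(436469920, 1, 2)], [460903809121], [], []),
([(402948256, 1, 2)], [425503885408], [], []),
([(369426592, 1, 2)], [390071486560], [], []),
([(335872192, 1, 2)], [354670481536], [], []),
([(436535392, 1, 2)], [460937331808], [], []),
([(369459328, 1, 2)], [390137482336], [], []),
([(402915520, 1, 2)], [425470363744], [], [])]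

/-- Together with `checkDim_cert3`, whose value 17 is the full dimension in degree 3, this shows
that d is injective there. -/
theorem kerDim_cert3 : Certified 3 cert3 0 := by decide +kernel

/-- The types and equations used in degree 4. -/
def cert4 : List (List (ℕ × ℕ × ℕ) × List ℕ × List ℕ × List ℕ) := [([(275146571936, 0, 1)],
  [287220739245216, 285021718086816, 283922207507616], [], [276220320933]),
([(378225721472, 2, 3)], [399296836042881, 283950124797060, 285050710164612], [], []),
([(446911643744, 2, 3), (378292797536, 2, 3), (378259275872, 2, 3), (412585459808, 2, 3),
  (378192232544, 0, 3), (309506310272, 2, 3), (378192199808, 2, 3), (343866048608, 2, 3),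
  (309539799200, 2, 3), (309506343008, 0, 3), (275113017536, 0, 3), (343899537536, 2, 3),
  (446945165408, 2, 3), (309472755872, 0, 3), (412551905408, 2, 3), (481271349344, 2, 3)],
  [471931141850208, 471931140802656, 399363408003171, 399363406955619, 399363410101344,
  399363409053792, 399363408006240, 399363406958688, 399363408004194, 399363411148896,
  399363409052769, 399363408005217, 399363409051746, 399363406956642, 399363410100321,
  399363406957665, 355417306828899, 359815353335907, 326795641651332, 325696130024580,
  282849608601699, 281722176574560, 281723249267808, 283950191874147, 325696131072132,
  323500327993476, 283950192922722, 355418380569699, 324597692138628, 318003846743172,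
  285050775146595, 283950193971297, 320201796255876, 286151358419043, 323497107818628,
  281723251359843, 285050776195170, 355419454310499, 356518965937251, 322399743673476,
  282820614460512], [], [319171068003]),
([(412652503136, 2, 3), (343933091936, 2, 3), (343899570272, 2, 3)], [363148242685026,
  362048732105826, 360949221526626, 357650689789026, 359849710947426, 359849713043553], [],
  [347156419683, 348231210081]),
([(343832494208, 0, 3)], [363083885282400, 363082812589152], [], []),
([(309539864672, 2, 3)], [326830071579744, 316943057912928], [], [311688404067, 312763194465]),
([(343933059200, 2, 3)], [363182573061216, 363182572013664], [], []),
([(412551938144, 2, 3)], [435647290641504, 435647292736608, 435647291689056], [], []),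
([(412618981472, 2, 3)], [316907624466528, 316907624465505, 316907624464482], [], []),
([(343866015872, 2, 3)], [363113888219232, 363113887171680, 363113886124128, 363113885076576,
  363113884029024], [], []),
([(378225754208, 2, 3)], [363113916501090, 399397766663265, 363113918597217, 326830039105632], [],
  []),
([(309539831936, 0, 1)], [325764887184480, 324666449298528], [], [311688370308, 312761063556]),
([(412585427072, 2, 3)], [435681618920544], [], []),
([(378326319200, 2, 3)], [399398840405088, 399398840404065], [], []),
([(343832461472, 2, 3)], [363079560987744, 363079559940192, 363079558892640, 363079557845088,
  363079556796513], [], []),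
([(412518383744, 0, 3)], [435612899476608], [], []),
([(446878122080, 1, 3)], [435614038198368], [], []),
([(412518351008, 2, 3)], [435580718679168], [], []),
([(378158645408, 0, 3)], [399332301997152, 399331229303904], [], []),
([(378259243136, 2, 3)], [399432095990880, 399432094943328], [], []),
([(240753279200, 0, 3)], [254234382763104], [], [248274715872, 248272619745]),
([(446878089344, 2, 3)], [471896783192160, 471863528653920], [], []),
([(309506277536, 2, 3)], [326829999263874, 326830037008482, 326830034912355, 281723213615235,
  326830035961953, 326830032817251], [], []),
([(481237827680, 2, 3)], [508180664779872], [], []),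
([(275146539200, 2, 3)], [290546155422816, 290546154375264, 290546153327712], [], []),
([(309472723136, 2, 3)], [326795678352480, 326795677304928, 326795676257376], [], [])]

/-- The selected types carry 118 of the 124 dimensions, and 118 - 11 = 107 = 124 - 17 is already the
largest rank compatible with d² = 0; the other types are not needed. The later certificates are
chosen in the same way. -/
theorem kerDim_cert4 : Certified 4 cert4 11 := by decide +kernel

/-- The types and equations used in degree 5. -/
def cert5 : List (List (ℕ × ℕ × ℕ) × List ℕ × List ℕ × List ℕ) := [([(316900068425856, 3, 4)],
  [334638704807249024, 253573982383639682, 254700981802110080, 254700981802109057,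
  255827976925613186, 255827981220578432], [], []),
([(457603129933920, 3, 4)], [483222303809832032], [], []),
([(316900034904192, 3, 4)], [254700946399039619, 253573946983714946, 254700945326346371,
  254700946402185344, 255827944742719619, 255827943670026371, 255827945817508994], [], []),
([(352118733144192, 3, 4)], [371758216287224960], [], []),
([(281681336664192, 0, 4)], [223144996000367744], [], []),
([(457568803749984, 1, 4)], [483187121616684128, 483188220054570080], [], []),
([(281750056075392, 3, 4)], [288448291119694976, 288448291118647424, 288448288972213376,
  288448288972212353], [], [286151323816067, 285050740543619, 285050744735873, 282849573998723,
  283950159368321, 283950159367298]),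
([(281715662815392, 3, 4)], [297418070502310016, 297419168940195968], [], []),
([(387371791122528, 3, 4)], [408914078190371936], [], []),
([(352084406992992, 3, 4), (246496964575392, 0, 4), (316934428164192, 3, 4), (422453117583456, 3,
  4), (281715696402528, 3, 4), (352118766698592, 3, 4), (281750056108128, 1, 2), (281750089629792,
  1, 2), (281715729924192, 1, 4), (422487477289056, 3, 4), (387268779049056, 3, 4),
  (281715696369792, 3, 4), (352153126404192, 3, 4), (316865708752992, 0, 4), (352084440514656, 3,
  4), (387303105232992, 3, 4)], [371793469345203296, 371793467198769248, 408948129764836448,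
  408948128691095648, 371793468272510048, 408948130837529696, 371793466125027425,
  446102792329856096, 371828619357553760, 371793400659313760, 371793437164405856,
  446102791257162848, 371828616137377889, 371828618284860512, 371793401733054560,
  371828617211119712, 371793435016923233, 371793399584522339, 371793433944229985,
  371793400659312737, 371828585031369824, 296399920586393696, 371793432869440610,
  371828583956580449, 371793436090665056, 371793436091712608, 371828582881791074,
  371793401732005985, 371793400658264162, 371828586104063072, 371793431796747362,
  371793432871536737, 371828585029273697, 371828583956581472, 371828586103015520,
  371793433943182433, 371828585030322272, 371793435019019360, 371793431798843489,
  371793435017971808, 371793432870489185, 371828585029274720, 371828583955532897,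
  371793435016924256, 295272922241666144, 371793433946326112, 371793431797795937,
  297519224498261090, 371793433945278560, 297451088095841378, 371793433944231008,
  371793431798844512, 371793432873632864, 371793432871537760, 371793431799892064,
  294144823312616546, 297453288193885280, 297453287119095905, 297453289266578528,
  297453288192837728, 252419494167838817, 252418393581424736, 253545394074681440,
  253573946983746659, 252419493093051488, 252419493093048419, 252418393581423713,
  252419493093050465, 291891962607406178, 252418393581422690, 254700946402217057,
  254700946402215011, 253545394070491232, 252417292995006563, 252419493093049442,
  289637963774659682, 255827944745895011, 290764963191032930, 256954943089575011,
  290764963192081505, 255827945818588259, 290764963193129057, 291891962608454753,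
  290764963193130080, 291891962609502305, 252419492018261090, 291891962609503328,
  253543192900800611, 293018962025875553, 291891962610550880, 291891962611598432,
  293018962025876576, 293018962027971680, 293018962026924128, 297484039051415651,
  295232242462097507, 297484040125156451, 296358140218314851, 295232243534790755,
  296358140219362403, 297484040126204003, 297484041198897251, 295232240312520803,
  295232272494365795, 296358143439537251, 296358141292055651, 296358141294150755,
  297484041200992355, 297484043346378851, 295232242462100576, 297484041198899297,
  297484042272638051, 296358142367891555, 296358143440584803, 295232278933667939,
  296358142365796451, 297484072307001443, 295232241387309155, 297484042272641120,
  292980441573625955, 294106379029971041, 295232242462098530, 294106342554208355,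
  296358141293103203, 297484041199944803, 295232241386261603, 294107443138528355,
  294106375807699043, 294106343626901603, 295232242461049955, 296358172401207395,
  294106342554210401, 294106343628996707, 295232243532695651, 297485139637833824,
  295232242458954851, 294107443139575907, 295232242462099553, 295232243536887905,
  292980443719012451, 292980475901904995, 294107472099150947, 295232278935766112,
  296358177766768739, 297484072308048995, 294107478538453091, 295232278934717537,
  291854579216288864, 294106379028924512, 294107478541598816, 292982671703936099,
  294106377954133091, 292980476974598243, 290729778821074016, 295232276787233891,
  294106379028922466, 296358173473900643, 297484076599869539, 295232277860974691,
  295233378446345312, 292980479123130464, 295232274640799843, 295232278936813664,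
  296358175620334691, 292980479122081889, 294106376881440866, 295232275715588195,
  295232273568106595, 291857871308721251, 295232275715590241], [290553665323105, 290553698844769],
  [282849608601698, 282849574032482, 283950193971296, 283949120229473, 283950159402080,
  290512896693344, 283949085660257]),
([(316865708720256, 1, 4)], [334610181928386656, 334609083490500704, 334607985052614752,
  334606885542035552, 334609082417807456, 334607983979921504, 334607982906180704,
  334606884468294752, 334605784957715552, 333478784466550883, 334605783883974752], [], []),
([(352050080809056, 1, 4)], [371763779341485152, 371762680903599200, 371761582465713248,
  371760481880344673, 371762679830905952, 371761581393020000, 371761580318230625,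
  371759381294976098], [], []),
([(352050047254656, 3, 4)], [371725263182105696, 371726363768520800, 371726362693732448,
  371725263150646400, 371726363767473248, 371726361588532352, 371727462205359200,
  371727463279100000, 260294159903129732], [], []),
([(387234419343456, 3, 4)], [371758248530906210, 371758250678388833, 371758249605695585,
  371758249604648033, 371758252825871456, 371758250680484960], [], []),
([(281681336631456, 2, 4)], [297451054777401443, 297448857901629539, 223144991677120640,
  223144991675025536, 223142794797154436], [], [290478503400608, 290478503398562, 290478503399585,
  290479578187937, 290479578188960, 290480652977312]),
([(387337464938592, 3, 4)], [408948095435508833, 408983280849880160, 408949194947136608,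
  408949194947135585, 408948096510298208], [], []),
([(316900068458592, 3, 4)], [252419494133270624, 252418393548950624, 252417292964630624,
  297487370872261730, 252419494134318176, 252418393549998176, 252419494135365728,
  252419494133269601, 252418393548949601, 252417292964629601, 252419494132221026,
  297488470383889505, 252418393547901026, 252416192379261026, 252417292963581026,
  252419494134317153, 252418393549997153, 252419494132220003, 252418393547900003], [], []),
([(316934394609792, 3, 4)], [334673889180385376, 288484535274966146, 334673889179337824,
  334673889179336801, 334673888105596001, 334673889178288226, 334673888105594978,
  334673888104546403, 297519227688058976], [], []),
([(422418791399520, 3, 4)], [260335972481368163, 408912944351512673, 446067641244812384,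
  446067610136708192, 446067642317505632, 446067609062967392, 446067607989226592,
  446033556416857184, 446067609064014944, 446067607989225569], [], []),
([(316865675165856, 3, 4)], [297448858975371362, 297448857902678114, 297448856828937314], [], []),
([(316968787869792, 3, 4)], [324477088172180576, 324477088171133024], [], [319168891161698,
  320269476531296, 320269476530273, 322470640979042]),
([(246531357868128, 0, 1)], [258078681586568288, 258077582075989088, 258077582045610080,
  255827981255180384], [], [249832040241251, 250930478127203]),
([(316900101980256, 1, 4)], [334645366299395168, 334639871964578912, 334644266787768416,
  334638772452952160, 334643167276141664, 258077582044562528, 256952781649347680,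
  255827981254132832, 256951682137720928], [], [326796780376160]),
([(316968754348128, 1, 2)], [331230253153386593, 331230253154435168, 327854753530904672,
  325602953717220449, 331303916102847584, 326793724778613857, 334604655411724385,
  325602953717219426, 326760739428761699], [326871875190880, 325772363563105, 326870801449057],
  [319167782850659, 319168856592482, 320267294478434, 320269441962080, 320268368220257]),
([(387234419310720, 3, 4)], [408912944353608800, 371758248499479650, 370632349666377827,
  370632347519943779, 408912947570640992, 408912945423158369], [], []),
([(316934461685856, 3, 4)], [334642034512070753, 288477977968217186, 334673920319916128,
  334673921390513249, 288480176991472736, 334673924611736672], [], [])]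

theorem kerDim_cert5 : Certified 5 cert5 15 := by decide +kernel

/-- The types and equations used in degree 6. -/
def cert6 : List (List (ℕ × ℕ × ℕ) × List ℕ × List ℕ × List ℕ) := [([(324435266997747808, 0, 5)],
  [228464410791295221856], [], []),
([(432556842359554144, 4, 5)], [418726854982662980704], [], []),
([(468550420680245344, 4, 5), (360569617065803872, 4, 5)], [342706095471672263776], [], []),
([(360604767078154336, 4, 5)], [336980861460028687456], [], []),
([(396598379725029472, 4, 5), (396563195386495072, 4, 5)], [418690793232538897504,
  418690793232538896481, 418691919132445739104, 418690794333124265056, 418762848595309855840,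
  418693045032352580704], [], []),
([(360569582739619936, 4, 5)], [342706060318439737441, 380752468839814497376,
  342706061420097799264, 342706061417951365216, 342706060319513479264, 342706062517462991968,
  342706062518535685216, 342706061419025106016], [], []),
([(288441654350839936, 4, 5)], [226192342578085629058, 223884252167104760962,
  225038296274157309058, 223884249970228989058, 225038297372595195010, 223883126271492884608,
  223884251068666875010, 222730204764738555010, 225036047776098683008, 223884252169252243585,
  225038299571618449537, 225038297374742677633], [], []),
([(360499213995475072, 4, 5)], [226192376632880269441], [], []),
([(432556808033370208, 4, 5)], [418726820928942082144, 418726823127964288096,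
  418726822029526402144, 418726822028453708896], [], []),
([(324470485729509472, 2, 5), (360499248388735072, 4, 5), (288476907408818272, 2, 5)],
  [266581822469623088224, 264275979460410443872, 265428900965017289824, 228500475871123047520,
  227346426267586104418, 226192378864147205218, 226192378865219898466, 227346424070710332514,
  227345299269242424418, 226191251865803525218, 228500471473076538466, 228499348871704579168,
  226192376666198740066, 226192378865221995616, 228498221873360899168], [], [297485206179383392,
  297486305691010144]),
([(360534467053453408, 4, 5)], [380716475227167622240, 380681606414915961952], [], []),
([(288476838689374336, 4, 5)], [304553850163284804736, 304552723164941124736], [], []),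
([(360534398367563872, 4, 5)], [380716442272958350432, 380716443372468929632,
  380716442274031043680, 380716441174520464480, 380716441173446723680, 380716440073935095905], [],
  []),
([(432521658021019744, 2, 5)], [418691952116690421856, 456738327683854861408,
  456737201783949067360, 418694203916503057504, 418693079116107842656], [], []),
([(360499248355213408, 4, 5), (360464064016679008, 1, 5)], [380680449759822054496,
  380680448661384168544, 380680447562946282592, 380680448660311475296, 380680446463435703392,
  380680445364997817440, 380680446462361962592, 380680445363924076640, 380680446464508396640,
  380680445366070510688, 380680447561873589344, 380680447560799848544, 380680446461288220769,
  380680445362850334817, 380680414577628906592, 380680414576555165792, 380680413478117279840,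
  380680413477043539040, 380680413478118327392, 380680413477043538017, 380647795398348473440,
  380645542468990895200, 380646668368896689248, 380645542467916105825, 380646669466261881952,
  380645542467918201952, 380645542466843412577, 380645542465768623202, 380646669465187092577,
  380646668367823996000, 380647796464605561952, 380646669467334575200, 380647794267729790048,
  380646669466260834400], [], []),
([(288476873049112672, 4, 5), (288476838722928736, 4, 5), (324505635708338272, 4, 5),
  (252448076063703136, 2, 3), (252412857331908736, 4, 5), (324470451369803872, 4, 5),
  (324505670068043872, 4, 5), (252448076030148736, 4, 5), (324470485695987808, 0, 5)],
  [342634004926677778528, 258477526773703771264, 342634041241667470432, 342634040142156891232,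
  342634037943133636705, 342634037944207378528, 342634039042645264480, 342634040143229584480,
  342634039044791698528, 342634039043719005280, 342670065608428718176, 342670070004326696032,
  342670064511064573024, 342670064509990832224, 342670067807450924128, 342670065609502458976,
  342670066707940344928, 342670068905888810080, 342670068904816116832, 342670066706866604128,
  342670064508917090401, 342670065607354976353, 342670067805304490080, 342670066705792862305,
  342670101859025388640, 342670066709013038176, 342670065610575152224, 342670067806378230880,
  304623622971085422691, 342600259846451332192, 342635196798323491936, 342670033723695662176,
  342670032623110294624, 342670032623110293601, 266509693442796422272, 342670032623111342176,
  266510819341629523072, 266509694541234308224, 341483334121299247201, 342634035711929584738,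
  342634037909878049890, 342634035713004374113, 342635196795103316065, 342635196797250798688,
  342601385746357126240, 221545755863747268739, 342634036811440163938, 342636323795594478688,
  342600259846449236065, 342600258714724335715, 342634035713002277986, 342634036811441212513,
  342634035714079163488, 342601386846940398688, 342634035713004375136, 342635196796177057888,
  342634037910952839265, 341517112218015075424, 342634036812514953313, 342634035714077067361,
  342634035714076019809, 342634039009389677665, 342600259814235963490, 266508566442305259649,
  342601386845867705440, 221546882864240527489, 266508567541816887424, 342671159622528762976,
  342634035714077068384, 342671159621455022176, 342634036812516001888, 342634037910951791713,
  342634035714078115936, 342634037910952840288, 342634036812513905761, 342600259846447139938,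
  342634036812514954336, 342635162712422843488, 342634036813587646561, 342634039010463418465,
  342634040108901304417, 342634037912025532513, 342636323794521785440, 342601385746356078688,
  342637450792865465440, 221546882863165738114, 342634036813587647584, 221546881763653062787,
  342636323793448044640, 342602512746846192736, 342634040108901305440, 342634037912025533536,
  342634039010463419488, 342601384614631178338, 342635161613983909984, 342635163810859681888,
  342634039010464467040, 258440371011659631712, 261967810988432558179, 260813769115833568354,
  258440371011659630689, 263121859522523663458, 258440371011659628643, 258440371011659629666,
  260813765782942124131, 261967812087944185954, 261967813218595343458, 259593292515191689312,
  263121858392946247777, 259659721711321975906, 263121859492457875552, 261967815419761888354,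
  261967814317033229410, 261967813187455813729, 260813766914667023458, 264275906927035255906,
  265429954331546848354, 260813769081477007456, 264275906927037352033, 261967814286967441504,
  260813766882453751906, 263121858392945198179, 264275908027618528354, 260813769115834616929,
  258439244011166371939, 263121861723690208354, 259659720577451690083, 259659720610738703458,
  263121860622034242658, 263121860623106935906, 263121860623109032033, 258440369911073214562,
  258440371010584840291, 260813767981965379681, 261967814319178615906, 260813768013104909410,
  260812643215930919008, 261967814318105922658, 261967814319180712033, 261965562519367027810,
  260813768015250295906, 261967813187454764131, 263121861721546919008, 260813769111542795362,
  263121859491383084131, 259659721711324073056, 260813767981965377635, 260813768014177602658,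
  264275908026545835106, 260813768015252392033, 263121861722617515106, 261967814285892650083,
  260812679465453848672, 261967816516056484960, 261967852766650010722, 261967846172804615266,
  263121860591968453729, 260813805365360690272, 261965600968983809122, 260813805363211111522,
  260813805364283804770, 259659757960847002720, 260813800967314181218, 259659757960844905570,
  263118522474664397920, 260813805365359642720, 260813805365357546593, 259659755761823747170,
  260813805364284853345, 261967852767723752545, 261967852768799589472, 261965600968985906272,
  261967852767724800097, 263121900171163699297, 261967852769872282720, 261967847272316243041,
  260813805364285900897, 261967852767724801120, 261967852768797493345, 258477525708553977952,
  263121900171163700320, 258477525707478138979, 258476398708061765731, 258476398708061768800,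
  263121893577316207714, 261967852768798541920, 258471897309605137504, 258476400908158763104,
  259628194312761773152, 258475273908738196579, 260776614414617021539, 258475275009325662304,
  258473022108926610529, 259623692914305141856, 258477526809137250400, 258475273907666550883,
  258474148008833453152, 258477525708550832227, 258477524607967561825, 258476400906011279458,
  260779989917461777504, 258477526806988718179, 258474148008832403554, 258477526809136201825,
  259625943613533457504, 258475272808154924131, 258474148008833450083, 258474149109418819681,
  258476399808645038179, 258476400908155617379, 258477524607967559779, 258475275007177130083,
  258475272808154926177, 258476399808647135329, 260783367617179156579, 259629321313253982304,
  258474149107271336035, 259624817713626614881, 258475273907666552929, 258476399807572345954,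
  258476400904937537635, 258477526804843331683, 258477526804844380258, 261929534819712240739,
  259630446112573359202, 258476398706988024931, 258476400907082924131, 258475273908740292706,
  258477524606894866531, 260777739218233461856, 258476399807572344931, 258474146908248083554,
  258473023209511977058, 258476399807571297379, 259627067312269560931, 258474148006685968483,
  258475271707569556579, 259630448311597662304, 258474148008833452129, 261929535919223868514,
  258475272808153876579, 258474146908248082531, 259629320212667566177, 258475273908739246177,
  259627069513438200931, 258476399808646088800, 261931785522161781856, 258476398708060718179,
  260778862916969565283], [260335972481372256, 260335972481371233, 260335972481369187,
  260334872969744481, 259208973062901858], [255827975851871362, 254700978580884610,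
  334604684371296355, 254700981801060481, 334605783881875555, 253573982383639681,
  253573982418239587, 253573982418242656, 253573982418240610, 253573982418241633,
  254699882325082210, 254700981836709985, 254700981836711008, 254699882325084256]),
([(252412891725168736, 1, 5)], [266548008157741941856, 266546883357346727008,
  266545758556951512160, 266548008091202486368, 266546883290807271520, 266545758490412056672,
  266548006992764600416, 266546882192369385568, 266545757391974170720, 266546881093931499616,
  266545756293536284768, 266544631493141069920, 266546881092858806368, 266545756292463591520], [],
  [260296391170068577, 260297490681696352]),
([(288441688710578272, 2, 5)], [227346427365993613408, 227345300366576192608,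
  228500475870017880160, 226192378861969345633, 227346427365994660960, 228500475870016831585,
  228499348870600459360, 228498221871183038560, 227346427365993612385, 228500471471973466210,
  227346427365992563810, 228499348870599410785, 226192378861969344610, 226192378861968296035,
  227345300366576191585, 228498221871181989985, 228497094871764569185, 228500471471972417635,
  227345300366575143010, 226191251862550875235, 227346427365994659937, 227344173367157722210,
  222730204766918545504, 222730203666332127331, 227346427365992562787, 222730204766918542435,
  226192378861969343587, 222730204766917496929, 222730204766918543458, 223883125170938974306,
  223883125170938973283, 223884252171432231010, 223884251070845816929, 223884251070845814883,
  225038298475359502435, 223884252171432233056, 225038299575945920608, 225037172575452663904,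
  223884252171432232033, 227341889684759511139, 228494811189366358114, 223884251070845815906], [],
  [297449987482189921, 297449987482190944, 297451086993817696]),
([(288512023061463136, 4, 5)], [295371014922196615264, 295371013822686036064,
  295371014921122874464, 295371013822684988512, 299977071441089791072, 295371012723174409312,
  295333859159047275616, 295371011623662782560, 298823024036577151072, 295333859159046228064,
  299943291176490241120, 298791495571790236768, 297639699967090232416, 297638575166695017568,
  295371014922195566689, 295371014921122873441, 295371013822684987489], [], [291891921809443939,
  293018921227914337, 290764927759682656, 291891922883185762, 293018921226864739,
  293018922301656160, 293018921227912291, 291891925030669408, 291891923956927585,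
  293018922301653091, 290764927759679587, 294145920644285539, 291891927176053858,
  291891927178151008, 291891923955877987, 293018923373298787, 290764926685940833]),
([(288512091747352672, 4, 5), (288512057421168736, 2, 3)], [295408238852887905376,
  301135656526867956832, 301135655428430070880, 301135654329992184928, 301135655427356330080,
  301135654328918444128, 301135652132042672224, 301135654327844703328, 301135653229406817376,
  301135652130968931424, 302288574734014710880, 300049165283544368224, 304594417742153614432,
  298829814617165891680, 299981609122354269280, 301135653230480558176, 295371050103345351778],
  [297526953257306208, 297525853745679456], [290764998592006240, 289637963774659681,
  291891998009427040, 290763863681502304, 290763863681501281, 290764963193129056,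
  291890863099970656]),
([(324505601348599936, 4, 5), (288476873082634336, 4, 5)], [258477561989216438368,
  304623659256042849376, 304623657057020643424, 304623658156531222624, 304623654859070082145,
  258477561990290179168, 342670031522524925026, 304623658154382691426, 304623657057019594849,
  304623658155457481824, 304623654859071129697, 304623654859069033570, 304623659254968060001,
  304623660353405945953, 304623659254969108576, 304623655958582757472, 304623660354480735328,
  304623655957509016672, 304623660353405946976, 304623657057018547297, 304623657058094384224,
  304623654859071130720, 304623655957507968097, 304623658156530174049, 304623657058092289120,
  304623655958581708897, 304623658156532270176, 304623659254968061024, 304623659253894319201,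
  304623660354479687776, 304623657055944805474, 304623658155456433249, 304623655956434226274], [],
  []),
([(288512023094984800, 4, 5)], [304659689150393451616, 304659688051955565664,
  304659686953517679712, 304659685855079793760], [], [291891927211672672, 291891927207480418,
  293018923405773922, 291891925062093922, 289637928374733922, 290764927793204320,
  290764927793203297, 290764927791107170, 291891927209577568, 293018926625950816])]

theorem kerDim_cert6 : Certified 6 cert6 62 := by decide +kernel

/-- The types and equations used in degree 7. -/
def cert7 : List (List (ℕ × ℕ × ℕ) × List ℕ × List ℕ × List ℕ) := [([(332293735780966301792, 5,
  6)], [267073262383634943413346, 268255006925855886773346, 268255006925856961563744,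
  269436750341078486453346], [], []),
([(369151195131366441056, 5, 6)], [230439249129847377726561, 230439250255747284569184,
  230439250255747284568161, 230439250255747282472034, 231620995922767548353634,
  231620993670968809458786], [], []),
([(332329764577951711328, 5, 6)], [350894112279034383664224, 350894113403834778879072,
  306070832276928223872096, 307252576816951218766944], [], []),
([(369151265465717325920, 4, 6)], [233984483948349643392096], [], []),
([(332221713371300495456, 0, 6), (369187259078364201056, 5, 6)], [350826123687290923484256,
  350824971891686223479904, 350823820096081523475552, 350824970766885828265056,
  350823818971281128260704, 350823817846480733045856, 350822666050876033041504,
  350822664926075637826656, 350823817845382295159904, 350822666049777595155552,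
  350822664924977199940704, 350821512004572104721504], [], [342599132814817493091]),
([(406008654481766580320, 5, 6)], [428739371143089273013344, 350820327556770626110560,
  350820326429771207642208, 350820326429771207641185, 350820327555671114483808], [], []),
([(258470765873481252992, 5, 6)], [272938174077569974009953], [], []),
([(332257777352657961056, 3, 6)], [350857218790918104123489, 350857221042717917807712,
  350857219916818010966112, 350858372839422128391264, 350859524633927317816416,
  350860677555431923614816], [], []),
([(332329799727964061792, 5, 6)], [350822666082730731734112], [], []),
([(295400282817919287392, 5, 6)], [268255038452154907068513, 267073296161732702603361,
  268255044079452196800609, 268255039578053740169313, 269436782993276339849313,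
  267073299539429201905761, 269436782994374777735265, 267073299538330764019809,
  268255042953553363699809, 267072145492027909441632, 268255042954651801585761,
  269436784120273610836065, 268255040702854135384161, 267072146617926742542432,
  268255041829851406370913, 268255040703952573270113, 267073298412431930919009], [], []),
([(369151230315704975456, 5, 6)], [350857255944484378739808, 350857252570083193095264,
  389816742273462025946208, 350857254819683983524960, 350857253694883588310112,
  389779848786445258033248, 389782154629454470677600, 389781035484915930596448,
  389779851038245070668896], [], []),
([(295400318002257821792, 5, 6)], [311934591049389786104928, 311934591048291348218976,
  311934591048290275525728, 311934589922391442424928, 311934591047190763898976,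
  311934589922390368684128, 311934589921290857056353, 267073336692995476522080,
  269436820149039490237536], [], []),
([(295364254020900356192, 5, 6)], [311897697560143960575072, 311897697561244545942624,
  311897697561243472201824, 311897697560143960574049, 311897696434244053732449,
  311860804073097127919712], [], []),
([(295400282852245471328, 5, 6)], [311934627074857131672672, 311934625950056736457824,
  311934624825256341242976, 311934622575655550813280, 311934623700455946028128,
  267073299574582434432096, 268255044114605429326944, 269436788654628424221792], [], []),
([(221577277760421888128, 5, 6)], [233978687749691838431328, 233978686623793005330528,
  233978685497893099536480, 233978684371993192694880, 233978687748592326803553,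
  233978686623791931588705, 233978685497893098487905, 233978684371993192693857,
  233978683246093285852257], [], [223884252171398677632, 225038296273083567234,
  222730204766884989057, 223884251067593133186, 223884249969155247234, 223884252167104760961,
  223884251070813309057, 223884249970228989057]),
([(295364289239598596192, 3, 6), (221541248963436511328, 0, 6)], [311901225002320831546464,
  311902376797925531550816, 194986880245107127322721], [], []),
([(295364254055260061792, 5, 6)], [311901189008708184671328, 311898885417498784662624,
  311904646613268376421472, 311903494817663676417120, 311902343022058976412768,
  311901191226454276408416, 311900039430849576404064, 311898887635244876399712,
  311903493692863281202272, 311902341897258581197920, 311901190101653881193568,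
  311900038306049181189216, 311898886510444481184864, 311897734714839781180512,
  311902340772458185983072, 311901188976853485978720, 311900037181248785974368,
  311898885385644085970016, 311897733590039385965664, 311901187852053090763872,
  311900036056448390759520, 311898884260843690755168, 311897732465238990750816,
  311866602489501024617568, 311865450693896324613216, 311865449569095929398368,
  311902340771359748097120, 311901188975755048092768, 311900037180150348088416,
  311898885384545648084064, 311901187850954652877920, 311900036055349952873568,
  311898884259745252869216, 311897732464140552864864, 311898883134944857654368,
  311866601363602191516768, 311865449567997491512416, 311864296647592396293216,
  311865448442098658411616, 311864296646493958407264, 311864295520595125306464,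
  311866601330616874140768, 311865449535012174136416, 311866600205816478925920,
  311865448410211778921568, 311864296614607078917216, 311865447285411383706720,
  311864295489806683702368, 311864294363907850601568, 311863142568303150597216,
  311863141442404317496416, 311864294362808340022368, 311863142567203640018016], [],
  [304594382591067522144]),
([(258470801092213047392, 3, 6), (258470765907840991328, 5, 6), (221577277760455442528, 0, 1),
  (258470765907874512992, 5, 6)], [272938207855667764626528, 272941664366180599696482,
  272941665493181091907680, 272942853317581705675872, 272941664367281185065057,
  272938206729767858832480, 272904772005033673883745, 272938207854567179258976,
  272940511446877164635232, 272943972460989627073632, 272939394589319556596832,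
  272939363028970036626528, 272938210106366991894624, 272940511445776579266657,
  272940511446876090894432, 272941664368379622952032, 272940547473472981403745,
  272938207855666689838176, 272941702647875838772320, 272941664367281185066080,
  272941664367281186113632, 272938210106366992942176, 272938210106365918153824,
  272938208980467086100576, 272942817288785792959584, 272944008488686029210720,
  272940548599372888246368, 272941664368380697740384, 272939361900871106530401,
  272942854475335237469280, 272939358525372558836832, 272938205603867950942305,
  272903617957629160194147, 272940548634525047030880, 272939361903071203525728,
  272944006236886216575072, 272940512571676486109280, 272942856693081329206368,
  272941666617980413380705, 272943970210290398757984, 272939361901970618157153,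
  272938206728667271367778, 272941665493180018165857, 272939363027870524999776,
  272939360777172370424928, 272904770880233278668897, 272944006237986800895072,
  272938208981565522938976, 272941700396076026136672, 272938206728667272416353,
  272940511446875016105057, 272939359650171879262305, 272940512571676485061728,
  272903619084628578664545, 272942854442382100890720, 272942818414685698753632,
  272942853316481121355872, 272942855567181423412320, 272903617958728671821922,
  272938210105266406526049, 272938205603866877201505, 272942854443480538776672,
  272938208981565522937953, 272941667744979831850080, 272938206729767856736353,
  272938208980467085053024, 272940512572777070429280, 272941701520877495092320,
  272940548600473472566368, 272941666652064169691232, 272902465037225139766368,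
  272943972493973871756384, 272905924958423043116130, 272904773163917854739553,
  272938210140449674463328, 272938209013451329734753, 272938209014550841362528,
  272938210139352310318176, 272907079005827556804705, 272905926085422461585505,
  272938211265250069678176, 272938209012355039331424, 272938209014552987796576,
  272905926084322949958753, 272904773162818343111778, 272907077879927649963105,
  272905927210222856800353, 272938209013452403476576, 272938211266350653998176,
  272938209013454549910624, 272938210139350162835553, 272938210139353383011424,
  272938209012352891848801, 272938207887553570375776, 272938211264150558050401,
  272938210140451820897376, 272938209014549767620705, 272938209014551915103328,
  272938207887552496633953, 272938206760555225647201, 272938211265251143418976,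
  272938207886455132489824, 272938209013453477217376, 272938210138252798691424,
  272938210138254945125472, 272938211264151631792224, 272938211264153778226272,
  272938207886454058748001, 272904773163918928481376, 272907077879928723704928,
  272907079006928142173280, 272905927211323442168928, 272907080131728537388128,
  272905926085423535327328, 233984487290896130344032, 233984482787300797940832,
  233984482787299725247584, 233984482787298651506784, 232802741622774206400609,
  232802738245078780840032, 233983332117591710861409, 228044598546668081774688,
  232802741622777426576480, 228043445624063963300961, 233983333243493764138080,
  232802740496875373299809, 226862854004476129414242, 232802741622776353883232,
  228075729681291303552096, 231620995954655502633057, 229224037245880886231136,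
  226864006924881224633442, 228043445625162400138338, 226864008052981226375265,
  228075729681291302504544, 226864006925981808954465, 229256320175009296386144,
  228044599673699710371936, 232802703342181702272096, 228075727427292466613346,
  230439215384737084442721, 228075729681324555995232, 228044599672599126050913,
  232802704469211151960161, 231620959926959102592096, 230439214257737665973346,
  229257473096546081933409, 229257474223543352920161, 230436910668727289220192,
  230439216511736502912096, 226862854003346550948963, 229257470842515066293346,
  228075728554291885083744, 230403474818094272219232, 226862854004446062575715,
  231620958799959684122721, 230439218763566347815009, 230439217638765952600161,
  229257471969514484762721, 229257473096513903232096, 226864006925950668374115,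
  231620958799959684123744, 229256321302008712759392, 231619805878455077276769,
  226864005798951252000867, 232800397499172488579169, 232800398626171907048544],
  [228494812289952776288, 228500440688898474080, 227346394384970154080, 227346393284386881632,
  228500441787336360032, 258477561989216439392, 258470771409698294882], [228494808988193525859,
  222730204764768964707, 223884252168207863907, 223884249970259398755, 222730204765841657955,
  222730203666331078755, 227343013383493521507, 226191217778793517155, 225038297373698297955,
  225036047772907868259, 225036045574959403107, 223883126269374763107, 223883125169864183907,
  223884251069769977955, 223883125170936877155, 227341888583098306659, 225037172573303083107,
  266542377529736531040, 266542377529736530017, 266542377529738626144, 266542377529737578592,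
  266543504529154999392, 266543503429644420192, 266543503429643372640, 266547972939042652257,
  266547972939043700832]),
([(221541248963436478592, 0, 6)], [233947557775085596148832, 233947556650285200933984,
  233946403728781667828832, 233947555523285784560736, 233946403727681084556384], [],
  [228464410790220399744, 228463284891387298944, 228463283790801930369])]

theorem kerDim_cert7 : Certified 7 cert7 115 := by decide +kernel

/-- The types and equations used in degree 8. -/
def cert8 : List (List (ℕ × ℕ × ℕ) × List ℕ × List ℕ × List ℕ) := [([(226895168455468998819936, 3,
  4)], [237176324652481749956265056, 237179865272170597769643104, 235968579424487838192862304,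
  239594175137663603791987808], [233984487290896131392608], [229257504623910284527712,
  230438096244627695830112, 230439249166132301628512]),
([(302452996117401931186272, 6, 7)], [232308744246220887823582304, 232308744246217589289748577,
  232308744246219789385696352, 232308744246219788313003104, 232308744246218689875117152,
  232308744246218688801376352, 232307562500552769119814752, 232308744243969090157380704,
  232308744243967990646801504, 232308744243969088010946656, 232308744243967988499318881,
  232308744243966890061432929, 232307562500552765899638881, 232308744243969089084687456,
  232307562500551668535494752, 232308744243967989573060704, 232307562500552768047121504,
  232307562500551667461752929, 232307562500552766973380704], [], []),
([(378010823814484875903072, 6, 7)], [235969792261885186111800416], [], []),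
([(264674064254444803031136, 6, 7)], [235969759977829089422706785, 235969754215475566299154529,
  234759648957161725393733729, 235969755368397069832259681, 235969755368395971394373729,
  235969758826033484722702433, 234759653568845542650382433, 237179860625583913466693729,
  234759653567720742255167585, 233549544851769388021418081, 238389968188613764167338081,
  235969756520191576094378081, 235969757674237880022698081, 233549547157612397235111008,
  235969757673113079627483233, 234759652414799238722062433], [], [272945123130694420235360]),
([(302416066600457526706272, 6, 7)], [197246350208865981258924131], [], []),
([(302416102629254545637472, 5, 7)], [239558752742456497766761568, 239559933334077215177016416,
  239557572150835780354411616, 239557572150835780354410593, 239562294517317549414253664,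
  239561113925697931514578016, 239562294516191649507412064, 239561113924570932096109664,
  239561113924570932096108641, 239558752741329497273502818, 239557572150835779280669793,
  199665383625287458338475106, 199666565370955580263467104, 199665383625289659509212256], [],
  [311861988518698539912290, 311861988520899710649440, 311861988520898637956192,
  311861988520897563167840, 311861988520897563166817, 311861988519799126329440,
  311861988519799125281888, 311861988519799125280865, 311861988519798051540065,
  311861988520898636908640, 311863142566103053601888, 311863142566103053600865,
  311863142568302076855392, 311863142567203638969440, 311863142567202565228640,
  311864296613507567289440]),
([(302489853576752331325536, 6, 7)], [319345462216802953860319328, 319346642808423671271621728,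
  319345463370850358372959328], [], []),
([(264710921713795203170400, 6, 7)], [271033293067853553599612000, 271033293067853552526918752,
  271033293067852453015292000, 271033293066726553108449377], [], [267073262383634943413345,
  268255006924756375145570]),
([(302526747064865390690400, 6, 7)], [319383241148664780370838624, 319385601177858810679755872],
  [], []),
([(340268785439675133296736, 6, 7)], [359241193701657898872046688], [], []),
([(302489889605514990551136, 6, 7)], [319349038578183213741605984, 319347856834767991141925984,
  319350218016882426546062432], [], []),
([(264710957742592188579936, 6, 7)], [271033331113135074483209312, 271033329961339469783204960,
  271033328809543865083200608, 271033329960214669387990112, 271033328808419064687985760,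
  271033327656623459987981408, 271033327655498659592766560, 271033326503703054892762208,
  273444099204894027201741920, 270994370438985024790430816, 270994370438983926352544864,
  270994368133142017724220512, 270994370438983925279851616, 270994370437858026446750816,
  270994368133142016651527264, 274621143286140694864955489], [], [268255044078352685172833,
  268255038452154907068512, 267073295035832795760737, 269436782994373703993441,
  268255039578054813910112, 267073298413532515239008, 267073299539431348339808,
  268255040703954719704160, 268255039576954228541537, 267073296161732702603360,
  269436782993275266107489, 267073299537231252392033, 269436784118075661322337,
  268255041827653456857185, 267073299539429201905760, 268255040703951499528289,
  269436785243974494423137]),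
([(264710957777742200930400, 6, 7)], [279454487719850752602113120, 279455668310345570106573920,
  279456847749044782911030368], [], []),
([(189079307075601825890400, 0, 7)], [199666565370989664019776608], [], [])]

theorem kerDim_cert8 : Certified 8 cert8 66 := by decide +kernel

/-- The types and equations used in degree 9. -/
def cert9 : List (List (ℕ × ℕ × ℕ) × List ℕ × List ℕ × List ℕ) := [([(309674052198868507313668192,
  7, 8)], [201980261433287144091696597088, 201980262613878764809107899488], [], []),
([(270988425971200373756624992, 7, 8)], [245305711898916795862200976480], [], []),
([(271026241796551443944144992, 7, 8)], [237884154071234449185190282336,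
  237881733859566028095555208288, 286158940939408290310470599776, 237884154072386244789890286688,
  237882943965976136442722747488], [], [])]

theorem kerDim_cert9 : Certified 9 cert9 5 := by decide +kernel

/-- The types and equations used in degree 10. -/
def cert10 : List (List (ℕ × ℕ × ℕ) × List ℕ × List ℕ × List ℕ) :=
  [([(237878066937377013930012016736, 8, 9)], [206827753856581340671058987025504], [], [])]

theorem kerDim_cert10 : Certified 10 cert10 0 := by decide +kernel


/-! ### Dimensions, Betti numbers and the Euler characteristic. -/

theorem checkDim_true : ∀ m < 20, checkDim (m + 1) (fun _ => true)
    ([0, 0, 17, 124, 423, 791, 801, 414, 96, 9, 1].getD m 0) = true := by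
  decide +kernel

/-- Degrees up to 20 are counted, higher ones vanish by the number of arguments; the default 0 of
`getD` covers all degrees from 12 on. -/
theorem finrank_C_succ (m : ℕ) : Module.finrank ℝ (C 20 (m + 1)) =
    [0, 0, 17, 124, 423, 791, 801, 414, 96, 9, 1].getD m 0 := by
  by_cases hm : m < 20
  · exact finrank_C_of_checkDim (checkDim_true m hm)
  · rw [finrank_C_of_le (by omega), List.getD_eq_default _ _ (by simp; omega)]

theorem typeOK_cert3 : ∀ b ∈ cert3, ∀ t ∈ b.1, TypeOK 3 t := by decide +kernel
theorem typeOK_cert4 : ∀ b ∈ cert4, ∀ t ∈ b.1, TypeOK 4 t := by decide +kernel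
theorem typeOK_cert5 : ∀ b ∈ cert5, ∀ t ∈ b.1, TypeOK 5 t := by decide +kernel
theorem typeOK_cert6 : ∀ b ∈ cert6, ∀ t ∈ b.1, TypeOK 6 t := by decide +kernel
theorem typeOK_cert7 : ∀ b ∈ cert7, ∀ t ∈ b.1, TypeOK 7 t := by decide +kernel
theorem typeOK_cert8 : ∀ b ∈ cert8, ∀ t ∈ b.1, TypeOK 8 t := by decide +kernel
theorem typeOK_cert9 : ∀ b ∈ cert9, ∀ t ∈ b.1, TypeOK 9 t := by decide +kernel
theorem typeOK_cert10 : ∀ b ∈ cert10, ∀ t ∈ b.1, TypeOK 10 t := by decide +kernel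

theorem checkDim_cert3 : checkDim 3 (hasType cert3) 17 = true := by decide +kernel
theorem checkDim_cert4 : checkDim 4 (hasType cert4) 118 = true := by decide +kernel
theorem checkDim_cert5 : checkDim 5 (hasType cert5) 331 = true := by decide +kernel
theorem checkDim_cert6 : checkDim 6 (hasType cert6) 537 = true := by decide +kernel
theorem checkDim_cert7 : checkDim 7 (hasType cert7) 441 = true := by decide +kernel
theorem checkDim_cert8 : checkDim 8 (hasType cert8) 154 = true := by decide +kernel
theorem checkDim_cert9 : checkDim 9 (hasType cert9) 13 = true := by decide +kernel
theorem checkDim_cert10 : checkDim 10 (hasType cert10) 1 = true := by decide +kernel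

theorem le_finrank_B_3 : 17 ≤ Module.finrank ℝ (B 20 (3 + 1)) :=
  le_finrank_B cert3 0 17 17 (by norm_num) (by norm_num) typeOK_cert3 kerDim_cert3
    checkDim_cert3 rfl

theorem le_finrank_B_4 : 107 ≤ Module.finrank ℝ (B 20 (4 + 1)) :=
  le_finrank_B cert4 11 118 107 (by norm_num) (by norm_num) typeOK_cert4 kerDim_cert4
    checkDim_cert4 rfl

theorem le_finrank_B_5 : 316 ≤ Module.finrank ℝ (B 20 (5 + 1)) :=
  le_finrank_B cert5 15 331 316 (by norm_num) (by norm_num) typeOK_cert5 kerDim_cert5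
    checkDim_cert5 rfl

theorem le_finrank_B_6 : 475 ≤ Module.finrank ℝ (B 20 (6 + 1)) :=
  le_finrank_B cert6 62 537 475 (by norm_num) (by norm_num) typeOK_cert6 kerDim_cert6
    checkDim_cert6 rfl

theorem le_finrank_B_7 : 326 ≤ Module.finrank ℝ (B 20 (7 + 1)) :=
  le_finrank_B cert7 115 441 326 (by norm_num) (by norm_num) typeOK_cert7 kerDim_cert7
    checkDim_cert7 rfl

theorem le_finrank_B_8 : 88 ≤ Module.finrank ℝ (B 20 (8 + 1)) :=
  le_finrank_B cert8 66 154 88 (by norm_num) (by norm_num) typeOK_cert8 kerDim_cert8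
    checkDim_cert8 rfl

theorem le_finrank_B_9 : 8 ≤ Module.finrank ℝ (B 20 (9 + 1)) :=
  le_finrank_B cert9 5 13 8 (by norm_num) (by norm_num) typeOK_cert9 kerDim_cert9
    checkDim_cert9 rfl

theorem le_finrank_B_10 : 1 ≤ Module.finrank ℝ (B 20 (10 + 1)) :=
  le_finrank_B cert10 0 1 1 (by norm_num) (by norm_num) typeOK_cert10 kerDim_cert10
    checkDim_cert10 rfl

/-- The entry with index m bounds the rank of d on degree m + 1. Beyond the list, the default is the
trivial bound 0. -/
theorem le_finrank_B_add_two (m : ℕ) :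
    [0, 0, 17, 107, 316, 475, 326, 88, 8, 1].getD m 0 ≤ Module.finrank ℝ (B 20 (m + 2)) := by
  by_cases hm : m < 10
  · interval_cases m
    · exact Nat.zero_le _
    · exact Nat.zero_le _
    · exact le_finrank_B_3
    · exact le_finrank_B_4
    · exact le_finrank_B_5
    · exact le_finrank_B_6
    · exact le_finrank_B_7
    · exact le_finrank_B_8
    · exact le_finrank_B_9
    · exact le_finrank_B_10
  · rw [List.getD_eq_default _ _ (by simp; omega)]
    exact Nat.zero_le _

/-- Each dimension is the sum of two neighbouring rank bounds: 17 = 0 + 17, 124 = 17 + 107, 423 =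
107 + 316, 791 = 316 + 475, 801 = 475 + 326, 414 = 326 + 88, 96 = 88 + 8, 9 = 8 + 1, 1 = 1 + 0. -/
theorem betti_succ (m : ℕ) : betti 20 (m + 1) = 0 := by
  have h := finrank_C_succ m
  have h2 := le_finrank_B_add_two m
  cases m with
  | zero => exact betti_eq_zero (r' := 0) (r := 0) h (Nat.zero_le _) h2
  | succ m =>
    refine betti_eq_zero (h.trans ?_) (le_finrank_B_add_two m) h2
    by_cases hm : m < 10
    · interval_cases m <;> rfl
    · rw [List.getD_eq_default _ _ (by simp; omega), List.getD_eq_default _ _ (by simp; omega),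
        List.getD_eq_default _ _ (by simp; omega)]

theorem eulerChar_eq : eulerChar 20 = 1 := by
  rw [eulerChar, finsum_eq_sum_of_support_subset (s := Finset.range 12)]
  · rw [Finset.sum_range_succ']
    simp only [finrank_C_succ, finrank_C_zero.2.1]
    decide
  · intro m hm
    rw [Finset.coe_range, Set.mem_Iio]
    by_contra h
    obtain ⟨k, rfl⟩ : ∃ k, m = k + 1 := ⟨m - 1, by omega⟩
    refine hm ?_
    simp only [finrank_C_succ]
    rw [List.getD_eq_default _ _ (by simp; omega), Nat.cast_zero, mul_zero]

end GKF

end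

theorem mainTheorem3 :
    (∀ m : ℕ, Module.Finite ℝ (GKF.C 20 m)) ∧
    (Module.finrank ℝ (GKF.C 20 0) = 1 ∧
      Module.finrank ℝ (GKF.C 20 1) = 0 ∧
      Module.finrank ℝ (GKF.C 20 2) = 0 ∧
      Module.finrank ℝ (GKF.C 20 3) = 17 ∧
      Module.finrank ℝ (GKF.C 20 4) = 124 ∧
      Module.finrank ℝ (GKF.C 20 5) = 423 ∧
      Module.finrank ℝ (GKF.C 20 6) = 791 ∧
      Module.finrank ℝ (GKF.C 20 7) = 801 ∧
      Module.finrank ℝ (GKF.C 20 8) = 414 ∧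
      Module.finrank ℝ (GKF.C 20 9) = 96 ∧
      Module.finrank ℝ (GKF.C 20 10) = 9 ∧
      Module.finrank ℝ (GKF.C 20 11) = 1 ∧
      ∀ m : ℕ, 12 ≤ m → Module.finrank ℝ (GKF.C 20 m) = 0) ∧
    GKF.eulerChar 20 = 1 ∧
    GKF.betti 20 0 = 1 ∧
    ∀ m : ℕ, 1 ≤ m → GKF.betti 20 m = 0 := by
  refine ⟨fun m => ?_, ⟨GKF.finrank_C_zero.2.1, GKF.finrank_C_succ 0, GKF.finrank_C_succ 1,
    GKF.finrank_C_succ 2, GKF.finrank_C_succ 3, GKF.finrank_C_succ 4, GKF.finrank_C_succ 5,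
    GKF.finrank_C_succ 6, GKF.finrank_C_succ 7, GKF.finrank_C_succ 8, GKF.finrank_C_succ 9,
    GKF.finrank_C_succ 10, fun m hm => ?_⟩, GKF.eulerChar_eq, GKF.finrank_C_zero.2.2,
    fun m hm => ?_⟩
  · cases m with
    | zero => exact GKF.finrank_C_zero.1
    | succ m => exact GKF.finite_C_succ m
  · obtain ⟨k, rfl⟩ : ∃ k, m = k + 1 := ⟨m - 1, by omega⟩
    rw [GKF.finrank_C_succ, List.getD_eq_default _ _ (by simp; omega)]
  · obtain ⟨k, rfl⟩ : ∃ k, m = k + 1 := ⟨m - 1, by omega⟩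
    exact GKF.betti_succ k
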